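/- **Theorem 4.1.** Consider the allocation of a set $M$ of $m$ indivisible chores to a set $N$ of $n$ agents with weights $w_i>0$, $\sum_{i\in N} w_i=1$, and additive cost functions $c_i\ge 0$, so that $c_i(S)=\sum_{e\in S}c_i(e)$. An allocation $X=(X_i)_{i\in N}$ is a partition of $M$ into (possibly empty) bundles. It is *WEF1* if for all $i,j\in N$ either $X_i=\emptyset$ or there is $e\in X_i$ with $c_i(X_i\setminus\{e\})/w_i\le c_i(X_j)/w_j$. It is *Pareto optimal* if there is no allocation $Y$ with $c_i(Y_i)\le c_i(X_i)$ for all $i\in N$ and strict inequality for at least one $i$. The instance is *bi-valued* if there are constants $a,b\ge 0$ with $c_i(e)\in\{a,b\}$ for all $i\in N$ and $e\in M$. There is a polynomial-time algorithm that, given any bi-valued instance (that is, $n$, $m$, the weights and the costs $c_i(e)$), computes an allocation that is both WEF1 and Pareto optimal. More precisely, there is one random-access program, using only addition, subtraction, multiplication and comparison of numbers, that has this property for all bi-valued instances with real or rational data. On real instances its running time is at most a polynomial in $n+m$ when an operation on reals costs one unit and an operation on indices (natural numbers) costs one unit plus the bit length of its result. On rational instances its running time, where every arithmetic operation and every memory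 read costs one unit plus the bit length of its result and every comparison or write one further unit, is at most a polynomial in the bit length of the input. -/

import Mathlib

/-! ## Weighted allocation of chores -/

/-- An instance with agents `Fin n` and items `Fin m`: positive weights that sum to `1` and
nonnegative costs of the single items (the cost of a bundle is additive, see `bundleCost`).
The numbers live in `F`, which is `ℝ` or `ℚ` in the theorem. -/
structure ChoreInstance (F : Type) [Field F] [LinearOrder F] (n m : ℕ) where
  weight : Fin n → F
  cost : Fin n → Fin m → F
  weight_pos : ∀ i, 0 < weight i
  weight_sum : ∑ i, weight i = 1
  cost_nonneg : ∀ i e, 0 ≤ cost i e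

/-- An allocation gives each item to exactly one agent; bundles may be empty. -/
abbrev Allocation (n m : ℕ) : Type := Fin m → Fin n

/-- The bundle of agent `i`. -/
def Allocation.bundle {n m : ℕ} (X : Allocation n m) (i : Fin n) : Finset (Fin m) :=
  Finset.univ.filter (fun e => X e = i)

namespace ChoreInstance

variable {F : Type} [Field F] [LinearOrder F] {n m : ℕ}

/-- The additive cost of a set of items for agent `i`. -/
def bundleCost (I : ChoreInstance F n m) (i : Fin n) (S : Finset (Fin m)) : F :=
  ∑ e ∈ S, I.cost i e

/-- There are two constants `a, b ≥ 0` such that every agent values every item at `a` or `b`. -/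
def BiValued (I : ChoreInstance F n m) : Prop :=
  ∃ a b : F, 0 ≤ a ∧ 0 ≤ b ∧ ∀ i e, I.cost i e = a ∨ I.cost i e = b

/-- Weighted envy-freeness up to one item, for chores. -/
def WEF1 (I : ChoreInstance F n m) (X : Allocation n m) : Prop :=
  ∀ i j : Fin n, X.bundle i = ∅ ∨
    ∃ e ∈ X.bundle i,
      I.bundleCost i (X.bundle i \ {e}) / I.weight i ≤ I.bundleCost i (X.bundle j) / I.weight j

/-- `Y` Pareto dominates `X`: nobody's cost goes up, and somebody's cost goes down. -/
def Dominates (I : ChoreInstance F n m) (Y X : Allocation n m) : Prop :=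
  (∀ i, I.bundleCost i (Y.bundle i) ≤ I.bundleCost i (X.bundle i)) ∧
    ∃ i, I.bundleCost i (Y.bundle i) < I.bundleCost i (X.bundle i)

def ParetoOptimal (I : ChoreInstance F n m) (X : Allocation n m) : Prop :=
  ¬ ∃ Y : Allocation n m, I.Dominates Y X

end ChoreInstance

/-! ## Random-access programs with running time

Imperative programs over two kinds of arrays: index arrays, whose cells are natural numbers, and
value arrays, whose cells are elements of an ordered ring. Arrays are named by natural
numbers and have a cell for each natural number; initially all cells except the input are `0`.
A program text uses no numerical constants other than fixed natural numbers, so the same program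
can be run over `ℝ` and over `ℚ`. -/

namespace RAM

/-- Memory: `idx a k` is cell `k` of index array `a`, `val a k` is cell `k` of value array `a`. -/
structure Store (F : Type) where
  idx : ℕ → ℕ → ℕ
  val : ℕ → ℕ → F

/-- Index expressions; `sub` is truncated subtraction of natural numbers. -/
inductive NExp : Type
  | const (k : ℕ)
  | read (a : ℕ) (k : NExp)
  | add (x y : NExp)
  | sub (x y : NExp)
  | mul (x y : NExp)

/-- Value expressions. -/
inductive VExp : Type
  | ofNat (k : NExp)
  | read (a : ℕ) (k : NExp)
  | add (x y : VExp)
  | sub (x y : VExp)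
  | mul (x y : VExp)

/-- Tests. -/
inductive BExp : Type
  | nle (x y : NExp)
  | vle (x y : VExp)
  | not (b : BExp)
  | and (b c : BExp)

/-- Programs. -/
inductive Prog : Type
  | skip
  | setIdx (a : ℕ) (k : NExp) (x : NExp)
  | setVal (a : ℕ) (k : NExp) (x : VExp)
  | seq (p q : Prog)
  | ite (b : BExp) (p q : Prog)
  | loop (b : BExp) (p : Prog)

variable {F : Type} [Field F] [LinearOrder F]

def NExp.eval (s : Store F) : NExp → ℕ
  | const k => k
  | read a k => s.idx a (k.eval s)
  | add x y => x.eval s + y.eval s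
  | sub x y => x.eval s - y.eval s
  | mul x y => x.eval s * y.eval s

def VExp.eval (s : Store F) : VExp → F
  | ofNat k => (k.eval s : F)
  | read a k => s.val a (k.eval s)
  | add x y => x.eval s + y.eval s
  | sub x y => x.eval s - y.eval s
  | mul x y => x.eval s * y.eval s

def BExp.holds (s : Store F) : BExp → Prop
  | nle x y => x.eval s ≤ y.eval s
  | vle x y => x.eval s ≤ y.eval s
  | not b => ¬ b.holds s
  | and b c => b.holds s ∧ c.holds s

/-- The time to evaluate an index expression: every operation costs `1` plus the number of
binary digits of its result (`Nat.size`). -/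
def NExp.time (s : Store F) : NExp → ℕ
  | const k => 1 + Nat.size k
  | read a k => k.time s + (1 + Nat.size (s.idx a (k.eval s)))
  | add x y => x.time s + y.time s + (1 + Nat.size (x.eval s + y.eval s))
  | sub x y => x.time s + y.time s + (1 + Nat.size (x.eval s - y.eval s))
  | mul x y => x.time s + y.time s + (1 + Nat.size (x.eval s * y.eval s))

/-- The time to evaluate a value expression: every operation costs `1` plus the `size` of its
result. With `size = 0` this is unit cost for the operations on values. -/
def VExp.time (size : F → ℕ) (s : Store F) : VExp → ℕ
  | ofNat k => k.time s + (1 + size (k.eval s : F))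
  | read a k => k.time s + (1 + size (s.val a (k.eval s)))
  | add x y => x.time size s + y.time size s + (1 + size (x.eval s + y.eval s))
  | sub x y => x.time size s + y.time size s + (1 + size (x.eval s - y.eval s))
  | mul x y => x.time size s + y.time size s + (1 + size (x.eval s * y.eval s))

def BExp.time (size : F → ℕ) (s : Store F) : BExp → ℕ
  | nle x y => x.time s + y.time s + 1
  | vle x y => x.time size s + y.time size s + 1
  | not b => b.time size s + 1
  | and b c => b.time size s + c.time size s + 1

def Store.setIdx (s : Store F) (a k x : ℕ) : Store F :=
  { s with idx := Function.update s.idx a (Function.update (s.idx a) k x) }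

def Store.setVal (s : Store F) (a k : ℕ) (x : F) : Store F :=
  { s with val := Function.update s.val a (Function.update (s.val a) k x) }

/-- `Exec size p s s' t`: program `p`, started in memory `s`, halts in memory `s'` after time
exactly `t`, the values being charged by `size`. -/
inductive Exec (size : F → ℕ) : Prog → Store F → Store F → ℕ → Prop
  | skip (s : Store F) : Exec size Prog.skip s s 1
  | setIdx (s : Store F) (a : ℕ) (k x : NExp) :
      Exec size (Prog.setIdx a k x) s (s.setIdx a (k.eval s) (x.eval s))
        (k.time s + x.time s + 1)
  | setVal (s : Store F) (a : ℕ) (k : NExp) (x : VExp) :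
      Exec size (Prog.setVal a k x) s (s.setVal a (k.eval s) (x.eval s))
        (k.time s + x.time size s + 1)
  | seq {p q : Prog} {s s' s'' : Store F} {t t' : ℕ} :
      Exec size p s s' t → Exec size q s' s'' t' →
        Exec size (Prog.seq p q) s s'' (t + t')
  | iteTrue {b : BExp} {p q : Prog} {s s' : Store F} {t : ℕ} :
      b.holds s → Exec size p s s' t →
        Exec size (Prog.ite b p q) s s' (b.time size s + t)
  | iteFalse {b : BExp} {p q : Prog} {s s' : Store F} {t : ℕ} :
      ¬ b.holds s → Exec size q s s' t →
        Exec size (Prog.ite b p q) s s' (b.time size s + t)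
  | loopStop {b : BExp} {p : Prog} {s : Store F} :
      ¬ b.holds s → Exec size (Prog.loop b p) s s (b.time size s)
  | loopStep {b : BExp} {p : Prog} {s s' s'' : Store F} {t t' : ℕ} :
      b.holds s → Exec size p s s' t → Exec size (Prog.loop b p) s' s'' t' →
        Exec size (Prog.loop b p) s s'' (b.time size s + t + t')

end RAM

namespace ChoreInstance

variable {F : Type} [Field F] [LinearOrder F] {n m : ℕ}

/-- The input memory: index array `0` holds `n` and `m`, value array `0` holds the weights, value
array `1` holds the cost matrix row by row (the cost of item `e` for agent `i` is in cell
`i * m + e`), and everything else is `0`. -/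
def inputStore (I : ChoreInstance F n m) : RAM.Store F where
  idx a k := if a = 0 ∧ k = 0 then n else if a = 0 ∧ k = 1 then m else 0
  val a k :=
    if a = 0 then (if h : k < n then I.weight ⟨k, h⟩ else 0)
    else if a = 1 then
      (if h : k < n * m then I.cost (Fin.divNat ⟨k, h⟩) (Fin.modNat ⟨k, h⟩) else 0)
    else 0

/-- On input `I` the program `p` halts after time at most `T`, and index array `1` then holds the
allocation `X`: its cell `e` is the agent that receives item `e`. -/
def ComputesWithin (I : ChoreInstance F n m) (size : F → ℕ) (p : RAM.Prog)
    (X : Allocation n m) (T : ℕ) : Prop :=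
  ∃ (s : RAM.Store F) (t : ℕ), RAM.Exec size p I.inputStore s t ∧ t ≤ T ∧
    ∀ e : Fin m, s.idx 1 e = X e

end ChoreInstance

/-- The number of bits of a rational number: a sign and the binary digits of the numerator and of
the denominator. -/
def ratBits (x : ℚ) : ℕ := 1 + Nat.size x.num.natAbs + Nat.size x.den

/-- The input length of a rational instance. -/
def ChoreInstance.bitLength {n m : ℕ} (I : ChoreInstance ℚ n m) : ℕ :=
  n + m + ∑ i, ratBits (I.weight i) + ∑ i, ∑ e, ratBits (I.cost i e)

namespace RAM

variable {F : Type}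

/-- The size of an index expression, numerical constants counted in unary. -/
def NExp.nodes : NExp → ℕ
  | const k => k + 1
  | read _ k => k.nodes + 1
  | add x y => x.nodes + y.nodes + 1
  | sub x y => x.nodes + y.nodes + 1
  | mul x y => x.nodes + y.nodes + 1

/-- Expressions whose value exceeds the cells of the memory by at most one. -/
def NExp.mild : NExp → Bool
  | const k => decide (k ≤ 1)
  | read _ _ => true
  | add (read _ _) (const 1) => true
  | add _ _ => false
  | sub x _ => x.mild
  | mul _ _ => false

theorem NExp.eval_le_of_mild {s : Store F} {B : ℕ} (hs : ∀ a k, s.idx a k ≤ B) :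
    ∀ x : NExp, x.mild = true → x.eval s ≤ B + 1
  | const k, h => by simp [NExp.mild] at h; simp [NExp.eval]; omega
  | read a k, _ => (hs _ _).trans (Nat.le_succ _)
  | add (read a k) (const 1), _ => by simpa [NExp.eval] using hs a _
  | sub x y, h => (Nat.sub_le _ _).trans (NExp.eval_le_of_mild hs x h)

theorem NExp.eval_le {s : Store F} {B : ℕ} (hs : ∀ a k, s.idx a k ≤ B) (x : NExp) :
    x.eval s ≤ (B + 2) ^ x.nodes := by
  have h1 : ∀ k, 1 ≤ (B + 2) ^ k := fun k => Nat.one_le_pow _ _ (by omega)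
  have hadd : ∀ p q : ℕ, (B + 2) ^ p + (B + 2) ^ q ≤ (B + 2) ^ (p + q + 1) := by
    intro p q
    rw [pow_succ, pow_add]
    nlinarith [h1 p, h1 q, Nat.mul_le_mul (h1 p) (h1 q)]
  induction x with
  | const k =>
    simp only [NExp.eval, NExp.nodes]
    exact (Nat.lt_pow_self (by omega : 1 < B + 2)).le.trans
      (Nat.pow_le_pow_right (by omega) (Nat.le_succ k))
  | read a k _ =>
    simp only [NExp.eval, NExp.nodes]
    refine (hs _ _).trans ?_
    rw [pow_succ]
    nlinarith [h1 k.nodes]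
  | add x y hx hy => exact (Nat.add_le_add hx hy).trans (hadd _ _)
  | sub x y hx hy => exact (Nat.sub_le _ _).trans ((hx.trans (Nat.le_add_right _ _)).trans (hadd _ _))
  | mul x y hx hy =>
    simp only [NExp.eval, NExp.nodes]
    calc _ ≤ (B + 2) ^ x.nodes * (B + 2) ^ y.nodes := Nat.mul_le_mul hx hy
      _ = (B + 2) ^ (x.nodes + y.nodes) := (pow_add _ _ _).symm
      _ ≤ _ := Nat.pow_le_pow_right (by omega) (Nat.le_succ _)

theorem _root_.Nat.size_le_of_le_pow {x A k : ℕ} (hk : k ≠ 0) (h : x ≤ A ^ k) :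
    Nat.size x ≤ k * Nat.size A := by
  rw [Nat.size_le, mul_comm, pow_mul]
  exact h.trans_lt (Nat.pow_lt_pow_left (Nat.lt_size_self A) hk)

theorem NExp.nodes_pos (x : NExp) : 0 < x.nodes := by cases x <;> simp [NExp.nodes]

theorem NExp.size_eval_le {s : Store F} {B : ℕ} (hs : ∀ a k, s.idx a k ≤ B) (x : NExp) :
    Nat.size (x.eval s) ≤ x.nodes * Nat.size (B + 2) :=
  Nat.size_le_of_le_pow x.nodes_pos.ne' (x.eval_le hs)

def VExp.nodes : VExp → ℕ
  | ofNat k => k.nodes + 1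
  | read _ k => k.nodes + 1
  | add x y => x.nodes + y.nodes + 1
  | sub x y => x.nodes + y.nodes + 1
  | mul x y => x.nodes + y.nodes + 1

/-- A bound for the time of one operation: `P` bounds the expressions, `B` the index cells and `L`
the size of the input values. -/
def opBound (P B L : ℕ) : ℕ := 1 + 4 ^ P * (L + P * Nat.size (B + 2) + 2)

theorem opBound_mono (P : ℕ) {B B' : ℕ} (h : B ≤ B') (L : ℕ) : opBound P B L ≤ opBound P B' L := by
  unfold opBound
  have := Nat.size_le_size (Nat.add_le_add_right h 2)
  gcongr

theorem one_add_mul_size_le_opBound (P B L : ℕ) : 1 + P * Nat.size (B + 2) ≤ opBound P B L := by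
  unfold opBound
  have : 1 ≤ 4 ^ P := Nat.one_le_pow _ _ (by omega)
  nlinarith [Nat.zero_le L, Nat.zero_le (P * Nat.size (B + 2))]

theorem NExp.time_le {s : Store F} {P B : ℕ} (L : ℕ) (hs : ∀ a k, s.idx a k ≤ B) (x : NExp)
    (hP : x.nodes ≤ P) : x.time s ≤ x.nodes * opBound P B L := by
  have key : ∀ y : NExp, y.nodes ≤ P → 1 + Nat.size (y.eval s) ≤ opBound P B L := by
    intro y hy
    have h1 := y.size_eval_le hs
    have h2 := one_add_mul_size_le_opBound P B L
    have h3 := Nat.mul_le_mul_right (Nat.size (B + 2)) hy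
    omega
  induction x with
  | const k =>
    have := key (const k) hP
    simp only [NExp.eval, NExp.time, NExp.nodes] at *
    nlinarith [Nat.zero_le (k * opBound P B L)]
  | read a k ih =>
    have := key (read a k) hP
    simp only [NExp.eval, NExp.time, NExp.nodes] at *
    have := ih (by omega)
    linarith
  | add x y hx hy =>
    have := key (add x y) hP
    simp only [NExp.eval, NExp.time, NExp.nodes] at *
    have := hx (by omega)
    have := hy (by omega)
    linarith
  | sub x y hx hy =>
    have := key (sub x y) hP
    simp only [NExp.eval, NExp.time, NExp.nodes] at *
    have := hx (by omega)
    have := hy (by omega)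
    linarith
  | mul x y hx hy =>
    have := key (mul x y) hP
    simp only [NExp.eval, NExp.time, NExp.nodes] at *
    have := hx (by omega)
    have := hy (by omega)
    linarith

variable [Field F]

/-- A measure of numbers that arithmetic operations increase only moderately. -/
structure SizeBound (size : F → ℕ) : Prop where
  add : ∀ x y, size (x + y) ≤ 2 * (size x + size y)
  sub : ∀ x y, size (x - y) ≤ 2 * (size x + size y)
  mul : ∀ x y, size (x * y) ≤ 2 * (size x + size y)
  cast : ∀ k : ℕ, size (k : F) ≤ Nat.size k + 2

theorem VExp.size_eval_le {size : F → ℕ} (hsize : SizeBound size) {s : Store F} {P B L : ℕ}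
    (hs : ∀ a k, s.idx a k ≤ B) (hL : ∀ a k, size (s.val a k) ≤ L) (x : VExp) (hP : x.nodes ≤ P) :
    size (x.eval s) ≤ 4 ^ x.nodes * (L + P * Nat.size (B + 2) + 2) := by
  generalize hM : L + P * Nat.size (B + 2) + 2 = M
  have h1 : ∀ k, 1 ≤ 4 ^ k := fun k => Nat.one_le_pow _ _ (by omega)
  have hleaf : ∀ k, M ≤ 4 ^ k * M := fun k => Nat.le_mul_of_pos_left _ (h1 k)
  have hop : ∀ p q u v : ℕ, u ≤ 4 ^ p * M → v ≤ 4 ^ q * M →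
      2 * (u + v) ≤ 4 ^ (p + q + 1) * M := by
    intro p q u v hu hv
    have h2 : 4 ^ p + 4 ^ q ≤ 2 * 4 ^ (p + q) := by
      rw [pow_add]; nlinarith [h1 p, h1 q, Nat.mul_le_mul (h1 p) (h1 q)]
    calc 2 * (u + v) ≤ 2 * (4 ^ p * M + 4 ^ q * M) := by omega
      _ = 2 * (4 ^ p + 4 ^ q) * M := by ring
      _ ≤ 2 * (2 * 4 ^ (p + q)) * M := by gcongr
      _ = 4 ^ (p + q + 1) * M := by ring
  induction x with
  | ofNat k =>
    simp only [VExp.eval, VExp.nodes] at *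
    have h2 := k.size_eval_le hs
    have h3 := Nat.mul_le_mul_right (Nat.size (B + 2)) (show k.nodes ≤ P by omega)
    have := hsize.cast (k.eval s)
    exact le_trans (by omega) (hleaf _)
  | read a k =>
    have := hL a (k.eval s)
    exact le_trans (show size (s.val a (k.eval s)) ≤ M by omega) (hleaf _)
  | add x y hx hy =>
    simp only [VExp.eval, VExp.nodes] at *
    exact (hsize.add _ _).trans (hop _ _ _ _ (hx (by omega)) (hy (by omega)))
  | sub x y hx hy =>
    simp only [VExp.eval, VExp.nodes] at *
    exact (hsize.sub _ _).trans (hop _ _ _ _ (hx (by omega)) (hy (by omega)))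
  | mul x y hx hy =>
    simp only [VExp.eval, VExp.nodes] at *
    exact (hsize.mul _ _).trans (hop _ _ _ _ (hx (by omega)) (hy (by omega)))

theorem VExp.time_le {size : F → ℕ} (hsize : SizeBound size) {s : Store F} {P B L : ℕ}
    (hs : ∀ a k, s.idx a k ≤ B) (hL : ∀ a k, size (s.val a k) ≤ L) (x : VExp) (hP : x.nodes ≤ P) :
    x.time size s ≤ x.nodes * opBound P B L := by
  have key : ∀ y : VExp, y.nodes ≤ P → 1 + size (y.eval s) ≤ opBound P B L := by
    intro y hy
    refine Nat.add_le_add_left ((y.size_eval_le hsize hs hL hy).trans ?_) 1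
    exact Nat.mul_le_mul_right _ (Nat.pow_le_pow_right (by omega) hy)
  induction x with
  | ofNat k =>
    have := key (ofNat k) hP
    simp only [VExp.eval, VExp.time, VExp.nodes] at *
    have := k.time_le (P := P) L hs (by omega)
    linarith
  | read a k =>
    have := key (read a k) hP
    simp only [VExp.eval, VExp.time, VExp.nodes] at *
    have := k.time_le (P := P) L hs (by omega)
    linarith
  | add x y hx hy =>
    have := key (add x y) hP
    simp only [VExp.eval, VExp.time, VExp.nodes] at *
    have := hx (by omega)
    have := hy (by omega)
    linarith
  | sub x y hx hy =>
    have := key (sub x y) hP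
    simp only [VExp.eval, VExp.time, VExp.nodes] at *
    have := hx (by omega)
    have := hy (by omega)
    linarith
  | mul x y hx hy =>
    have := key (mul x y) hP
    simp only [VExp.eval, VExp.time, VExp.nodes] at *
    have := hx (by omega)
    have := hy (by omega)
    linarith

def BExp.nodes : BExp → ℕ
  | nle x y => x.nodes + y.nodes + 1
  | vle x y => x.nodes + y.nodes + 1
  | not b => b.nodes + 1
  | and b c => b.nodes + c.nodes + 1

theorem BExp.time_le {size : F → ℕ} (hsize : SizeBound size) {s : Store F} {P B L : ℕ}
    (hs : ∀ a k, s.idx a k ≤ B) (hL : ∀ a k, size (s.val a k) ≤ L) (x : BExp) (hP : x.nodes ≤ P) :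
    x.time size s ≤ x.nodes * opBound P B L := by
  have h1 : 1 ≤ opBound P B L := by unfold opBound; omega
  induction x with
  | nle x y =>
    simp only [BExp.time, BExp.nodes] at *
    have := x.time_le (P := P) L hs (by omega)
    have := y.time_le (P := P) L hs (by omega)
    linarith
  | vle x y =>
    simp only [BExp.time, BExp.nodes] at *
    have := x.time_le hsize hs hL (P := P) (by omega)
    have := y.time_le hsize hs hL (P := P) (by omega)
    linarith
  | not b ih =>
    simp only [BExp.time, BExp.nodes] at *
    have := ih (by omega)
    linarith
  | and b c hb hc =>
    simp only [BExp.time, BExp.nodes] at *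
    have := hb (by omega)
    have := hc (by omega)
    linarith

variable [LinearOrder F]

/-- The index arrays of a memory. -/
abbrev Mem : Type := ℕ → ℕ → ℕ

def Mem.upd (σ : Mem) (a k x : ℕ) : Mem := Function.update σ a (Function.update (σ a) k x)

@[simp] theorem Mem.upd_self (σ : Mem) (a k x : ℕ) :
    σ.upd a k x a = Function.update (σ a) k x := by
  simp [Mem.upd]

@[simp] theorem Mem.upd_ne (σ : Mem) {a a' : ℕ} (k x : ℕ) (h : a' ≠ a) :
    σ.upd a k x a' = σ a' := by
  simp [Mem.upd, h]

/-- Unit-cost semantics of programs that do not write values: `Steps V p σ σ' t` says that `p`,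
run with value arrays `V`, transforms the index arrays `σ` into `σ'` in `t` steps. -/
inductive Steps (V : ℕ → ℕ → F) : Prog → Mem → Mem → ℕ → Prop
  | skip (σ : Mem) : Steps V Prog.skip σ σ 1
  | setIdx (σ : Mem) (a : ℕ) (k x : NExp) :
      Steps V (Prog.setIdx a k x) σ (σ.upd a (k.eval ⟨σ, V⟩) (x.eval ⟨σ, V⟩)) 1
  | seq {p q : Prog} {σ σ' σ'' : Mem} {t t' : ℕ} :
      Steps V p σ σ' t → Steps V q σ' σ'' t' → Steps V (Prog.seq p q) σ σ'' (t + t')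
  | iteTrue {b : BExp} {p q : Prog} {σ σ' : Mem} {t : ℕ} :
      b.holds ⟨σ, V⟩ → Steps V p σ σ' t → Steps V (Prog.ite b p q) σ σ' (1 + t)
  | iteFalse {b : BExp} {p q : Prog} {σ σ' : Mem} {t : ℕ} :
      ¬ b.holds ⟨σ, V⟩ → Steps V q σ σ' t → Steps V (Prog.ite b p q) σ σ' (1 + t)
  | loopStop {b : BExp} {p : Prog} {σ : Mem} :
      ¬ b.holds ⟨σ, V⟩ → Steps V (Prog.loop b p) σ σ 1
  | loopStep {b : BExp} {p : Prog} {σ σ' σ'' : Mem} {t t' : ℕ} :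
      b.holds ⟨σ, V⟩ → Steps V p σ σ' t → Steps V (Prog.loop b p) σ' σ'' t' →
        Steps V (Prog.loop b p) σ σ'' (1 + t + t')

/-! ### From steps to running time -/

def Prog.nodes : Prog → ℕ
  | skip => 1
  | setIdx _ k x => k.nodes + x.nodes + 1
  | setVal _ k x => k.nodes + x.nodes + 1
  | seq p q => p.nodes + q.nodes
  | ite b p q => b.nodes + p.nodes + q.nodes
  | loop b p => b.nodes + p.nodes

/-- Programs that write no values, and only mild expressions into index cells. -/
def Prog.mild : Prog → Bool
  | skip => true
  | setIdx _ _ x => x.mild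
  | setVal _ _ _ => false
  | seq p q => p.mild && q.mild
  | ite _ p q => p.mild && q.mild
  | loop _ p => p.mild

theorem Mem.upd_le {σ : Mem} {B : ℕ} (hs : ∀ a k, σ a k ≤ B) {a k x : ℕ} (hx : x ≤ B) (a' k' : ℕ) :
    σ.upd a k x a' k' ≤ B := by
  unfold Mem.upd
  rcases eq_or_ne a' a with rfl | h
  · rcases eq_or_ne k' k with rfl | h'
    · simpa using hx
    · simpa [h'] using hs _ _
  · simpa [h] using hs _ _

/-- The index cells grow by at most one per step, so that `t` steps of a mild program take time at
most `t` times a bound for the time of a single operation. -/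
theorem Steps.exists_exec {size : F → ℕ} (hsize : SizeBound size) {V : ℕ → ℕ → F} {L P : ℕ}
    (hL : ∀ a k, size (V a k) ≤ L) {p : Prog} {σ σ' : Mem} {t : ℕ} (h : Steps V p σ σ' t)
    (hp : p.mild = true) (hP : p.nodes ≤ P) (C : ℕ) :
    ∀ B, (∀ a k, σ a k ≤ B) → B + t ≤ C →
      (∀ a k, σ' a k ≤ B + t) ∧
        ∃ t', Exec size p ⟨σ, V⟩ ⟨σ', V⟩ t' ∧ t' ≤ t * (P * opBound P C L) := by
  have h1 : 1 ≤ opBound P C L := by unfold opBound; omega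
  have htest : ∀ (σ : Mem) (b : BExp) (B : ℕ), (∀ a k, σ a k ≤ B) → B ≤ C → b.nodes ≤ P →
      b.time size ⟨σ, V⟩ ≤ P * opBound P C L := by
    intro σ b B hB hBC hb
    refine (b.time_le hsize (s := ⟨σ, V⟩) hB hL hb).trans ?_
    exact Nat.mul_le_mul hb (opBound_mono P hBC L)
  induction h with
  | skip σ =>
    intro B hB hC
    refine ⟨fun a k => (hB a k).trans (Nat.le_succ _), 1, Exec.skip _, ?_⟩
    simp only [Prog.nodes] at hP
    nlinarith
  | setIdx σ a k x =>
    intro B hB hC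
    simp only [Prog.mild, Prog.nodes] at hp hP
    refine ⟨Mem.upd_le (fun a k => (hB a k).trans (Nat.le_succ _))
      (x.eval_le_of_mild (s := ⟨σ, V⟩) hB hp), _, Exec.setIdx _ _ _ _, ?_⟩
    have hk := k.time_le (s := ⟨σ, V⟩) (P := P) L hB (by omega)
    have hx := x.time_le (s := ⟨σ, V⟩) (P := P) L hB (by omega)
    have hm := opBound_mono P (show B ≤ C by omega) L
    calc _ ≤ k.nodes * opBound P C L + x.nodes * opBound P C L + opBound P C L := by
            gcongr
            · exact hk.trans (by gcongr)
            · exact hx.trans (by gcongr)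
      _ = (k.nodes + x.nodes + 1) * opBound P C L := by ring
      _ ≤ P * opBound P C L := by gcongr
      _ = _ := (one_mul _).symm
  | @seq p q σ σ' σ'' t t' _ _ ih1 ih2 =>
    intro B hB hC
    simp only [Prog.mild, Prog.nodes, Bool.and_eq_true] at hp hP
    obtain ⟨hB1, t1, he1, ht1⟩ := ih1 hp.1 (by omega) B hB (by omega)
    obtain ⟨hB2, t2, he2, ht2⟩ := ih2 hp.2 (by omega) (B + t) hB1 (by omega)
    refine ⟨fun a k => (hB2 a k).trans (by omega), _, Exec.seq he1 he2, ?_⟩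
    rw [add_mul]; omega
  | @iteTrue b p q σ σ' t hb _ ih =>
    intro B hB hC
    simp only [Prog.mild, Prog.nodes, Bool.and_eq_true] at hp hP
    obtain ⟨hB1, t1, he1, ht1⟩ := ih hp.1 (by omega) B hB (by omega)
    refine ⟨fun a k => (hB1 a k).trans (by omega), _, Exec.iteTrue hb he1, ?_⟩
    have := htest σ b B hB (by omega) (by omega)
    rw [add_mul]; omega
  | @iteFalse b p q σ σ' t hb _ ih =>
    intro B hB hC
    simp only [Prog.mild, Prog.nodes, Bool.and_eq_true] at hp hP
    obtain ⟨hB1, t1, he1, ht1⟩ := ih hp.2 (by omega) B hB (by omega)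
    refine ⟨fun a k => (hB1 a k).trans (by omega), _, Exec.iteFalse hb he1, ?_⟩
    have := htest σ b B hB (by omega) (by omega)
    rw [add_mul]; omega
  | @loopStop b p σ hb =>
    intro B hB hC
    simp only [Prog.nodes] at hP
    refine ⟨fun a k => (hB a k).trans (by omega), _, Exec.loopStop hb, ?_⟩
    have := htest σ b B hB (by omega) (by omega)
    omega
  | @loopStep b p σ σ' σ'' t t' hb _ _ ih1 ih2 =>
    intro B hB hC
    have hp' := hp
    have hP' := hP
    simp only [Prog.mild, Prog.nodes] at hp' hP'
    obtain ⟨hB1, t1, he1, ht1⟩ := ih1 hp' (by omega) B hB (by omega)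
    obtain ⟨hB2, t2, he2, ht2⟩ := ih2 hp hP (B + t) hB1 (by omega)
    refine ⟨fun a k => (hB2 a k).trans (by omega), _, Exec.loopStep hb he1 he2, ?_⟩
    have := htest σ b B hB (by omega) (by omega)
    rw [add_mul, add_mul]; omega

/-! ### A program logic with step bounds -/

/-- The index arrays that a program may write. -/
def Prog.writes : Prog → ℕ → Bool
  | skip, _ => false
  | setIdx a _ _, c => a == c
  | setVal _ _ _, _ => false
  | seq p q, c => p.writes c || q.writes c
  | ite _ p q, c => p.writes c || q.writes c
  | loop _ p, c => p.writes c

theorem Steps.frame {V : ℕ → ℕ → F} {p : Prog} {σ σ' : Mem} {t : ℕ} (h : Steps V p σ σ' t)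
    {a : ℕ} (ha : p.writes a = false) : σ' a = σ a := by
  induction h with
  | skip => rfl
  | setIdx σ b k x =>
    simp only [Prog.writes, beq_eq_false_iff_ne] at ha
    exact Mem.upd_ne _ _ _ ha.symm
  | seq _ _ ih1 ih2 =>
    simp only [Prog.writes, Bool.or_eq_false_iff] at ha
    exact (ih2 ha.2).trans (ih1 ha.1)
  | iteTrue _ _ ih => simp only [Prog.writes, Bool.or_eq_false_iff] at ha; exact ih ha.1
  | iteFalse _ _ ih => simp only [Prog.writes, Bool.or_eq_false_iff] at ha; exact ih ha.2
  | loopStop => rfl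
  | loopStep _ _ _ ih1 ih2 => exact (ih2 ha).trans (ih1 ha)

/-- From `σ`, the program `p` halts within `T` steps in a memory that satisfies `Q`. -/
def Runs (V : ℕ → ℕ → F) (p : Prog) (σ : Mem) (T : ℕ) (Q : Mem → Prop) : Prop :=
  ∃ σ' t, Steps V p σ σ' t ∧ t ≤ T ∧ Q σ'

namespace Runs

variable {V : ℕ → ℕ → F} {p q : Prog} {b : BExp} {σ : Mem} {T T' T₁ T₂ : ℕ} {Q R : Mem → Prop}

theorem mono (h : Runs V p σ T R) (hT : T ≤ T')
    (hQ : ∀ σ', (∀ a, p.writes a = false → σ' a = σ a) → R σ' → Q σ') : Runs V p σ T' Q := by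
  obtain ⟨σ', t, hs, ht, hR⟩ := h
  exact ⟨σ', t, hs, ht.trans hT, hQ _ (fun a ha => hs.frame ha) hR⟩

theorem mono_steps (h : Runs V p σ T Q) (hT : T ≤ T') : Runs V p σ T' Q :=
  h.mono hT fun _ _ h => h

theorem skip (h : Q σ) : Runs V Prog.skip σ (T + 1) Q :=
  ⟨σ, 1, Steps.skip σ, by omega, h⟩

theorem set {a : ℕ} {k x : NExp} (h : Q (σ.upd a (k.eval ⟨σ, V⟩) (x.eval ⟨σ, V⟩))) :
    Runs V (Prog.setIdx a k x) σ (T + 1) Q :=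
  ⟨_, 1, Steps.setIdx _ _ _ _, by omega, h⟩

theorem seq (h : Runs V p σ T₁ R)
    (h' : ∀ σ', (∀ a, p.writes a = false → σ' a = σ a) → R σ' → Runs V q σ' T₂ Q) :
    Runs V (Prog.seq p q) σ (T₁ + T₂) Q := by
  obtain ⟨σ', t, hs, ht, hR⟩ := h
  obtain ⟨σ'', t', hs', ht', hQ⟩ := h' σ' (fun a ha => hs.frame ha) hR
  exact ⟨σ'', _, hs.seq hs', by omega, hQ⟩

theorem set_seq {a : ℕ} {k x : NExp}
    (h : Runs V q (σ.upd a (k.eval ⟨σ, V⟩) (x.eval ⟨σ, V⟩)) T Q) :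
    Runs V (Prog.seq (Prog.setIdx a k x) q) σ (T + 1) Q := by
  obtain ⟨σ', t, hs, ht, hQ⟩ := h
  exact ⟨σ', _, (Steps.setIdx _ _ _ _).seq hs, by omega, hQ⟩

theorem ite (h : b.holds ⟨σ, V⟩ → Runs V p σ T Q) (h' : ¬ b.holds ⟨σ, V⟩ → Runs V q σ T Q) :
    Runs V (Prog.ite b p q) σ (T + 1) Q := by
  by_cases hb : b.holds ⟨σ, V⟩
  · obtain ⟨σ', t, hs, ht, hQ⟩ := h hb
    exact ⟨σ', _, Steps.iteTrue hb hs, by omega, hQ⟩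
  · obtain ⟨σ', t, hs, ht, hQ⟩ := h' hb
    exact ⟨σ', _, Steps.iteFalse hb hs, by omega, hQ⟩

theorem loop (I : Mem → Prop) (μ : Mem → ℕ)
    (hstep : ∀ σ', (∀ a, p.writes a = false → σ' a = σ a) → I σ' → b.holds ⟨σ', V⟩ →
      Runs V p σ' T (fun σ'' => I σ'' ∧ μ σ'' < μ σ'))
    (hI : I σ) (hQ : ∀ σ', (∀ a, p.writes a = false → σ' a = σ a) → I σ' → ¬ b.holds ⟨σ', V⟩ → Q σ')
    {N : ℕ} (hN : μ σ ≤ N) :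
    Runs V (Prog.loop b p) σ (N * (T + 1) + 1) Q := by
  suffices H : ∀ N σ', (∀ a, p.writes a = false → σ' a = σ a) → I σ' → μ σ' ≤ N →
      Runs V (Prog.loop b p) σ' (N * (T + 1) + 1) Q from H N σ (fun _ _ => rfl) hI hN
  intro N
  induction N with
  | zero =>
    intro σ' hf hI' hN'
    by_cases hb : b.holds ⟨σ', V⟩
    · obtain ⟨_, _, _, _, _, h⟩ := hstep σ' hf hI' hb
      omega
    · exact ⟨σ', 1, Steps.loopStop hb, by omega, hQ _ hf hI' hb⟩
  | succ N ih =>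
    intro σ' hf hI' hN'
    by_cases hb : b.holds ⟨σ', V⟩
    · obtain ⟨σ₁, t₁, hs₁, ht₁, hI₁, h⟩ := hstep σ' hf hI' hb
      obtain ⟨σ₂, t₂, hs₂, ht₂, hQ₂⟩ :=
        ih σ₁ (fun a ha => (hs₁.frame ha).trans (hf a ha)) hI₁ (by omega)
      refine ⟨σ₂, _, Steps.loopStep hb hs₁ hs₂, ?_, hQ₂⟩
      rw [add_mul]; omega
    · exact ⟨σ', 1, Steps.loopStop hb, by omega, hQ _ hf hI' hb⟩

end Runs

/-- The scalar variable kept in cell `0` of index array `a`. -/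
abbrev NExp.var (a : ℕ) : NExp := .read a (.const 0)

/-- The test `x < y` of indices. -/
abbrev BExp.nlt (x y : NExp) : BExp := .not (.nle y x)

/-- The test `x < y` of values. -/
abbrev BExp.vlt (x y : VExp) : BExp := .not (.vle y x)

abbrev BExp.or (b c : BExp) : BExp := .not (.and (.not b) (.not c))

/-- The loop in which variable `c` runs through the naturals below cell `q` of index array `0`. -/
def Prog.forRange (c q : ℕ) (p : Prog) : Prog :=
  .seq (.setIdx c (.const 0) (.const 0))
    (.loop (.nlt (.var c) (.read 0 (.const q)))
      (.seq p (.setIdx c (.const 0) (.add (.var c) (.const 1)))))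

theorem Runs.forRange {V : ℕ → ℕ → F} {p : Prog} {σ : Mem} {c q T N : ℕ} {Q : Mem → Prop}
    (I : ℕ → Mem → Prop) (hc : p.writes c = false) (h0 : p.writes 0 = false) (hc0 : c ≠ 0)
    (hN : σ 0 q ≤ N) (hI : I 0 σ) (hupd : ∀ k σ' x, I k σ' → I k (σ'.upd c 0 x))
    (hstep : ∀ k σ', k < σ 0 q →
      (∀ a, (Prog.forRange c q p).writes a = false → σ' a = σ a) → σ' c 0 = k →
      I k σ' → Runs V p σ' T (I (k + 1)))
    (hQ : ∀ σ', (∀ a, (Prog.forRange c q p).writes a = false → σ' a = σ a) →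
      I (σ 0 q) σ' → Q σ') :
    Runs V (Prog.forRange c q p) σ (N * (T + 2) + 2) Q := by
  have hw : ∀ a, (Prog.forRange c q p).writes a = false ↔ a ≠ c ∧ p.writes a = false := by
    intro a
    simp only [Prog.forRange, Prog.writes, Bool.or_eq_false_iff, beq_eq_false_iff_ne]
    tauto
  simp only [hw, and_imp] at hstep hQ
  refine Runs.set_seq ?_
  refine Runs.mono_steps (T := N * (T + 1 + 1) + 1) ?_ (by ring_nf; omega)
  refine Runs.loop (fun σ' => σ' c 0 ≤ σ 0 q ∧ (∀ a, a ≠ c → p.writes a = false → σ' a = σ a) ∧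
    I (σ' c 0) σ') (fun σ' => σ 0 q - σ' c 0) ?_ ?_ ?_ ?_
  · rintro σ' - ⟨hle, hfr, hI'⟩ hb
    have h00 := hfr 0 hc0.symm h0
    have hlt : σ' c 0 < σ 0 q := by simpa [BExp.holds, NExp.eval, h00] using hb
    refine Runs.seq (R := I (σ' c 0 + 1)) (T₂ := 1) (hstep _ σ' hlt hfr rfl hI') ?_
    intro σ'' hf'' hI''
    refine Runs.set (T := 0) ?_
    have hcc : σ'' c 0 = σ' c 0 := by rw [hf'' c hc]
    simp only [NExp.eval, Mem.upd_self, Function.update_self, hcc]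
    refine ⟨⟨hlt, fun a ha hpa => ?_, hupd _ _ _ hI''⟩, by omega⟩
    rw [Mem.upd_ne _ _ _ ha, hf'' a hpa, hfr a ha hpa]
  · simp only [NExp.eval, Mem.upd_self, Function.update_self]
    exact ⟨Nat.zero_le _, fun a ha _ => Mem.upd_ne _ _ _ ha, hupd _ _ _ hI⟩
  · rintro σ' - ⟨hle, hfr, hI'⟩ hb
    have h00 := hfr 0 hc0.symm h0
    have : σ' c 0 = σ 0 q := le_antisymm hle (by simpa [BExp.holds, NExp.eval, h00] using hb)
    exact hQ σ' hfr (this ▸ hI')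
  · simp only [NExp.eval, Mem.upd_self, Function.update_self]; omega

end RAM

/-- The data on which the allocation of bi-valued chores depends, with agents `0, …, n - 1` and
items `0, …, m - 1`: an item costs `a` for the agents in `low`, and `b` for the others. -/
structure BivaluedData (F : Type) [Field F] [LinearOrder F] where
  n : ℕ
  m : ℕ
  w : ℕ → F
  a : F
  b : F
  low : ℕ → ℕ → Prop
  n_pos : 0 < n
  w_pos : ∀ i, i < n → 0 < w i
  a_nonneg : 0 ≤ a
  a_le_b : a ≤ b
  low_lt : ∀ i e, low i e → i < n

namespace BivaluedData

variable {F : Type} [Field F] [LinearOrder F] (S : BivaluedData F)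

/-- The number of items `e` with owner `i` such that `P i e`. -/
noncomputable def num (P : ℕ → ℕ → Prop) (own : ℕ → ℕ) (i : ℕ) : ℕ :=
  open Classical in ((Finset.range S.m).filter fun e => own e = i ∧ P i e).card

/-- The number of items of agent `i`. -/
noncomputable def count (own : ℕ → ℕ) (i : ℕ) : ℕ := S.num (fun _ _ => True) own i

/-- The number of items of price `a` that agent `i` owns, where `B` is the set of agents whose
items have raised prices. -/
noncomputable def cheap (own : ℕ → ℕ) (B : ℕ → Prop) (i : ℕ) : ℕ :=
  S.num (fun i e => ¬ B i ∧ S.low i e) own i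

/-- The number of items of price `b` that agent `i` owns. -/
noncomputable def dear (own : ℕ → ℕ) (B : ℕ → Prop) (i : ℕ) : ℕ :=
  S.num (fun i e => B i ∨ ¬ S.low i e) own i

/-- The total price of the bundle of agent `i`. -/
noncomputable def load (own : ℕ → ℕ) (B : ℕ → Prop) (i : ℕ) : F :=
  S.a * S.cheap own B i + S.b * S.dear own B i

/-- The price of the bundle of agent `i` per unit of weight. -/
noncomputable def level (own : ℕ → ℕ) (B : ℕ → Prop) (i : ℕ) : F := S.load own B i / S.w i

/-- The number of items of agent `i` after removal of one item, per unit of weight. -/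
noncomputable def drop (own : ℕ → ℕ) (i : ℕ) : F := ((S.count own i : F) - 1) / S.w i

/-- Some item of agent `u` that is low for `u` is also low for `l`. -/
def Edge (own : ℕ → ℕ) (u l : ℕ) : Prop := ∃ e, e < S.m ∧ own e = u ∧ S.low u e ∧ S.low l e

def Reach (own : ℕ → ℕ) : ℕ → ℕ → Prop := Relation.ReflTransGen (S.Edge own)

/-- Agent `i` owns items of price `a` only and envies some agent, even after removal of one item. -/
def Envies (own : ℕ → ℕ) (B : ℕ → Prop) (i : ℕ) : Prop :=
  i < S.n ∧ ¬ B i ∧ S.dear own B i = 0 ∧ ∃ l, l < S.n ∧ S.level own B l < S.a * S.drop own i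

/-- The invariant of the allocation procedure. Items owned by `S.n` are not allocated yet. -/
structure Inv (own : ℕ → ℕ) (B : ℕ → Prop) : Prop where
  own_le : ∀ e, e < S.m → own e ≤ S.n
  free : ∀ e, e < S.m → own e = S.n → ∀ l, ¬ S.low l e
  raised_lt : ∀ i, B i → i < S.n
  raised_low : ∀ e, e < S.m → B (own e) → S.low (own e) e
  high : ∀ e, e < S.m → B (own e) ∨ ¬ S.low (own e) e → ∀ l, S.low l e → B l
  balanced : ∀ i j, i < S.n → j < S.n → ¬ B i → ¬ B j → S.Reach own i j →
    ((S.cheap own B i : F) - 1) / S.w i ≤ S.cheap own B j / S.w j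
  raised_le : ∀ i r, B i → B r ∨ S.Envies own B r → S.drop own r ≤ S.dear own B i / S.w i
  dear_le : ∀ j l, j < S.n → l < S.n → ¬ B j → 0 < S.dear own B j →
    (S.load own B j - S.b) / S.w j ≤ S.level own B l
  pos : ∀ i, B i → 0 < S.a

variable {S}

section Counting

variable {own : ℕ → ℕ} {B B' : ℕ → Prop}

open Classical in
theorem num_update (P : ℕ → ℕ → Prop) (own : ℕ → ℕ) {e : ℕ}
    (he : e < S.m) (j i : ℕ) :
    S.num P (Function.update own e j) i + (if own e = i ∧ P i e then 1 else 0) =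
      S.num P own i + if j = i ∧ P i e then 1 else 0 := by
  unfold num
  have he' : e ∈ Finset.range S.m := Finset.mem_range.2 he
  simp only [Finset.card_filter]
  rw [← Finset.add_sum_erase _ _ he', ← Finset.add_sum_erase _ _ he']
  have : ∀ x ∈ (Finset.range S.m).erase e,
      (if Function.update own e j x = i ∧ P i x then 1 else 0) =
        if own x = i ∧ P i x then 1 else 0 := by
    intro x hx
    rw [Function.update_of_ne (Finset.ne_of_mem_erase hx)]
  rw [Finset.sum_congr rfl this, Function.update_self]
  ring

theorem num_pos {P : ℕ → ℕ → Prop} {e : ℕ} (he : e < S.m) (h : P (own e) e) :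
    0 < S.num P own (own e) := by
  classical
  exact Finset.card_pos.2 ⟨e, by simp [he, h]⟩

theorem exists_of_num_pos {P : ℕ → ℕ → Prop} {i : ℕ} (h : 0 < S.num P own i) :
    ∃ e, e < S.m ∧ own e = i ∧ P i e := by
  classical
  obtain ⟨e, he⟩ := Finset.card_pos.1 h
  simp only [Finset.mem_filter, Finset.mem_range] at he
  exact ⟨e, he⟩

theorem num_le (P : ℕ → ℕ → Prop) (own : ℕ → ℕ) (i : ℕ) : S.num P own i ≤ S.m := by
  classical
  exact (Finset.card_filter_le _ _).trans (by simp)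

theorem count_eq (own : ℕ → ℕ) (B : ℕ → Prop) (i : ℕ) :
    S.count own i = S.cheap own B i + S.dear own B i := by
  classical
  unfold count cheap dear num
  rw [← Finset.card_union_of_disjoint]
  · congr 1
    ext e
    simp only [Finset.mem_filter, Finset.mem_union]
    tauto
  · rw [Finset.disjoint_left]
    intro e
    simp only [Finset.mem_filter]
    tauto

theorem cheap_congr {i : ℕ} (h : B i ↔ B' i) : S.cheap own B i = S.cheap own B' i := by
  unfold cheap num
  congr 1
  ext e
  simp [h]

theorem dear_congr {i : ℕ} (h : B i ↔ B' i) : S.dear own B i = S.dear own B' i := by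
  unfold dear num
  congr 1
  ext e
  simp [h]

theorem cheap_of_raised {i : ℕ} (h : B i) : S.cheap own B i = 0 := by
  unfold cheap num; simp [h]

theorem dear_of_raised {i : ℕ} (h : B i) : S.dear own B i = S.count own i := by
  rw [count_eq own B i, cheap_of_raised h, zero_add]

theorem low_of_dear_eq_zero {e : ℕ} (he : e < S.m) (h : S.dear own B (own e) = 0) :
    S.low (own e) e := by
  by_contra hl
  exact (num_pos (S := S) (P := fun i e => B i ∨ ¬ S.low i e) he (Or.inr hl)).ne' h

theorem Reach.lt {i r : ℕ} (hi : i < S.n) (h : S.Reach own i r) : r < S.n := by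
  induction h with
  | refl => exact hi
  | tail _ hE _ => obtain ⟨e, -, -, -, hl⟩ := hE; exact S.low_lt _ _ hl

theorem b_nonneg (S : BivaluedData F) : 0 ≤ S.b := S.a_nonneg.trans S.a_le_b

variable [IsStrictOrderedRing F]

theorem load_nonneg (own : ℕ → ℕ) (B : ℕ → Prop) (i : ℕ) : 0 ≤ S.load own B i :=
  add_nonneg (mul_nonneg S.a_nonneg (Nat.cast_nonneg _)) (mul_nonneg S.b_nonneg (Nat.cast_nonneg _))

theorem level_nonneg {i : ℕ} (hi : i < S.n) : 0 ≤ S.level own B i :=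
  div_nonneg (load_nonneg _ _ _) (S.w_pos i hi).le

theorem load_mono {i : ℕ} (h : B i → B' i) : S.load own B i ≤ S.load own B' i := by
  by_cases hB : B i
  · simp only [load, cheap_congr (iff_of_true hB (h hB)), dear_congr (iff_of_true hB (h hB)), le_refl]
  by_cases hB' : B' i
  · simp only [load, cheap_of_raised hB', dear_of_raised hB', count_eq own B i]
    push_cast
    nlinarith [S.a_le_b, Nat.cast_nonneg (α := F) (S.cheap own B i)]
  · simp only [load, cheap_congr (iff_of_false hB hB'), dear_congr (iff_of_false hB hB'), le_refl]

theorem level_mono {i : ℕ} (hi : i < S.n) (h : B i → B' i) :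
    S.level own B i ≤ S.level own B' i :=
  div_le_div_of_nonneg_right (load_mono h) (S.w_pos i hi).le

end Counting

namespace Inv

variable [IsStrictOrderedRing F] {own : ℕ → ℕ} {B : ℕ → Prop}

theorem dear_eq_zero_of_reach (h : S.Inv own B) {i : ℕ} (hi : S.Envies own B i) {r : ℕ}
    (hr : S.Reach own i r) (hB : ¬ B r) : S.dear own B r = 0 := by
  obtain ⟨hin, hiB, hid, l, hl, hlt⟩ := hi
  by_contra hd
  have hrn := hr.lt hin
  have h1 := h.balanced i r hin hrn hiB hB hr
  have h2 := h.dear_le r l hrn hl hB (Nat.pos_of_ne_zero hd)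
  have h3 : S.drop own i = ((S.cheap own B i : F) - 1) / S.w i := by
    rw [drop, count_eq own B i, hid, add_zero]
  have hw := S.w_pos r hrn
  have h4 : S.a * (S.cheap own B r / S.w r) ≤ (S.load own B r - S.b) / S.w r := by
    rw [← mul_div_assoc]
    apply div_le_div_of_nonneg_right _ hw.le
    have : (1 : F) ≤ S.dear own B r := by exact_mod_cast Nat.pos_of_ne_zero hd
    unfold load
    nlinarith [S.b_nonneg]
  have h5 := mul_le_mul_of_nonneg_left h1 S.a_nonneg
  rw [← h3] at h5
  linarith

theorem pos_of_envies {i : ℕ} (hi : S.Envies own B i) : 0 < S.a := by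
  obtain ⟨-, -, -, l, hl, hlt⟩ := hi
  refine S.a_nonneg.lt_of_ne fun h0 => ?_
  rw [← h0, zero_mul] at hlt
  exact absurd hlt (not_lt.2 (level_nonneg hl))

/-- Raising the prices of all agents that can be reached from an envious agent with the largest
number of items per unit of weight. -/
theorem raise (h : S.Inv own B) {i : ℕ} (hi : S.Envies own B i)
    (hmax : ∀ r, B r ∨ S.Envies own B r → S.drop own r ≤ S.drop own i) :
    S.Inv own fun r => B r ∨ S.Reach own i r := by
  have ha := pos_of_envies hi
  have hdear := fun r => h.dear_eq_zero_of_reach hi (r := r)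
  have hi' := hi
  obtain ⟨hin, hiB, hid, l₀, hl₀, hlt⟩ := hi'
  set B' : ℕ → Prop := fun r => B r ∨ S.Reach own i r with hB'
  have hsub : ∀ r, B r → B' r := fun r hr => Or.inl hr
  have hlt' : ∀ r, B' r → r < S.n := fun r hr => hr.elim (h.raised_lt r) fun hr => hr.lt hin
  have hdrop : ∀ r, B' r ∨ S.Envies own B r → S.drop own r ≤ S.drop own i := by
    intro r hr
    by_cases hr1 : B r ∨ S.Envies own B r
    · exact hmax r hr1
    push Not at hr1
    have hreach : S.Reach own i r := by tauto
    have hnot := hr1.2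
    unfold Envies at hnot
    push Not at hnot
    have := hnot (hreach.lt hin) hr1.1 (hdear r hreach hr1.1) l₀ hl₀
    exact (lt_of_mul_lt_mul_left (this.trans_lt hlt) ha.le).le
  have hcong : ∀ r, ¬ B' r → (B' r ↔ B r) := fun r hr => ⟨fun h => absurd h hr, hsub r⟩
  have henv : ∀ r, S.Envies own B' r → S.Envies own B r := by
    rintro r ⟨h1, h2, h3, l, hl, h4⟩
    exact ⟨h1, fun hr => h2 (hsub r hr), by rwa [← dear_congr (hcong r h2)], l, hl,
      (level_mono hl (hsub l)).trans_lt h4⟩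
  refine ⟨h.own_le, h.free, hlt', ?_, ?_, ?_, ?_, ?_, fun _ _ => ha⟩
  · intro e he hr
    by_cases hBe : B (own e)
    · exact h.raised_low e he hBe
    · exact low_of_dear_eq_zero he (hdear _ (hr.resolve_left hBe) hBe)
  · intro e he hor l hl
    by_cases hor' : B (own e) ∨ ¬ S.low (own e) e
    · exact Or.inl (h.high e he hor' l hl)
    push Not at hor'
    have hreach : S.Reach own i (own e) := by tauto
    exact Or.inr (hreach.tail ⟨e, he, rfl, hor'.2, hl⟩)
  · intro r j hr hj hBr hBj hreach
    rw [cheap_congr (hcong r hBr), cheap_congr (hcong j hBj)]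
    exact h.balanced r j hr hj (fun h => hBr (hsub _ h)) (fun h => hBj (hsub _ h)) hreach
  · intro k r hk hr
    have hr1 : S.drop own r ≤ S.drop own i := hdrop r (hr.imp_right (henv r))
    rw [dear_of_raised hk]
    by_cases hBk : B k
    · refine hr1.trans ?_
      rw [← dear_of_raised (S := S) hBk]
      exact h.raised_le k i hBk (Or.inr hi)
    · have hreach := hk.resolve_left hBk
      refine hr1.trans ?_
      have := h.balanced i k hin (hreach.lt hin) hiB hBk hreach
      rw [drop, count_eq own B i, hid, count_eq own B k, hdear k hreach hBk]
      simpa using this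
  · intro j l hj hl hBj hd
    rw [dear_congr (hcong j hBj)] at hd
    rw [load, cheap_congr (hcong j hBj), dear_congr (hcong j hBj)]
    exact (h.dear_le j l hj hl (fun h => hBj (hsub _ h)) hd).trans (level_mono hl (hsub l))

/-- An item that is low for raised agents only may move to an agent with the smallest level. -/
theorem move (h : S.Inv own B) {e j : ℕ} (he : e < S.m) (hj : j < S.n) (hBj : ¬ B j)
    (hown : own e = S.n ∨ B (own e)) (hlow : ∀ l, S.low l e → B l)
    (hq : ∀ l, l < S.n → S.level own B j ≤ S.level (Function.update own e j) B l)
    (hB : ∀ i r, B i → B r ∨ S.Envies own B r →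
      S.drop own r ≤ S.dear (Function.update own e j) B i / S.w i) :
    S.Inv (Function.update own e j) B := by
  classical
  set own' := Function.update own e j with hown'
  have hje : own e ≠ j := by
    rintro rfl
    exact hown.elim (fun h => hj.ne h) hBj
  have hnlow : ¬ S.low j e := fun hl => hBj (hlow j hl)
  have hcheap : ∀ i, ¬ B i → i < S.n → S.cheap own' B i = S.cheap own B i := by
    intro i hi hin
    have := num_update (S := S) (fun i e => ¬ B i ∧ S.low i e) own he j i
    have h1 : ¬ (own e = i ∧ ¬ B i ∧ S.low i e) := fun h1 => hi (hlow _ h1.2.2)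
    have h2 : ¬ (j = i ∧ ¬ B i ∧ S.low i e) := fun h1 => hi (hlow _ h1.2.2)
    rwa [if_neg h1, if_neg h2] at this
  have hother : ∀ i, ¬ B i → i < S.n → i ≠ j → ∀ P : ℕ → ℕ → Prop,
      S.num P own' i = S.num P own i := by
    intro i hi hin hij P
    have := num_update (S := S) P own he j i
    have h1 : own e ≠ i := by
      rintro rfl
      exact hown.elim (fun h => hin.ne h) hi
    simpa [h1, hij.symm] using this
  have hdearj : S.dear own' B j = S.dear own B j + 1 := by
    have := num_update (S := S) (fun i e => B i ∨ ¬ S.low i e) own he j j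
    simp only [hje, hnlow, false_and, not_false_eq_true, or_true, and_self, if_true, if_false,
      add_zero] at this
    exact this
  have hcount : ∀ r, r < S.n → r ≠ j → S.count own' r ≤ S.count own r := by
    intro r hr hrj
    have := num_update (S := S) (fun _ _ => True) own he j r
    simp only [hrj.symm, false_and, if_false, add_zero, ← hown'] at this
    unfold count
    split_ifs at this <;> omega
  have hdrop : ∀ r, r < S.n → r ≠ j → S.drop own' r ≤ S.drop own r := by
    intro r hr hrj
    refine div_le_div_of_nonneg_right ?_ (S.w_pos r hr).le
    have : (S.count own' r : F) ≤ S.count own r := by exact_mod_cast hcount r hr hrj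
    linarith
  have henv : ∀ r, S.Envies own' B r → r ≠ j ∧ S.Envies own B r := by
    rintro r ⟨h1, h2, h3, l, hl, h4⟩
    have hrj : r ≠ j := by rintro rfl; omega
    refine ⟨hrj, h1, h2, (hother r h2 h1 hrj _).symm.trans h3, j, hj, ?_⟩
    have h5 := mul_le_mul_of_nonneg_left (hdrop r h1 hrj) S.a_nonneg
    exact (hq l hl).trans_lt (h4.trans_le h5)
  have hedge : ∀ u l, S.Edge own' u l → S.Edge own u l := by
    rintro u l ⟨x, hx, hxu, hlu, hll⟩
    rcases eq_or_ne x e with rfl | hxe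
    · rw [hown', Function.update_self] at hxu
      exact absurd (hxu ▸ hlu) hnlow
    · exact ⟨x, hx, by rwa [hown', Function.update_of_ne hxe] at hxu, hlu, hll⟩
  refine ⟨?_, ?_, h.raised_lt, ?_, ?_, ?_, ?_, ?_, h.pos⟩
  · intro x hx
    rcases eq_or_ne x e with rfl | hxe
    · rw [hown', Function.update_self]; exact hj.le
    · rw [hown', Function.update_of_ne hxe]; exact h.own_le x hx
  · intro x hx hxn
    rcases eq_or_ne x e with rfl | hxe
    · rw [hown', Function.update_self] at hxn; omega
    · rw [hown', Function.update_of_ne hxe] at hxn; exact h.free x hx hxn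
  · intro x hx hxB
    rcases eq_or_ne x e with rfl | hxe
    · rw [hown', Function.update_self] at hxB; exact absurd hxB hBj
    · rw [hown', Function.update_of_ne hxe] at hxB ⊢; exact h.raised_low x hx hxB
  · intro x hx hor
    rcases eq_or_ne x e with rfl | hxe
    · exact hlow
    · rw [hown', Function.update_of_ne hxe] at hor; exact h.high x hx hor
  · intro i k hi hk hBi hBk hr
    rw [hcheap i hBi hi, hcheap k hBk hk]
    exact h.balanced i k hi hk hBi hBk (Relation.ReflTransGen.mono hedge _ _ hr)
  · intro i r hi hr
    refine le_trans ?_ (hB i r hi (hr.imp_right fun hr => (henv r hr).2))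
    rcases hr with hr | hr
    · exact hdrop r (h.raised_lt r hr) (by rintro rfl; exact hBj hr)
    · exact hdrop r hr.1 (henv r hr).1
  · intro k l hk hl hBk hd
    refine le_trans ?_ (hq l hl)
    rcases eq_or_ne k j with rfl | hkj
    · refine le_of_eq ?_
      rw [load, hcheap k hBk hk, hdearj, level, load]
      push_cast
      ring
    · have e1 : S.load own' B k = S.load own B k := by
        simp only [load, cheap, dear, hother k hBk hk hkj]
      have e2 : S.dear own' B k = S.dear own B k := hother k hBk hk hkj _
      rw [e1]
      exact h.dear_le k j hk hj hBk (e2 ▸ hd)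

/-- An unallocated item goes to an agent with the smallest level. -/
theorem assign (h : S.Inv own B) {e j : ℕ} (he : e < S.m) (hfree : own e = S.n) (hj : j < S.n)
    (hBj : ¬ B j) (hmin : ∀ l, l < S.n → S.level own B j ≤ S.level own B l) :
    S.Inv (Function.update own e j) B := by
  classical
  have hge : ∀ P : ℕ → ℕ → Prop, ∀ l, l < S.n →
      S.num P own l ≤ S.num P (Function.update own e j) l := by
    intro P l hl
    have := num_update (S := S) P own he j l
    rw [if_neg (by rintro ⟨h1, -⟩; omega)] at this
    omega
  refine h.move he hj hBj (Or.inl hfree) (fun l hl => absurd hl (h.free e he hfree l)) ?_ ?_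
  · intro l hl
    refine (hmin l hl).trans (div_le_div_of_nonneg_right ?_ (S.w_pos l hl).le)
    refine add_le_add (mul_le_mul_of_nonneg_left ?_ S.a_nonneg)
      (mul_le_mul_of_nonneg_left ?_ S.b_nonneg)
    · exact_mod_cast hge _ l hl
    · exact_mod_cast hge _ l hl
  · intro i r hi hr
    refine (h.raised_le i r hi hr).trans
      (div_le_div_of_nonneg_right ?_ (S.w_pos i (h.raised_lt i hi)).le)
    exact_mod_cast hge _ i (h.raised_lt i hi)

theorem not_raised_of_lt {e j : ℕ} (h : S.Inv own B) (hB : B (own e))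
    (henvy : S.level own B j < S.b * S.drop own (own e)) : ¬ B j := by
  intro hBj
  have h1 := h.raised_le j (own e) hBj (Or.inl hB)
  have h2 := mul_le_mul_of_nonneg_left h1 S.b_nonneg
  rw [level, load, cheap_of_raised hBj, Nat.cast_zero, mul_zero, zero_add, mul_div_assoc] at henvy
  linarith

/-- A raised agent with the largest number of items per unit of weight gives an item to an agent
with the smallest level. -/
theorem give {e j : ℕ} (h : S.Inv own B) (hB : B (own e))
    (henvy : S.level own B j < S.b * S.drop own (own e)) (he : e < S.m) (hj : j < S.n)
    (hmax : ∀ r, B r ∨ S.Envies own B r → S.drop own r ≤ S.drop own (own e))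
    (hmin : ∀ l, l < S.n → S.level own B j ≤ S.level own B l) :
    S.Inv (Function.update own e j) B := by
  classical
  have hBj := h.not_raised_of_lt hB henvy
  have hje : own e ≠ j := by rintro rfl; exact hBj hB
  have hsn := h.raised_lt _ hB
  have hself : S.dear own B (own e) = S.dear (Function.update own e j) B (own e) + 1 := by
    have := num_update (S := S) (fun i e => B i ∨ ¬ S.low i e) own he j (own e)
    simp only [hje.symm, hB, true_or, and_true, if_true, if_false, add_zero] at this
    exact this.symm
  have hself' : (S.dear (Function.update own e j) B (own e) : F) / S.w (own e) =
      S.drop own (own e) := by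
    rw [drop, ← dear_of_raised (S := S) hB, hself]
    push_cast
    ring
  have hge : ∀ P : ℕ → ℕ → Prop, ∀ l, own e ≠ l →
      S.num P own l ≤ S.num P (Function.update own e j) l := by
    intro P l hl
    have := num_update (S := S) P own he j l
    rw [if_neg (by rintro ⟨h1, -⟩; exact hl h1)] at this
    omega
  refine h.move he hj hBj (Or.inr hB) (h.high e he (Or.inl hB)) ?_ ?_
  · intro l hl
    rcases eq_or_ne (own e) l with rfl | hle
    · refine henvy.le.trans_eq ?_
      rw [level, load, cheap_of_raised hB, Nat.cast_zero, mul_zero, zero_add, mul_div_assoc, hself']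
    refine (hmin l hl).trans (div_le_div_of_nonneg_right ?_ (S.w_pos l hl).le)
    refine add_le_add (mul_le_mul_of_nonneg_left ?_ S.a_nonneg)
      (mul_le_mul_of_nonneg_left ?_ S.b_nonneg)
    · exact_mod_cast hge _ l hle
    · exact_mod_cast hge _ l hle
  · intro i r hi hr
    rcases eq_or_ne (own e) i with rfl | hie
    · rw [hself']; exact hmax r hr
    refine (h.raised_le i r hi hr).trans
      (div_le_div_of_nonneg_right ?_ (S.w_pos i (h.raised_lt i hi)).le)
    exact_mod_cast hge _ i hie

end Inv

/-! ### The allocation of the items that are low for somebody -/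

variable (S) in
/-- Every item that is low for somebody is given to somebody for whom it is low, and the others
are not allocated. -/
def LowAllocation (own : ℕ → ℕ) : Prop :=
  ∀ e, e < S.m → (own e = S.n ∧ ∀ l, ¬ S.low l e) ∨ S.low (own e) e

variable (S) in
/-- The number of allocated items, in an allocation of the low items. -/
noncomputable abbrev lows (own : ℕ → ℕ) (i : ℕ) : ℕ := S.cheap own (fun _ => False) i

theorem LowAllocation.dear_eq_zero {own : ℕ → ℕ} (h : S.LowAllocation own) {i : ℕ} (hi : i < S.n) :
    S.dear own (fun _ => False) i = 0 := by
  by_contra hd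
  obtain ⟨e, he, rfl, hl⟩ := exists_of_num_pos (Nat.pos_of_ne_zero hd)
  rcases h e he with h1 | h1
  · omega
  · tauto

theorem LowAllocation.inv {own : ℕ → ℕ} (h : S.LowAllocation own)
    (hbal : ∀ i j, i < S.n → j < S.n → S.Reach own i j →
      ((S.lows own i : F) - 1) / S.w i ≤ S.lows own j / S.w j) :
    S.Inv own fun _ => False := by
  refine ⟨?_, ?_, by simp, by simp, ?_, fun i j hi hj _ _ => hbal i j hi hj, by simp, ?_, by simp⟩
  · intro e he
    exact (h e he).elim (fun h => h.1.le) fun h => (S.low_lt _ _ h).le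
  · intro e he hn
    rcases h e he with h | h
    · exact h.2
    · have := S.low_lt _ _ h; omega
  · intro e he hor l hl
    rcases h e he with h | h
    · exact h.2 l hl
    · tauto
  · intro j l hj _ _ hd
    rw [h.dear_eq_zero hj] at hd
    omega

section Potential

variable (S) in
/-- The rank of a number among the possible numbers of items per unit of weight. -/
noncomputable def rank (z : F) : ℕ :=
  ((Finset.range S.n ×ˢ Finset.range (S.m + 1)).filter fun p => (p.2 : F) / S.w p.1 < z).card

variable (S) in
/-- A potential that decreases when an item moves to an agent with fewer items per unit of weight. -/
noncomputable def potential (x : ℕ → ℕ) : ℕ :=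
  ∑ i ∈ Finset.range S.n, ∑ t ∈ Finset.range (x i), S.rank ((t : F) / S.w i)

theorem rank_le (z : F) : S.rank z ≤ S.n * (S.m + 1) :=
  (Finset.card_filter_le _ _).trans (by simp)

theorem rank_lt {j k : ℕ} {z : F} (hj : j < S.n) (hk : k ≤ S.m) (h : (k : F) / S.w j < z) :
    S.rank ((k : F) / S.w j) < S.rank z := by
  apply Finset.card_lt_card
  rw [Finset.ssubset_iff_of_subset]
  · refine ⟨(j, k), ?_, ?_⟩
    · simp [hj, h]; omega
    · simp
  · intro p
    simp only [Finset.mem_filter]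
    exact fun hp => ⟨hp.1, hp.2.trans h⟩

theorem potential_le {x : ℕ → ℕ} (hx : ∀ i, i < S.n → x i ≤ S.m) :
    S.potential x ≤ S.n * (S.m * (S.n * (S.m + 1))) := by
  unfold potential
  calc _ ≤ ∑ i ∈ Finset.range S.n, S.m * (S.n * (S.m + 1)) := by
        refine Finset.sum_le_sum fun i hi => ?_
        calc _ ≤ ∑ t ∈ Finset.range (x i), S.n * (S.m + 1) :=
              Finset.sum_le_sum fun t _ => rank_le _
          _ = x i * (S.n * (S.m + 1)) := by simp
          _ ≤ _ := Nat.mul_le_mul_right _ (hx i (Finset.mem_range.1 hi))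
    _ = _ := by simp

theorem potential_lt {x x' : ℕ → ℕ} {i j : ℕ} (hi : i < S.n) (hj : j < S.n) (hij : i ≠ j)
    (hx : x j ≤ S.m)
    (hx' : ∀ u, u < S.n → x' u + (if u = i then 1 else 0) = x u + if u = j then 1 else 0)
    (hlt : (x j : F) / S.w j < ((x i : F) - 1) / S.w i) : S.potential x' < S.potential x := by
  have hi1 : x' i + 1 = x i := by simpa [hij] using hx' i hi
  have hr := rank_lt (S := S) hj hx hlt
  have hi2 : ((x i : F) - 1) / S.w i = (x' i : F) / S.w i := by rw [← hi1]; push_cast; ring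
  rw [hi2] at hr
  have key : S.potential x' + S.rank ((x' i : F) / S.w i) =
      S.potential x + S.rank ((x j : F) / S.w j) := by
    have e1 : ∀ k, k < S.n → ∀ z : ℕ, z = ∑ u ∈ Finset.range S.n, if u = k then z else 0 := by
      intro k hk z
      simp [hk]
    rw [e1 i hi (S.rank ((x' i : F) / S.w i)), e1 j hj (S.rank ((x j : F) / S.w j))]
    unfold potential
    rw [← Finset.sum_add_distrib, ← Finset.sum_add_distrib]
    refine Finset.sum_congr rfl fun u hu => ?_
    have hu' := hx' u (Finset.mem_range.1 hu)
    by_cases h1 : u = i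
    · subst h1
      have h2 : u ≠ j := hij
      simp only [if_true, h2, if_false, add_zero] at hu' ⊢
      rw [← hu', Finset.sum_range_succ]
    · by_cases h2 : u = j
      · subst h2
        simp only [if_true, h1, if_false, add_zero] at hu' ⊢
        rw [hu', Finset.sum_range_succ]
      · simp only [h2, h1, if_false, add_zero] at hu' ⊢
        rw [hu']
  omega

end Potential

end BivaluedData

namespace ChoreInstance

variable {F : Type} [Field F] [LinearOrder F] {n m : ℕ}

theorem sum_mul_bundleCost (I : ChoreInstance F n m) (c : Fin n → F) (Y : Allocation n m) :
    ∑ i, c i * I.bundleCost i (Y.bundle i) = ∑ e, c (Y e) * I.cost (Y e) e := by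
  rw [← Finset.sum_fiberwise Finset.univ Y fun e => c (Y e) * I.cost (Y e) e]
  refine Finset.sum_congr rfl fun i _ => ?_
  rw [bundleCost, Allocation.bundle, Finset.mul_sum]
  refine Finset.sum_congr rfl fun e he => ?_
  rw [(Finset.mem_filter.1 he).2]

/-- If prices and multipliers certify that every item goes to an agent with the least scaled cost,
the allocation is Pareto optimal. -/
theorem paretoOptimal_of_prices [IsStrictOrderedRing F] (I : ChoreInstance F n m) (X : Allocation n m) (p : Fin m → F)
    (c : Fin n → F) (hpos : ∀ i, 0 < c i) (hle : ∀ i e, p e ≤ c i * I.cost i e)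
    (heq : ∀ e, c (X e) * I.cost (X e) e = p e) : I.ParetoOptimal X := by
  rintro ⟨Y, hY, i, hi⟩
  have h1 : ∑ i, c i * I.bundleCost i (Y.bundle i) < ∑ i, c i * I.bundleCost i (X.bundle i) :=
    Finset.sum_lt_sum (fun i _ => mul_le_mul_of_nonneg_left (hY i) (hpos i).le)
      ⟨i, Finset.mem_univ i, mul_lt_mul_of_pos_left hi (hpos i)⟩
  rw [I.sum_mul_bundleCost, I.sum_mul_bundleCost] at h1
  refine absurd h1 (not_lt.2 (Finset.sum_le_sum fun e _ => ?_))
  rw [heq]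
  exact hle _ _

end ChoreInstance

namespace BivaluedData

variable {F : Type} [Field F] [LinearOrder F] {S : BivaluedData F}

variable (S) in
open Classical in
/-- The price of an item. -/
noncomputable def price (own : ℕ → ℕ) (B : ℕ → Prop) (e : ℕ) : F :=
  if ¬ B (own e) ∧ S.low (own e) e then S.a else S.b

variable {own : ℕ → ℕ} {B : ℕ → Prop} {X : Allocation S.n S.m}

open Classical in
theorem num_eq_card_bundle (hX : ∀ e, (X e : ℕ) = own e) (P : ℕ → ℕ → Prop) (i : Fin S.n) :
    S.num P own i = ((X.bundle i).filter fun e : Fin S.m => P i e).card := by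
  unfold num Allocation.bundle
  rw [Finset.filter_filter, Finset.card_filter, Finset.card_filter, Finset.sum_range]
  refine Finset.sum_congr rfl fun e _ => ?_
  simp only [← hX e, Fin.val_inj]

theorem sum_price (hX : ∀ e, (X e : ℕ) = own e) (i : Fin S.n) :
    ∑ e ∈ X.bundle i, S.price own B e = S.load own B i := by
  classical
  unfold load cheap dear
  rw [num_eq_card_bundle hX, num_eq_card_bundle hX]
  have : ∀ e ∈ X.bundle i, S.price own B e = if ¬ B i ∧ S.low i e then S.a else S.b := by
    intro e he
    have : own e = i := by rw [← hX e, (Finset.mem_filter.1 he).2]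
    unfold price
    rw [this]
  rw [Finset.sum_congr rfl this, Finset.sum_ite, Finset.sum_const, Finset.sum_const, nsmul_eq_mul,
    nsmul_eq_mul, mul_comm S.a, mul_comm S.b]
  simp only [not_and_or, not_not]
  congr!

variable [IsStrictOrderedRing F]

/-- When nobody envies beyond one item with respect to prices, the allocation is fair and
efficient. -/
theorem Inv.wef1_and_paretoOptimal (h : S.Inv own B) (I : ChoreInstance F S.n S.m)
    (hw : ∀ i : Fin S.n, S.w i = I.weight i)
    (hlow : ∀ (i : Fin S.n) (e : Fin S.m), S.low i e → I.cost i e = S.a)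
    (hhigh : ∀ (i : Fin S.n) (e : Fin S.m), ¬ S.low i e → I.cost i e = S.b)
    (hX : ∀ e, (X e : ℕ) = own e) (hnot : ∀ i, ¬ S.Envies own B i)
    (hB : ∀ i l, B i → l < S.n → S.b * S.drop own i ≤ S.level own B l) :
    I.WEF1 X ∧ I.ParetoOptimal X := by
  classical
  have hown : ∀ e, e < S.m → own e < S.n := fun e he => by
    rw [← hX ⟨e, he⟩]; exact (X ⟨e, he⟩).2
  have hpos : ∀ i, B i → 0 < S.b := fun i hi => (h.pos i hi).trans_le S.a_le_b
  have hcost : ∀ i e, S.a ≤ I.cost i e := by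
    intro i e
    by_cases hl : S.low i e
    · rw [hlow i e hl]
    · rw [hhigh i e hl]; exact S.a_le_b
  set c : Fin S.n → F := fun i => if B i then S.b / S.a else 1 with hc
  have hcpos : ∀ i, 0 < c i := by
    intro i
    by_cases hi : B i
    · simpa only [hc, if_pos hi] using div_pos (hpos i hi) (h.pos i hi)
    · simp [hc, hi]
  have hprice_le : ∀ i (e : Fin S.m), S.price own B e ≤ c i * I.cost i e := by
    intro i e
    by_cases hi : B i
    · have ha := h.pos i hi
      simp only [hc, if_pos hi]
      calc S.price own B e ≤ S.b := by
            unfold price; split_ifs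
            · exact S.a_le_b
            · exact le_rfl
        _ = S.b / S.a * S.a := by field_simp
        _ ≤ _ := mul_le_mul_of_nonneg_left (hcost i e) (div_pos (hpos i hi) ha).le
    · simp only [hc, if_neg hi, one_mul]
      unfold price
      split_ifs with hp
      · exact hcost i e
      · rw [not_and_or, not_not] at hp
        have := h.high e e.2 hp i
        exact (hhigh i e fun hl => hi (this hl)).ge
  have hprice_eq : ∀ e, c (X e) * I.cost (X e) e = S.price own B e := by
    intro e
    have hXe := hX e
    by_cases hi : B (X e)
    · have ha := h.pos _ hi
      have hl := h.raised_low e e.2 (hX e ▸ hi)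
      rw [hlow (X e) e (by rwa [hXe])]
      simp only [hc, if_pos hi, price]
      rw [if_neg (by rw [← hXe]; tauto)]
      field_simp
    · simp only [hc, if_neg hi, one_mul, price, ← hXe]
      by_cases hl : S.low (X e) e
      · rw [if_pos ⟨hi, hl⟩, hlow _ _ hl]
      · rw [if_neg (by tauto), hhigh _ _ hl]
  refine ⟨fun i j => ?_, I.paretoOptimal_of_prices X _ c hcpos hprice_le hprice_eq⟩
  rw [or_iff_not_imp_left]
  intro hne
  have hmem : ∀ e, e ∈ X.bundle i ↔ X e = i := fun e => by simp [Allocation.bundle]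
  have hwi := S.w_pos i i.2
  have hwj := S.w_pos j j.2
  suffices ∃ e ∈ X.bundle i, (S.load own B i - S.price own B e) / S.w i ≤ S.level own B j by
    obtain ⟨e, he, hle⟩ := this
    refine ⟨e, he, ?_⟩
    rw [← hw, ← hw]
    refine le_of_mul_le_mul_left ?_ (hcpos i)
    rw [← mul_div_assoc, ← mul_div_assoc]
    have h1 : c i * I.bundleCost i (X.bundle i \ {e}) = S.load own B i - S.price own B e := by
      rw [← sum_price hX, ChoreInstance.bundleCost, Finset.mul_sum,
        ← Finset.sum_sdiff (Finset.singleton_subset_iff.2 he), Finset.sum_singleton,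
        add_sub_cancel_right]
      refine Finset.sum_congr rfl fun x hx => ?_
      rw [← hprice_eq, (hmem x).1 (Finset.mem_sdiff.1 hx).1]
    have h2 : S.load own B j ≤ c i * I.bundleCost i (X.bundle j) := by
      rw [← sum_price hX, ChoreInstance.bundleCost, Finset.mul_sum]
      exact Finset.sum_le_sum fun x _ => hprice_le i x
    rw [h1]
    exact hle.trans (div_le_div_of_nonneg_right h2 hwj.le)
  obtain ⟨e, he⟩ := Finset.nonempty_iff_ne_empty.2 hne
  have hei : own e = i := by rw [← hX e, (hmem e).1 he]
  by_cases hBi : B i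
  · refine ⟨e, he, le_of_eq_of_le ?_ (hB i j hBi j.2)⟩
    rw [load, cheap_of_raised hBi, dear_of_raised hBi, drop, price, if_neg (by rw [hei]; tauto)]
    push_cast
    ring
  rcases Nat.eq_zero_or_pos (S.dear own B i) with hd | hd
  · refine ⟨e, he, ?_⟩
    have hl : S.low (own e) e := low_of_dear_eq_zero e.2 (by rwa [hei])
    have hnot := hnot i
    unfold Envies at hnot
    push Not at hnot
    refine le_of_eq_of_le ?_ (hnot i.2 hBi hd j j.2)
    rw [load, hd, drop, count_eq own B, hd, price, if_pos ⟨by rwa [hei], hl⟩]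
    push_cast
    ring
  · obtain ⟨e', he', hei', hl⟩ := exists_of_num_pos hd
    have hXe : X ⟨e', he'⟩ = i := Fin.ext (by rw [hX]; exact hei')
    refine ⟨⟨e', he'⟩, (hmem _).2 hXe, le_of_eq_of_le ?_ (h.dear_le i j i.2 j.2 hBi hd)⟩
    rw [price, if_neg]
    simp only [hei']
    tauto

end BivaluedData

namespace ChoreProgram

open RAM

/-! ### The program

Index arrays: `0` numbers of agents and items, `1` owner of an item, `2` low pairs of agents and
items, `3` raised agents, `4` and `5` numbers of items of the two prices of an agent, `6`, `7`, `8`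
marks, items and successors on paths, `9` and `10` agent and item of the smallest and the largest
cost. Scalars: `11`, …, `14` loop counters, `15` and `16` progress flags, `17` position on a path,
`18` agent of the smallest level, `19` and `20` candidate for a change and its existence, `21` item
that changes its owner. -/

abbrev agents : NExp := .read 0 (.const 0)

abbrev cell (i e : NExp) : NExp := .add (.mul i (.read 0 (.const 1))) e

abbrev weightOf (i : NExp) : VExp := .read 0 i

abbrev costOf (i e : NExp) : VExp := .read 1 (cell i e)

def minCost : VExp := costOf (.read 9 (.const 0)) (.read 9 (.const 1))

def maxCost : VExp := costOf (.read 10 (.const 0)) (.read 10 (.const 1))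

abbrev ownerOf (e : NExp) : NExp := .read 1 e

def isLow (i e : NExp) : BExp := .nle (.const 1) (.read 2 (cell i e))

def loadOf (i : NExp) : VExp :=
  .add (.mul minCost (.ofNat (.read 4 i))) (.mul maxCost (.ofNat (.read 5 i)))

def countOf (i : NExp) : VExp := .ofNat (.add (.read 4 i) (.read 5 i))

def levelLt (i j : NExp) : BExp :=
  .vlt (.mul (loadOf i) (weightOf j)) (.mul (loadOf j) (weightOf i))

def dropLt (i j : NExp) : BExp :=
  .vlt (.add (.mul (countOf i) (weightOf j)) (weightOf i))
    (.add (.mul (countOf j) (weightOf i)) (weightOf j))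

/-- The level of `j` is smaller than `p` times the drop of `i`. -/
def exceeds (p : VExp) (i j : NExp) : BExp :=
  .vlt (.add (.mul (loadOf j) (weightOf i)) (.mul p (weightOf j)))
    (.mul (.mul p (countOf i)) (weightOf j))

/-- Agent `i` has more items of price `a` per unit of weight than `j`, even after removal of one. -/
def unbalanced (i j : NExp) : BExp :=
  .vlt (.add (.mul (.ofNat (.read 4 j)) (weightOf i)) (weightOf j))
    (.mul (.ofNat (.read 4 i)) (weightOf j))

def findMin : Prog :=
  .seq (.setIdx 18 (.const 0) (.const 0))
    (.forRange 11 0 (.ite (levelLt (.var 11) (.var 18)) (.setIdx 18 (.const 0) (.var 11)) .skip))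

def isCandidate (i : NExp) : BExp :=
  .or (.nle (.const 1) (.read 3 i))
    (.and (.nle (.read 5 i) (.const 0)) (exceeds minCost i (.var 18)))

def findMax : Prog :=
  .seq (.setIdx 20 (.const 0) (.const 0))
    (.forRange 11 0
      (.ite (.and (isCandidate (.var 11))
          (.or (.nle (.var 20) (.const 0)) (dropLt (.var 19) (.var 11))))
        (.seq (.setIdx 19 (.const 0) (.var 11)) (.setIdx 20 (.const 0) (.const 1))) .skip))

/-- Marks the agents from which the agent in variable `13` can be reached. -/
def findPaths : Prog :=
  .seq (.forRange 11 0 (.setIdx 6 (.var 11) (.const 0)))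
    (.seq (.setIdx 6 (.var 13) (.const 1))
    (.seq (.setIdx 16 (.const 0) (.const 1))
    (.loop (.nle (.const 1) (.var 16))
      (.seq (.setIdx 16 (.const 0) (.const 0))
      (.forRange 11 1
        (.ite (.and (.nlt (ownerOf (.var 11)) agents) (isLow (ownerOf (.var 11)) (.var 11)))
          (.forRange 12 0
            (.ite (.and (.nle (.read 6 (ownerOf (.var 11))) (.const 0))
                (.and (.nle (.const 1) (.read 6 (.var 12))) (isLow (.var 12) (.var 11))))
              (.seq (.setIdx 7 (ownerOf (.var 11)) (.var 11))
              (.seq (.setIdx 8 (ownerOf (.var 11)) (.var 12))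
              (.seq (.setIdx 6 (ownerOf (.var 11)) (.const 1))
              (.setIdx 16 (.const 0) (.const 1)))))
              .skip))
          .skip))))))

/-- Passes items along the path from the agent in variable `14` to the agent in variable `13`. -/
def transfer : Prog :=
  .seq (.setIdx 17 (.const 0) (.var 14))
    (.seq (.loop (.not (.and (.nle (.var 17) (.var 13)) (.nle (.var 13) (.var 17))))
      (.seq (.setIdx 1 (.read 7 (.var 17)) (.read 8 (.var 17)))
      (.setIdx 17 (.const 0) (.read 8 (.var 17)))))
    (.seq (.setIdx 4 (.var 14) (.sub (.read 4 (.var 14)) (.const 1)))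
    (.seq (.setIdx 4 (.var 13) (.add (.read 4 (.var 13)) (.const 1)))
    (.setIdx 15 (.const 0) (.const 1)))))

/-- Balances the items that are low for somebody. -/
def balance : Prog :=
  .seq (.setIdx 15 (.const 0) (.const 1))
    (.loop (.nle (.const 1) (.var 15))
      (.seq (.setIdx 15 (.const 0) (.const 0))
      (.forRange 13 0
        (.ite (.nle (.var 15) (.const 0))
          (.seq findPaths
            (.forRange 14 0
              (.ite (.and (.nle (.var 15) (.const 0))
                  (.and (.nle (.const 1) (.read 6 (.var 14))) (unbalanced (.var 14) (.var 13))))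
                transfer .skip)))
          .skip))))

/-- Allocates the items that are low for nobody. -/
def fill : Prog :=
  .forRange 13 1
    (.ite (.nle agents (ownerOf (.var 13)))
      (.seq findMin
      (.seq (.setIdx 1 (.var 13) (.var 18))
      (.setIdx 5 (.var 18) (.add (.read 5 (.var 18)) (.const 1)))))
      .skip)

/-- Raises the agents that can be reached from the agent in variable `19`. -/
def raise : Prog :=
  .forRange 13 0
    (.seq findPaths
      (.ite (.and (.nle (.const 1) (.read 6 (.var 19))) (.nle (.read 3 (.var 13)) (.const 0)))
        (.seq (.setIdx 3 (.var 13) (.const 1))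
        (.seq (.setIdx 5 (.var 13) (.read 4 (.var 13)))
        (.setIdx 4 (.var 13) (.const 0))))
        .skip))

/-- Gives an item of the agent in variable `19` to the agent in variable `18`. -/
def give : Prog :=
  .seq (.forRange 11 1
      (.ite (.and (.nle (ownerOf (.var 11)) (.var 19)) (.nle (.var 19) (ownerOf (.var 11))))
        (.setIdx 21 (.const 0) (.var 11)) .skip))
    (.seq (.setIdx 1 (.var 21) (.var 18))
    (.seq (.setIdx 5 (.var 19) (.sub (.read 5 (.var 19)) (.const 1)))
    (.setIdx 5 (.var 18) (.add (.read 5 (.var 18)) (.const 1)))))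

def improve : Prog :=
  .seq (.setIdx 15 (.const 0) (.const 1))
    (.loop (.nle (.const 1) (.var 15))
      (.seq (.setIdx 15 (.const 0) (.const 0))
      (.seq findMin
      (.seq findMax
      (.ite (.nle (.const 1) (.var 20))
        (.ite (.nle (.const 1) (.read 3 (.var 19)))
          (.ite (exceeds maxCost (.var 19) (.var 18))
            (.seq give (.setIdx 15 (.const 0) (.const 1))) .skip)
          (.seq raise (.setIdx 15 (.const 0) (.const 1))))
        .skip)))))

def findCosts : Prog :=
  .forRange 11 0
    (.forRange 12 1
      (.seq
        (.ite (.vlt (costOf (.var 11) (.var 12)) minCost)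
          (.seq (.setIdx 9 (.const 0) (.var 11)) (.setIdx 9 (.const 1) (.var 12))) .skip)
        (.ite (.vlt maxCost (costOf (.var 11) (.var 12)))
          (.seq (.setIdx 10 (.const 0) (.var 11)) (.setIdx 10 (.const 1) (.var 12))) .skip)))

def clear : Prog := .forRange 11 1 (.setIdx 1 (.var 11) agents)

def assignLow : Prog :=
  .forRange 11 0
    (.forRange 12 1
      (.ite (.vle (costOf (.var 11) (.var 12)) minCost)
        (.seq (.setIdx 2 (cell (.var 11) (.var 12)) (.const 1))
          (.ite (.nle agents (ownerOf (.var 12)))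
            (.seq (.setIdx 1 (.var 12) (.var 11))
            (.setIdx 4 (.var 11) (.add (.read 4 (.var 11)) (.const 1))))
            .skip))
        .skip))

def main : Prog :=
  .seq findCosts (.seq clear (.seq assignLow (.seq balance (.seq fill improve))))

/-! ### Memories that represent allocations -/

variable {F : Type} [Field F] [LinearOrder F]

/-- The memory contains the given data. -/
structure Env (S : BivaluedData F) (V : ℕ → ℕ → F) (σ : Mem) : Prop where
  agents : σ 0 0 = S.n
  items : σ 0 1 = S.m
  weight : ∀ i, i < S.n → V 0 i = S.w i
  minCost : V 1 (σ 9 0 * S.m + σ 9 1) = S.a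
  maxCost : V 1 (σ 10 0 * S.m + σ 10 1) = S.b
  low : ∀ i e, i < S.n → e < S.m → (1 ≤ σ 2 (i * S.m + e) ↔ S.low i e)

/-- The memory represents the allocation in array `1` and the set `B` of raised agents. -/
structure Rep (S : BivaluedData F) (B : ℕ → Prop) (σ : Mem) : Prop where
  raised : ∀ i, i < S.n → (1 ≤ σ 3 i ↔ B i)
  cheap : ∀ i, i < S.n → σ 4 i = S.cheap (σ 1) B i
  dear : ∀ i, i < S.n → σ 5 i = S.dear (σ 1) B i

variable {S : BivaluedData F} {V : ℕ → ℕ → F} {σ σ' : Mem} {B : ℕ → Prop} {i j e : NExp}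

theorem Env.congr (h : Env S V σ) (h0 : σ' 0 = σ 0) (h2 : σ' 2 = σ 2) (h9 : σ' 9 = σ 9)
    (h10 : σ' 10 = σ 10) : Env S V σ' := by
  obtain ⟨h1, h3, h4, h5, h6, h7⟩ := h
  constructor <;> simpa only [h0, h2, h9, h10]

theorem Rep.congr (h : Rep S B σ) (h1 : σ' 1 = σ 1) (h3 : σ' 3 = σ 3) (h4 : σ' 4 = σ 4)
    (h5 : σ' 5 = σ 5) : Rep S B σ' := by
  obtain ⟨h6, h7, h8⟩ := h
  constructor <;> simpa only [h1, h3, h4, h5]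

theorem Env.eval_minCost (h : Env S V σ) : ChoreProgram.minCost.eval ⟨σ, V⟩ = S.a := by
  simp only [ChoreProgram.minCost, VExp.eval, NExp.eval, h.items, h.minCost]

theorem Env.eval_maxCost (h : Env S V σ) : ChoreProgram.maxCost.eval ⟨σ, V⟩ = S.b := by
  simp only [ChoreProgram.maxCost, VExp.eval, NExp.eval, h.items, h.maxCost]

theorem Env.holds_isLow (h : Env S V σ) (hi : i.eval ⟨σ, V⟩ < S.n) (he : e.eval ⟨σ, V⟩ < S.m) :
    (isLow i e).holds ⟨σ, V⟩ ↔ S.low (i.eval ⟨σ, V⟩) (e.eval ⟨σ, V⟩) := by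
  simp only [isLow, BExp.holds, NExp.eval, h.items]
  exact h.low _ _ hi he

theorem Env.eval_loadOf (h : Env S V σ) (hr : Rep S B σ) (hi : i.eval ⟨σ, V⟩ < S.n) :
    (loadOf i).eval ⟨σ, V⟩ = S.load (σ 1) B (i.eval ⟨σ, V⟩) := by
  simp only [loadOf, VExp.eval, h.eval_minCost, h.eval_maxCost, NExp.eval]
  rw [hr.cheap _ hi, hr.dear _ hi, BivaluedData.load]

theorem Rep.eval_countOf (hr : Rep S B σ) (hi : i.eval ⟨σ, V⟩ < S.n) :
    (countOf i).eval ⟨σ, V⟩ = S.count (σ 1) (i.eval ⟨σ, V⟩) := by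
  simp only [countOf, VExp.eval, NExp.eval]
  rw [hr.cheap _ hi, hr.dear _ hi, BivaluedData.count_eq _ B]

variable [IsStrictOrderedRing F]

theorem Env.holds_levelLt (h : Env S V σ) (hr : Rep S B σ) (hi : i.eval ⟨σ, V⟩ < S.n)
    (hj : j.eval ⟨σ, V⟩ < S.n) : (levelLt i j).holds ⟨σ, V⟩ ↔
      S.level (σ 1) B (i.eval ⟨σ, V⟩) < S.level (σ 1) B (j.eval ⟨σ, V⟩) := by
  simp only [levelLt, BExp.holds, VExp.eval, h.eval_loadOf hr hi, h.eval_loadOf hr hj,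
    h.weight _ hi, h.weight _ hj, not_le, BivaluedData.level]
  rw [div_lt_div_iff₀ (S.w_pos _ hi) (S.w_pos _ hj)]

theorem Env.holds_dropLt (h : Env S V σ) (hr : Rep S B σ) (hi : i.eval ⟨σ, V⟩ < S.n)
    (hj : j.eval ⟨σ, V⟩ < S.n) : (dropLt i j).holds ⟨σ, V⟩ ↔
      S.drop (σ 1) (i.eval ⟨σ, V⟩) < S.drop (σ 1) (j.eval ⟨σ, V⟩) := by
  simp only [dropLt, BExp.holds, VExp.eval, hr.eval_countOf hi, hr.eval_countOf hj,
    h.weight _ hi, h.weight _ hj, not_le, BivaluedData.drop]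
  rw [div_lt_div_iff₀ (S.w_pos _ hi) (S.w_pos _ hj), sub_mul, sub_mul, one_mul, one_mul]
  constructor <;> intro <;> linarith

theorem Env.holds_exceeds (h : Env S V σ) (hr : Rep S B σ) {p : VExp} {c : F}
    (hp : p.eval ⟨σ, V⟩ = c) (hi : i.eval ⟨σ, V⟩ < S.n) (hj : j.eval ⟨σ, V⟩ < S.n) :
    (exceeds p i j).holds ⟨σ, V⟩ ↔
      S.level (σ 1) B (j.eval ⟨σ, V⟩) < c * S.drop (σ 1) (i.eval ⟨σ, V⟩) := by
  simp only [exceeds, BExp.holds, VExp.eval, hr.eval_countOf hi, h.eval_loadOf hr hj, hp,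
    h.weight _ hi, h.weight _ hj, not_le, BivaluedData.drop, BivaluedData.level]
  rw [← mul_div_assoc, div_lt_div_iff₀ (S.w_pos _ hj) (S.w_pos _ hi), mul_sub, sub_mul, mul_one]
  constructor <;> intro <;> linarith

theorem Env.holds_unbalanced (h : Env S V σ) {x y : ℕ} (hx : σ 4 (i.eval ⟨σ, V⟩) = x)
    (hy : σ 4 (j.eval ⟨σ, V⟩) = y) (hi : i.eval ⟨σ, V⟩ < S.n) (hj : j.eval ⟨σ, V⟩ < S.n) :
    (unbalanced i j).holds ⟨σ, V⟩ ↔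
      (y : F) / S.w (j.eval ⟨σ, V⟩) < ((x : F) - 1) / S.w (i.eval ⟨σ, V⟩) := by
  simp only [unbalanced, BExp.holds, VExp.eval, NExp.eval, hx, hy, h.weight _ hi, h.weight _ hj,
    not_le]
  rw [div_lt_div_iff₀ (S.w_pos _ hj) (S.w_pos _ hi), sub_mul, one_mul]
  constructor <;> intro <;> linarith

/-! ### Selection of agents -/

/-- A bound for the steps of a loop with at most `N` rounds of at most `T` steps. -/
abbrev forSteps (N T : ℕ) : ℕ := N * (T + 2) + 2

theorem runs_findMin {N : ℕ} (hE : Env S V σ) (hR : Rep S B σ) (hn : S.n ≤ N) :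
    Runs V findMin σ (forSteps N 2 + 1) fun σ' => σ' 18 0 < S.n ∧
      ∀ l, l < S.n → S.level (σ 1) B (σ' 18 0) ≤ S.level (σ 1) B l := by
  have h00 := hE.agents
  refine Runs.set_seq (Runs.forRange (fun k σ' => σ' 18 0 < S.n ∧ ∀ l, l < k →
    S.level (σ 1) B (σ' 18 0) ≤ S.level (σ 1) B l) rfl rfl (by decide) (by simpa [h00]) ?_ ?_ ?_ ?_)
  · simp [S.n_pos, NExp.eval]
  · intro k σ' x h
    simpa using h
  · intro k σ' hk hf hc h
    have hk : k < S.n := by simpa [h00] using hk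
    have hE' : Env S V σ' := hE.congr (hf 0 rfl) (hf 2 rfl) (hf 9 rfl) (hf 10 rfl)
    have hR' : Rep S B σ' := hR.congr (hf 1 rfl) (hf 3 rfl) (hf 4 rfl) (hf 5 rfl)
    have h1 : σ' 1 = σ 1 := hf 1 rfl
    have hlt := hE'.holds_levelLt hR' (i := .var 11) (j := .var 18) (by simpa [NExp.eval, hc])
      (by simpa [NExp.eval] using h.1)
    simp only [NExp.eval, hc, h1] at hlt
    refine Runs.ite (fun hb => Runs.set (T := 0) ?_) (fun hb => Runs.skip ?_)
    · simp only [NExp.eval, Mem.upd_self, Function.update_self, hc]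
      rw [hlt] at hb
      refine ⟨hk, fun l hl => ?_⟩
      rcases Nat.lt_succ_iff_lt_or_eq.1 hl with hl | rfl
      · exact hb.le.trans (h.2 l hl)
      · exact le_rfl
    · rw [hlt, not_lt] at hb
      refine ⟨h.1, fun l hl => ?_⟩
      rcases Nat.lt_succ_iff_lt_or_eq.1 hl with hl | rfl
      · exact h.2 l hl
      · exact hb
  · intro σ' hf h
    have : σ.upd 18 0 0 0 0 = S.n := h00
    simpa only [NExp.eval, this] using h

theorem runs_findMax {N : ℕ} (hE : Env S V σ) (hR : Rep S B σ) (hn : S.n ≤ N) (hj : σ 18 0 < S.n)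
    (hmin : ∀ l, l < S.n → S.level (σ 1) B (σ 18 0) ≤ S.level (σ 1) B l) :
    Runs V findMax σ (forSteps N 3 + 1) fun σ' =>
      (σ' 20 0 = 0 ∧ ∀ r, r < S.n → ¬ (B r ∨ S.Envies (σ 1) B r)) ∨
      (1 ≤ σ' 20 0 ∧ σ' 19 0 < S.n ∧ (B (σ' 19 0) ∨ S.Envies (σ 1) B (σ' 19 0)) ∧
        ∀ r, r < S.n → B r ∨ S.Envies (σ 1) B r → S.drop (σ 1) r ≤ S.drop (σ 1) (σ' 19 0)) := by
  have h00 := hE.agents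
  refine Runs.set_seq (Runs.forRange (fun k σ' =>
    (σ' 20 0 = 0 ∧ ∀ r, r < k → ¬ (B r ∨ S.Envies (σ 1) B r)) ∨
      (1 ≤ σ' 20 0 ∧ σ' 19 0 < S.n ∧ (B (σ' 19 0) ∨ S.Envies (σ 1) B (σ' 19 0)) ∧
        ∀ r, r < k → B r ∨ S.Envies (σ 1) B r → S.drop (σ 1) r ≤ S.drop (σ 1) (σ' 19 0)))
    rfl rfl (by decide) (by simpa [h00]) ?_ ?_ ?_ ?_)
  · simp [NExp.eval]
  · intro k σ' x h
    simpa using h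
  · intro k σ' hk hf hc h
    have hk : k < S.n := by simpa [h00] using hk
    have hE' : Env S V σ' := hE.congr (hf 0 rfl) (hf 2 rfl) (hf 9 rfl) (hf 10 rfl)
    have hR' : Rep S B σ' := hR.congr (hf 1 rfl) (hf 3 rfl) (hf 4 rfl) (hf 5 rfl)
    have h1 : σ' 1 = σ 1 := hf 1 rfl
    have h18 : σ' 18 = σ 18 := hf 18 rfl
    have hcand : (isCandidate (.var 11)).holds ⟨σ', V⟩ ↔ B k ∨ S.Envies (σ 1) B k := by
      have h3 := hR'.raised k hk
      have h5 := hR'.dear k hk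
      have hx := hE'.holds_exceeds hR' hE'.eval_minCost (i := .var 11) (j := .var 18)
        (by simpa [NExp.eval, hc]) (by simpa [NExp.eval, h18])
      simp only [NExp.eval, hc, h1, h18] at hx h5
      have hex : (∃ l, l < S.n ∧ S.level (σ 1) B l < S.a * S.drop (σ 1) k) ↔
          S.level (σ 1) B (σ 18 0) < S.a * S.drop (σ 1) k :=
        ⟨fun ⟨l, hl, h⟩ => (hmin l hl).trans_lt h, fun h => ⟨_, hj, h⟩⟩
      simp only [isCandidate, BExp.or, BExp.holds, NExp.eval, hc, h3, h5, hx, BivaluedData.Envies,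
        hex, Nat.le_zero]
      tauto
    have hdrop : σ' 19 0 < S.n → ((dropLt (.var 19) (.var 11)).holds ⟨σ', V⟩ ↔
        S.drop (σ 1) (σ' 19 0) < S.drop (σ 1) k) := by
      intro h19
      have := hE'.holds_dropLt hR' (i := .var 19) (j := .var 11) (by simpa [NExp.eval])
        (by simpa [NExp.eval, hc])
      simpa only [NExp.eval, hc, h1] using this
    refine Runs.ite (fun hb => Runs.set_seq (Runs.set (T := 0) (Or.inr ?_)))
      (fun hb => Runs.skip ?_)
    · obtain ⟨hb1, hb2⟩ := hb
      rw [hcand] at hb1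
      have e19 : ∀ x y, ((σ'.upd 19 0 x).upd 20 0 y) 19 0 = x := by simp
      have e20 : ∀ x y, ((σ'.upd 19 0 x).upd 20 0 y) 20 0 = y := by simp
      simp only [NExp.eval, hc, e19, e20]
      refine ⟨le_rfl, hk, hb1, fun r hr hcr => ?_⟩
      rcases Nat.lt_succ_iff_lt_or_eq.1 hr with hr | rfl
      · rcases h with h | h
        · exact absurd hcr (h.2 r hr)
        · have h20 : ¬ σ' 20 0 ≤ 0 := by omega
          simp only [BExp.holds, NExp.eval, h20, hdrop h.2.1] at hb2
          exact (h.2.2.2 r hr hcr).trans (by simpa using hb2 : _ < _).le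
      · exact le_rfl
    · simp only [BExp.holds, hcand] at hb
      rcases h with h | h
      · left
        refine ⟨h.1, fun r hr => ?_⟩
        rcases Nat.lt_succ_iff_lt_or_eq.1 hr with hr | rfl
        · exact h.2 r hr
        · intro hcr
          exact hb ⟨hcr, by simp [NExp.eval, h.1]⟩
      · right
        refine ⟨h.1, h.2.1, h.2.2.1, fun r hr hcr => ?_⟩
        rcases Nat.lt_succ_iff_lt_or_eq.1 hr with hr | rfl
        · exact h.2.2.2 r hr hcr
        · rw [hdrop h.2.1] at hb
          by_contra hlt
          rw [not_le] at hlt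
          exact hb ⟨hcr, fun hn => hn.2 hlt⟩
  · intro σ' hf h
    have : σ.upd 20 0 0 0 0 = S.n := h00
    simpa only [NExp.eval, this] using h

end ChoreProgram

namespace BivaluedData

variable {F : Type} [Field F] [LinearOrder F] (S : BivaluedData F)

/-- The number of marked agents. -/
def marks (mark : ℕ → ℕ) : ℕ := ((Finset.range S.n).filter fun u => 1 ≤ mark u).card

/-- The marked agents form a tree with root `j`: a marked agent `u ≠ j` owns `item u`, which is low
for it and for the marked agent `next u`, and the rank decreases from `u` to `next u`. -/
structure IsTree (own mark item next rank : ℕ → ℕ) (j : ℕ) : Prop where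
  root : 1 ≤ mark j
  reach : ∀ u, u < S.n → 1 ≤ mark u → S.Reach own u j
  rank_lt : ∀ u, u < S.n → 1 ≤ mark u → rank u < S.marks mark
  step : ∀ u, u < S.n → 1 ≤ mark u → u ≠ j → item u < S.m ∧ own (item u) = u ∧
    S.low u (item u) ∧ S.low (next u) (item u) ∧ 1 ≤ mark (next u) ∧ rank (next u) < rank u

variable {S} {own mark item next rank : ℕ → ℕ} {j : ℕ}

theorem marks_le (mark : ℕ → ℕ) : S.marks mark ≤ S.n :=
  (Finset.card_filter_le _ _).trans (by simp)

theorem IsTree.init (hj : 1 ≤ mark j) (h : ∀ u, u < S.n → u ≠ j → mark u = 0) :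
    S.IsTree own mark item next (fun _ => 0) j := by
  have h' : ∀ u, u < S.n → 1 ≤ mark u → u = j := by
    intro u hu hm
    by_contra hne
    have := h u hu hne
    omega
  refine ⟨hj, fun u hu hm => ?_, fun u hu hm => ?_, fun u hu hm hne => absurd (h' u hu hm) hne⟩
  · rw [h' u hu hm]; exact Relation.ReflTransGen.refl
  · exact Finset.card_pos.2 ⟨u, by simp [hu, hm]⟩

theorem marks_update {u : ℕ} (hu : u < S.n) (h : mark u = 0) :
    S.marks (Function.update mark u 1) = S.marks mark + 1 := by
  unfold marks
  rw [← Finset.card_insert_of_notMem (a := u) (by simp [h])]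
  congr 1
  ext v
  rcases eq_or_ne v u with rfl | hv <;> simp_all

theorem IsTree.extend (h : S.IsTree own mark item next rank j) {e l : ℕ} (he : e < S.m)
    (hl : 1 ≤ mark l) (hown : mark (own e) = 0) (hlo : S.low (own e) e) (hll : S.low l e) :
    S.IsTree own (Function.update mark (own e) 1) (Function.update item (own e) e)
      (Function.update next (own e) l) (Function.update rank (own e) (S.marks mark)) j := by
  have hne : ∀ {v}, 1 ≤ mark v → v ≠ own e := by
    rintro v hv rfl
    omega
  have hmarks := marks_update (S := S) (S.low_lt _ _ hlo) hown
  have hln := S.low_lt _ _ hll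
  refine ⟨?_, fun u hu hm => ?_, fun u hu hm => ?_, fun u hu hm huj => ?_⟩
  · rw [Function.update_of_ne (hne h.root)]; exact h.root
  · rcases eq_or_ne u (own e) with rfl | hue
    · exact Relation.ReflTransGen.head ⟨e, he, rfl, hlo, hll⟩ (h.reach l hln hl)
    · rw [Function.update_of_ne hue] at hm
      exact h.reach u hu hm
  · rw [hmarks]
    rcases eq_or_ne u (own e) with rfl | hue
    · simp
    · rw [Function.update_of_ne hue] at hm ⊢
      exact (h.rank_lt u hu hm).trans (Nat.lt_succ_self _)
  · rcases eq_or_ne u (own e) with rfl | hue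
    · simp only [Function.update_self, Function.update_of_ne (hne hl)]
      exact ⟨he, trivial, hlo, hll, hl, h.rank_lt l hln hl⟩
    · rw [Function.update_of_ne hue] at hm
      have := h.step u hu hm huj
      have hne' := hne this.2.2.2.2.1
      simpa only [Function.update_of_ne hue, Function.update_of_ne hne'] using this

theorem reach_imp_marked (hj : 1 ≤ mark j) (hclosed : ∀ e, e < S.m → S.low (own e) e →
    ∀ l, l < S.n → 1 ≤ mark l → S.low l e → 1 ≤ mark (own e)) {u : ℕ} (h : S.Reach own u j) :
    1 ≤ mark u := by
  induction h using Relation.ReflTransGen.head_induction_on with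
  | refl => exact hj
  | head hE _ ih =>
    obtain ⟨e, he, rfl, hlo, hll⟩ := hE
    exact hclosed e he hlo _ (S.low_lt _ _ hll) ih hll

end BivaluedData

namespace ChoreProgram

open RAM

variable {F : Type} [Field F] [LinearOrder F] {S : BivaluedData F} {V : ℕ → ℕ → F} {σ : Mem}

/-- The marks in memory describe the agents that reach agent `j`. -/
structure Marked (S : BivaluedData F) (j : ℕ) (σ : Mem) : Prop where
  tree : ∃ rank, S.IsTree (σ 1) (σ 6) (σ 7) (σ 8) rank j
  iff : ∀ u, u < S.n → (1 ≤ σ 6 u ↔ S.Reach (σ 1) u j)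

abbrev loopSteps (N T : ℕ) : ℕ := N * (T + 1) + 1

abbrev pathSteps (N : ℕ) : ℕ :=
  forSteps N 1 + (loopSteps (N + 1) (forSteps N (forSteps N 5 + 1) + 1) + 1 + 1)

theorem runs_findPaths {N : ℕ} (hE : Env S V σ) (hn : S.n ≤ N) (hm : S.m ≤ N) :
    Runs V findPaths σ (pathSteps N) (Marked S (σ 13 0)) := by
  have h00 := hE.agents
  set j := σ 13 0 with hjdef
  refine Runs.seq (R := fun σ' => ∀ u, u < S.n → σ' 6 u = 0)
    (Runs.forRange (fun k σ' => ∀ u, u < k → σ' 6 u = 0) rfl rfl (by decide) (by rwa [h00])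
      (by simp) (by simp) ?_ (by simp [h00])) ?_
  · intro k σ' hk hf hc h
    refine Runs.set (T := 0) ?_
    simp only [NExp.eval, hc, Mem.upd_self]
    intro u hu
    rcases Nat.lt_succ_iff_lt_or_eq.1 hu with hu | rfl
    · rw [Function.update_of_ne hu.ne, h u hu]
    · simp
  intro σ₀ hf₀ hclear
  have h13 : σ₀ 13 0 = j := by rw [hf₀ 13 rfl]
  refine Runs.set_seq (Runs.set_seq ?_)
  simp only [NExp.eval, h13]
  let Closed : Mem → ℕ → Prop := fun σ' e => S.low (σ 1 e) e →
    ∀ l, l < S.n → 1 ≤ σ' 6 l → S.low l e → 1 ≤ σ' 6 (σ 1 e)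
  refine Runs.loop (fun σ' => (∃ rank, S.IsTree (σ 1) (σ' 6) (σ' 7) (σ' 8) rank j) ∧ σ' 16 0 ≤ 1 ∧
    (σ' 16 0 = 0 → ∀ e, e < S.m → Closed σ' e)) (fun σ' => S.n - S.marks (σ' 6) + σ' 16 0)
    ?_ ?_ ?_ ?_
  · rintro σ₁ hf₁ ⟨htree, h16, -⟩ hb
    have h16 : σ₁ 16 0 = 1 := le_antisymm h16 (by simpa [BExp.holds, NExp.eval] using hb)
    have hle₁ := BivaluedData.marks_le (S := S) (σ₁ 6)
    have hE₁ : Env S V σ₁ := hE.congr ((hf₁ 0 rfl).trans (hf₀ 0 rfl))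
      ((hf₁ 2 rfl).trans (hf₀ 2 rfl)) ((hf₁ 9 rfl).trans (hf₀ 9 rfl))
      ((hf₁ 10 rfl).trans (hf₀ 10 rfl))
    have hown₁ : σ₁ 1 = σ 1 := (hf₁ 1 rfl).trans (hf₀ 1 rfl)
    refine Runs.set_seq ?_
    simp only [NExp.eval]
    refine Runs.forRange (fun k σ' => (∃ rank, S.IsTree (σ 1) (σ' 6) (σ' 7) (σ' 8) rank j) ∧
      ((σ' 16 0 = 0 ∧ σ' 6 = σ₁ 6 ∧ ∀ e, e < k → Closed σ' e) ∨
        (σ' 16 0 = 1 ∧ S.marks (σ₁ 6) < S.marks (σ' 6)))) rfl rfl (by decide)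
        (hE₁.items.trans_le hm) ?_ ?_ ?_ ?_
    · exact ⟨by simpa using htree, Or.inl (by simp)⟩
    · intro k σ' x h
      simpa [Closed] using h
    · intro k σ₂ hk hf₂ hc₂ h
      have hk : k < S.m := hE₁.items ▸ hk
      have hE₂ : Env S V σ₂ := hE₁.congr (hf₂ 0 rfl) (hf₂ 2 rfl) (hf₂ 9 rfl) (hf₂ 10 rfl)
      have hown₂ : σ₂ 1 = σ 1 := (hf₂ 1 rfl).trans hown₁
      have hcond : (BExp.and (.nlt (ownerOf (.var 11)) ChoreProgram.agents)
          (isLow (ownerOf (.var 11)) (.var 11))).holds ⟨σ₂, V⟩ ↔ S.low (σ 1 k) k := by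
        have hl := hE₂.holds_isLow (i := ownerOf (.var 11)) (e := .var 11)
        simp only [BExp.holds, NExp.eval, hc₂, hown₂, hE₂.agents, not_le] at hl ⊢
        exact ⟨fun h => (hl h.1 hk).1 h.2, fun h => ⟨S.low_lt _ _ h, (hl (S.low_lt _ _ h) hk).2 h⟩⟩
      refine Runs.ite (T := forSteps N 5) (fun hb => ?_)
        (fun hb => Runs.mono_steps (T := 1) (Runs.skip (T := 0) ?_)
        (by unfold forSteps; omega))
      · rw [hcond] at hb
        have hon := S.low_lt _ _ hb
        refine Runs.forRange (T := 5) (fun k' σ' =>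
          (∃ rank, S.IsTree (σ 1) (σ' 6) (σ' 7) (σ' 8) rank j) ∧
          ((σ' 16 0 = 0 ∧ σ' 6 = σ₁ 6 ∧ (∀ e, e < k → Closed σ' e) ∧
              ∀ l, l < k' → 1 ≤ σ' 6 l → S.low l k → 1 ≤ σ' 6 (σ 1 k)) ∨
            (σ' 16 0 = 1 ∧ S.marks (σ₁ 6) < S.marks (σ' 6)))) rfl rfl (by decide)
            (hE₂.agents.trans_le hn) ?_ ?_ ?_ ?_
        · refine ⟨h.1, h.2.imp_left fun h => ⟨h.1, h.2.1, h.2.2, by simp⟩⟩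
        · intro k' σ' x h
          simpa [Closed] using h
        · intro k' σ₃ hk' hf₃ hc₃ h₃
          have hk' : k' < S.n := hE₂.agents ▸ hk'
          have hE₃ : Env S V σ₃ := hE₂.congr (hf₃ 0 rfl) (hf₃ 2 rfl) (hf₃ 9 rfl) (hf₃ 10 rfl)
          have hown₃ : σ₃ 1 = σ 1 := (hf₃ 1 rfl).trans hown₂
          have hc₃' : σ₃ 11 0 = k := by rw [hf₃ 11 rfl, hc₂]
          have hcond₃ : (BExp.and (.nle (.read 6 (ownerOf (.var 11))) (.const 0))
              (.and (.nle (.const 1) (.read 6 (.var 12)))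
                (isLow (.var 12) (.var 11)))).holds ⟨σ₃, V⟩ ↔
              σ₃ 6 (σ 1 k) = 0 ∧ 1 ≤ σ₃ 6 k' ∧ S.low k' k := by
            have hl := hE₃.holds_isLow (i := .var 12) (e := .var 11)
            simp only [BExp.holds, NExp.eval, hc₃, hc₃', hown₃, Nat.le_zero] at hl ⊢
            rw [hl hk' hk]
          refine Runs.ite (T := 4) (fun hb₃ => Runs.set_seq (Runs.set_seq (Runs.set_seq
            (Runs.set (T := 0) ?_)))) (fun hb₃ => Runs.skip (T := 3) ?_)
          · rw [hcond₃] at hb₃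
            obtain ⟨⟨rank, ht⟩, hor⟩ := h₃
            have ht' := ht.extend hk hb₃.2.1 hb₃.1 hb hb₃.2.2
            have hm' := BivaluedData.marks_update (S := S) hon hb₃.1
            have e11 : ∀ a x y (τ : Mem), a ≠ 11 → (τ.upd a x y) 11 = τ 11 :=
              fun a x y τ h => Mem.upd_ne _ _ _ h.symm
            simp only [NExp.eval, e11, Mem.upd_ne, Mem.upd_self, hc₃, hc₃', hown₃, ne_eq,
              OfNat.one_ne_ofNat, not_false_eq_true, Nat.reduceEqDiff]
            refine ⟨⟨_, ht'⟩, Or.inr ⟨by simp, ?_⟩⟩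
            rw [hm']
            rcases hor with hor | hor
            · rw [hor.2.1]; omega
            · omega
          · rw [hcond₃] at hb₃
            refine ⟨h₃.1, h₃.2.imp_left fun h => ⟨h.1, h.2.1, h.2.2.1, fun l hl hml hll => ?_⟩⟩
            rcases Nat.lt_succ_iff_lt_or_eq.1 hl with hl | rfl
            · exact h.2.2.2 l hl hml hll
            · by_contra h0
              exact hb₃ ⟨by omega, hml, hll⟩
        · intro σ' hf' h'
          rw [hE₂.agents] at h'
          refine ⟨h'.1, h'.2.imp_left fun h => ⟨h.1, h.2.1, fun e he => ?_⟩⟩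
          rcases Nat.lt_succ_iff_lt_or_eq.1 he with he | rfl
          · exact h.2.2.1 e he
          · exact fun _ => h.2.2.2
      · rw [hcond] at hb
        refine ⟨h.1, h.2.imp_left fun h => ⟨h.1, h.2.1, fun e he => ?_⟩⟩
        rcases Nat.lt_succ_iff_lt_or_eq.1 he with he | rfl
        · exact h.2.2 e he
        · exact fun h => absurd h hb
    · intro σ' hf' h'
      have : (σ₁.upd 16 0 0) 0 1 = S.m := hE₁.items
      rw [this] at h'
      obtain ⟨ht, h' | h'⟩ := h'
      · exact ⟨⟨ht, by omega, fun _ => h'.2.2⟩, by rw [h'.1, h'.2.1]; omega⟩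
      · refine ⟨⟨ht, by omega, fun h => by omega⟩, ?_⟩
        have := BivaluedData.marks_le (S := S) (σ' 6)
        omega
  · refine ⟨⟨_, BivaluedData.IsTree.init (by simp) fun u hu hne => ?_⟩, by simp, by simp⟩
    simpa [hne] using hclear u hu
  · rintro σ₁ hf₁ ⟨⟨rank, ht⟩, -, hcl⟩ hb
    have hown₁ : σ₁ 1 = σ 1 := (hf₁ 1 rfl).trans (hf₀ 1 rfl)
    have h16 : σ₁ 16 0 = 0 := by simpa [BExp.holds, NExp.eval] using hb
    refine ⟨⟨rank, by rwa [hown₁]⟩, fun u hu => ?_⟩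
    rw [hown₁]
    exact ⟨ht.reach u hu, BivaluedData.reach_imp_marked ht.root fun e he => hcl h16 e he⟩
  · simp; omega

end ChoreProgram

namespace BivaluedData

variable {F : Type} [Field F] [LinearOrder F] {S : BivaluedData F}

theorem LowAllocation.move {own : ℕ → ℕ} (h : S.LowAllocation own) {e l : ℕ} (he : e < S.m)
    (hlo : S.low (own e) e) (hll : S.low l e) : S.LowAllocation (Function.update own e l) ∧
      ∀ u, S.lows (Function.update own e l) u + (if u = own e then 1 else 0) =
        S.lows own u + if u = l then 1 else 0 := by
  classical
  refine ⟨fun x hx => ?_, fun u => ?_⟩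
  · rcases eq_or_ne x e with rfl | hxe
    · rw [Function.update_self]; exact Or.inr hll
    · rw [Function.update_of_ne hxe]; exact h x hx
  · have := num_update (S := S) (fun i e => ¬ False ∧ S.low i e) own he l u
    unfold lows cheap
    convert this using 3 <;> aesop

end BivaluedData

namespace ChoreProgram

open RAM

variable {F : Type} [Field F] [LinearOrder F] {S : BivaluedData F} {V : ℕ → ℕ → F} {σ : Mem}

theorem runs_transfer {N : ℕ} (hn : S.n ≤ N) (hlow : S.LowAllocation (σ 1))
    (htree : ∃ rank, S.IsTree (σ 1) (σ 6) (σ 7) (σ 8) rank (σ 13 0)) (hi : σ 14 0 < S.n)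
    (hmark : 1 ≤ σ 6 (σ 14 0)) (hij : σ 14 0 ≠ σ 13 0)
    (hx : ∀ u, u < S.n → σ 4 u = S.lows (σ 1) u) :
    Runs V transfer σ (loopSteps N 2 + 3 + 1) fun σ' => S.LowAllocation (σ' 1) ∧
      (∀ u, u < S.n → σ' 4 u = S.lows (σ' 1) u) ∧
      (∀ u, u < S.n → S.lows (σ' 1) u + (if u = σ 14 0 then 1 else 0) =
        S.lows (σ 1) u + if u = σ 13 0 then 1 else 0) ∧ σ' 15 0 = 1 := by
  obtain ⟨rank, ht⟩ := htree
  set i := σ 14 0 with hidef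
  set j := σ 13 0 with hjdef
  refine Runs.set_seq (Runs.seq (R := fun σ' => S.LowAllocation (σ' 1) ∧
    ∀ u, u < S.n → S.lows (σ' 1) u + (if u = i then 1 else 0) =
        S.lows (σ 1) u + if u = j then 1 else 0)
    (Runs.loop (T := 2) (fun σ' => σ' 17 0 < S.n ∧ 1 ≤ σ 6 (σ' 17 0) ∧ S.LowAllocation (σ' 1) ∧
      (∀ u, u < S.n → 1 ≤ σ 6 u → u ≠ j → rank u ≤ rank (σ' 17 0) → σ' 1 (σ 7 u) = u) ∧
      ∀ u, u < S.n → S.lows (σ' 1) u + (if u = i then 1 else 0) =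
        S.lows (σ 1) u + if u = σ' 17 0 then 1 else 0) (fun σ' => rank (σ' 17 0)) ?_ ?_ ?_ ?_) ?_)
  · rintro σ₁ hf ⟨h17, hm17, hl, hp, hcnt⟩ hb
    have h7 : σ₁ 7 = σ 7 := hf 7 rfl
    have h8 : σ₁ 8 = σ 8 := hf 8 rfl
    have h13 : σ₁ 13 0 = j := by rw [hf 13 rfl]; rfl
    have hne : σ₁ 17 0 ≠ j := by
      intro h
      exact hb ⟨(h.trans h13.symm).le, (h.trans h13.symm).ge⟩
    generalize hcur : σ₁ 17 0 = cur at *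
    obtain ⟨s1, -, s3, s4, s5, s6⟩ := ht.step cur h17 hm17 hne
    have hown := hp cur h17 hm17 hne le_rfl
    have hmv := hl.move s1 (l := σ 8 cur) (by rwa [hown]) s4
    rw [hown] at hmv
    refine Runs.set_seq (Runs.set (T := 0) ?_)
    simp only [NExp.eval, hcur, h7, h8, Mem.upd_self, Function.update_self, Mem.upd_ne, ne_eq,
      OfNat.ofNat_ne_one, OfNat.one_ne_ofNat, not_false_eq_true]
    refine ⟨⟨S.low_lt _ _ s4, s5, hmv.1, fun u hu hmu huj hr => ?_, fun u hu => ?_⟩, s6⟩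
    · rw [Function.update_of_ne, hp u hu hmu huj (hr.trans s6.le)]
      intro h
      have h1 := (ht.step u hu hmu huj).2.1
      have h2 := (ht.step cur h17 hm17 hne).2.1
      rw [h, h2] at h1
      subst h1
      omega
    · have h1 := hmv.2 u
      have h2 := hcnt u hu
      omega
  · simp only [NExp.eval, Mem.upd_self, Function.update_self, Mem.upd_ne, ne_eq,
      OfNat.one_ne_ofNat, not_false_eq_true]
    exact ⟨hi, hmark, hlow, fun u hu hm huj _ => (ht.step u hu hm huj).2.1, fun _ _ => rfl⟩
  · rintro σ₁ hf ⟨-, -, hl, -, hcnt⟩ hb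
    have h13 : σ₁ 13 0 = j := by rw [hf 13 rfl]; rfl
    have h17 : σ₁ 17 0 = j := by
      simp only [BExp.holds, NExp.eval, h13, not_not] at hb
      omega
    rw [h17] at hcnt
    exact ⟨hl, hcnt⟩
  · simp only [NExp.eval, Mem.upd_self, Function.update_self]
    exact (ht.rank_lt i hi hmark).le.trans ((BivaluedData.marks_le _).trans hn)
  · rintro σ₁ hf ⟨hl, hcnt⟩
    have h13 : σ₁ 13 0 = j := by rw [hf 13 rfl]; rfl
    have h14 : σ₁ 14 0 = i := by rw [hf 14 rfl]; rfl
    have h4 : σ₁ 4 = σ 4 := hf 4 rfl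
    refine Runs.set_seq (Runs.set_seq (Runs.set (T := 0) ?_))
    simp only [NExp.eval, h13, h14, h4, Mem.upd_self, Function.update_self, Mem.upd_ne, ne_eq,
      OfNat.one_ne_ofNat, not_false_eq_true, Nat.reduceEqDiff]
    refine ⟨hl, fun u hu => ?_, hcnt, trivial⟩
    have h1 := hcnt u hu
    have h2 := hx u hu
    rcases eq_or_ne u j with rfl | huj
    · simp only [hij.symm, if_false, if_true, add_zero] at h1
      rw [Function.update_self, Function.update_of_ne hij.symm, h2]
      exact h1.symm
    · rw [Function.update_of_ne huj]
      rcases eq_or_ne u i with rfl | hui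
      · simp only [hij, if_false, if_true, add_zero] at h1
        rw [Function.update_self, h2]
        omega
      · simp only [hui, huj, if_false, add_zero] at h1
        rw [Function.update_of_ne hui, h2, h1]

variable [IsStrictOrderedRing F]

abbrev transferSteps (N : ℕ) : ℕ := loopSteps N 2 + 3 + 1

abbrev balanceSteps (N : ℕ) : ℕ :=
  loopSteps (N * (N * (N * (N + 1))) + 1)
    (forSteps N (pathSteps N + forSteps N (transferSteps N + 1) + 1) + 1) + 1

/-- No agent has more items per unit of weight than an agent that it reaches, even after removal
of one item. -/
def IsBalanced (S : BivaluedData F) (own : ℕ → ℕ) (i j : ℕ) : Prop :=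
  S.Reach own i j → ((S.lows own i : F) - 1) / S.w i ≤ S.lows own j / S.w j

theorem runs_balance {N : ℕ} (hE : Env S V σ) (hn : S.n ≤ N) (hm : S.m ≤ N)
    (hlow : S.LowAllocation (σ 1)) (hx : ∀ u, u < S.n → σ 4 u = S.lows (σ 1) u) :
    Runs V balance σ (balanceSteps N) fun σ' => S.LowAllocation (σ' 1) ∧
      (∀ u, u < S.n → σ' 4 u = S.lows (σ' 1) u) ∧
      ∀ i j, i < S.n → j < S.n → IsBalanced S (σ' 1) i j := by
  refine Runs.set_seq (Runs.loop (fun σ' => S.LowAllocation (σ' 1) ∧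
    (∀ u, u < S.n → σ' 4 u = S.lows (σ' 1) u) ∧ σ' 15 0 ≤ 1 ∧
    (σ' 15 0 = 0 → ∀ i j, i < S.n → j < S.n → IsBalanced S (σ' 1) i j))
    (fun σ' => S.potential (S.lows (σ' 1)) + σ' 15 0) ?_ ?_ ?_ ?_)
  · rintro σ₁ hf₁ ⟨hlow₁, hx₁, h15, -⟩ hb
    have h15 : σ₁ 15 0 = 1 := le_antisymm h15 (by simpa [BExp.holds, NExp.eval] using hb)
    have hE₁ : Env S V σ₁ := hE.congr (hf₁ 0 rfl) (hf₁ 2 rfl) (hf₁ 9 rfl) (hf₁ 10 rfl)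
    refine Runs.set_seq ?_
    simp only [NExp.eval]
    refine Runs.forRange (fun k σ' => S.LowAllocation (σ' 1) ∧
      (∀ u, u < S.n → σ' 4 u = S.lows (σ' 1) u) ∧
      ((σ' 15 0 = 0 ∧ σ' 1 = σ₁ 1 ∧ ∀ j, j < k → ∀ i, i < S.n → IsBalanced S (σ₁ 1) i j) ∨
        (σ' 15 0 = 1 ∧ S.potential (S.lows (σ' 1)) < S.potential (S.lows (σ₁ 1)))))
      rfl rfl (by decide) (hE₁.agents.trans_le hn) ?_ ?_ ?_ ?_
    · exact ⟨hlow₁, hx₁, Or.inl (by simp)⟩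
    · intro k σ' x h
      simpa using h
    · intro k σ₂ hk hf₂ hc₂ h₂
      have hk : k < S.n := hE₁.agents ▸ hk
      have hE₂ : Env S V σ₂ := hE₁.congr (hf₂ 0 rfl) (hf₂ 2 rfl) (hf₂ 9 rfl) (hf₂ 10 rfl)
      refine Runs.ite (fun hb₂ => ?_) (fun hb₂ => Runs.mono_steps (T := 1) (Runs.skip (T := 0) ?_)
        (by simp only [forSteps, pathSteps, loopSteps]; omega))
      · have h15₂ : σ₂ 15 0 = 0 := by simpa [BExp.holds, NExp.eval] using hb₂
        obtain ⟨hlow₂, hx₂, h₂⟩ := h₂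
        obtain ⟨-, hown₂, hprev⟩ := h₂.resolve_right (by omega)
        refine Runs.seq (runs_findPaths hE₂ hn hm) fun σ₃ hf₃ hM => ?_
        rw [hc₂] at hM
        have hE₃ : Env S V σ₃ := hE₂.congr (hf₃ 0 rfl) (hf₃ 2 rfl) (hf₃ 9 rfl) (hf₃ 10 rfl)
        have hown₃ : σ₃ 1 = σ₁ 1 := (hf₃ 1 rfl).trans hown₂
        refine Runs.forRange (fun k' σ' => S.LowAllocation (σ' 1) ∧
          (∀ u, u < S.n → σ' 4 u = S.lows (σ' 1) u) ∧
          ((σ' 15 0 = 0 ∧ σ' 1 = σ₁ 1 ∧ ∀ i, i < k' → IsBalanced S (σ₁ 1) i k) ∨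
            (σ' 15 0 = 1 ∧ S.potential (S.lows (σ' 1)) < S.potential (S.lows (σ₁ 1)))))
          rfl rfl (by decide) (hE₃.agents.trans_le hn) ?_ ?_ ?_ ?_
        · rw [hf₃ 1 rfl, hf₃ 4 rfl, hf₃ 15 rfl]
          exact ⟨hlow₂, hx₂, Or.inl ⟨h15₂, hown₂, by simp⟩⟩
        · intro k' σ' x h
          simpa using h
        · intro k' σ₄ hk' hf₄ hc₄ h₄
          have hk' : k' < S.n := hE₃.agents ▸ hk'
          have hE₄ : Env S V σ₄ := hE₃.congr (hf₄ 0 rfl) (hf₄ 2 rfl) (hf₄ 9 rfl) (hf₄ 10 rfl)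
          have h13 : σ₄ 13 0 = k := by rw [hf₄ 13 rfl, hf₃ 13 rfl, hc₂]
          have h6 : σ₄ 6 = σ₃ 6 := hf₄ 6 rfl
          obtain ⟨hlow₄, hx₄, h₄⟩ := h₄
          have hunb := hE₄.holds_unbalanced (i := .var 14) (j := .var 13) (x := S.lows (σ₄ 1) k')
            (y := S.lows (σ₄ 1) k) (by simpa [NExp.eval, hc₄] using hx₄ k' hk')
            (by simpa [NExp.eval, h13] using hx₄ k hk) (by simpa [NExp.eval, hc₄])
            (by simpa [NExp.eval, h13])
          simp only [NExp.eval, hc₄, h13] at hunb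
          refine Runs.ite (fun hb₄ => ?_) (fun hb₄ => Runs.mono_steps (T := 1)
            (Runs.skip (T := 0) ?_) (by simp only [transferSteps]; omega))
          · simp only [BExp.holds, NExp.eval, hc₄, hunb, h6, Nat.le_zero] at hb₄
            obtain ⟨h15₄, hmark, hlt⟩ := hb₄
            obtain ⟨-, hown₄, -⟩ := h₄.resolve_right (by omega)
            have hne : k' ≠ k := by
              rintro rfl
              rw [div_lt_div_iff_of_pos_right (S.w_pos _ hk')] at hlt
              linarith
            refine Runs.mono (runs_transfer hn hlow₄ ?_ (by rwa [hc₄]) (by rwa [hc₄, h6])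
              (by rwa [hc₄, h13]) hx₄) le_rfl ?_
            · rw [hown₄, ← hown₃, hf₄ 6 rfl, hf₄ 7 rfl, hf₄ 8 rfl, h13]
              exact hM.tree
            · rintro σ₅ - ⟨hlow₅, hx₅, hmove, h15₅⟩
              refine ⟨hlow₅, hx₅, Or.inr ⟨h15₅, ?_⟩⟩
              rw [← hown₄]
              rw [hc₄, h13] at hmove
              exact BivaluedData.potential_lt hk' hk hne (BivaluedData.num_le _ _ _) hmove hlt
          · refine ⟨hlow₄, hx₄, h₄.imp_left fun h => ⟨h.1, h.2.1, fun i hi => ?_⟩⟩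
            rcases Nat.lt_succ_iff_lt_or_eq.1 hi with hi | rfl
            · exact h.2.2 i hi
            · intro hr
              have hmark : 1 ≤ σ₃ 6 i := (hM.iff i hk').2 (by rwa [hown₃])
              simp only [BExp.holds, NExp.eval, hc₄, hunb, h6, Nat.le_zero, h.1, hmark, true_and,
                h.2.1, not_lt] at hb₄
              exact hb₄
        · intro σ' hf' h'
          rw [hE₃.agents] at h'
          refine ⟨h'.1, h'.2.1, h'.2.2.imp_left fun h => ⟨h.1, h.2.1, fun j hj => ?_⟩⟩
          rcases Nat.lt_succ_iff_lt_or_eq.1 hj with hj | rfl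
          · exact hprev j hj
          · exact h.2.2
      · have h15₂ : ¬ σ₂ 15 0 = 0 := by simpa [BExp.holds, NExp.eval] using hb₂
        exact ⟨h₂.1, h₂.2.1, Or.inr (h₂.2.2.resolve_left fun h => h15₂ h.1)⟩
    · intro σ' hf' h'
      have : (σ₁.upd 15 0 0) 0 0 = S.n := hE₁.agents
      rw [this] at h'
      obtain ⟨hl, hx, h' | h'⟩ := h'
      · refine ⟨⟨hl, hx, by omega, fun _ i j hi hj => ?_⟩, by rw [h'.1, h'.2.1]; omega⟩
        rw [h'.2.1]
        exact h'.2.2 j hj i hi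
      · exact ⟨⟨hl, hx, by omega, fun h => by omega⟩, by omega⟩
  · exact ⟨hlow, hx, by simp [NExp.eval], by simp [NExp.eval]⟩
  · rintro σ₁ - ⟨hl, hx, -, h⟩ hb
    exact ⟨hl, hx, h (by simpa [BExp.holds, NExp.eval] using hb)⟩
  · simp only [NExp.eval, Mem.upd_self, Function.update_self]
    refine Nat.add_le_add_right ((BivaluedData.potential_le fun i _ =>
      BivaluedData.num_le _ _ _).trans ?_) 1
    gcongr

end ChoreProgram

namespace BivaluedData

variable {F : Type} [Field F] [LinearOrder F] {S : BivaluedData F} {own : ℕ → ℕ} {B B' : ℕ → Prop}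

theorem cheap_update {e : ℕ} (he : e < S.m) (hlow : ∀ l, S.low l e → B l) (j u : ℕ) :
    S.cheap (Function.update own e j) B u = S.cheap own B u := by
  have := num_update (S := S) (fun i e => ¬ B i ∧ S.low i e) own he j u
  rwa [if_neg fun h => h.2.1 (hlow u h.2.2), if_neg fun h => h.2.1 (hlow u h.2.2)] at this

theorem dear_update {e : ℕ} (he : e < S.m) (hlow : ∀ l, S.low l e → B l) (j u : ℕ) :
    S.dear (Function.update own e j) B u + (if u = own e then 1 else 0) =
      S.dear own B u + if u = j then 1 else 0 := by
  classical
  have h := num_update (S := S) (fun i e => B i ∨ ¬ S.low i e) own he j u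
  have htrue : B u ∨ ¬ S.low u e := by
    have := hlow u
    tauto
  unfold dear
  convert h using 3 <;> simp [htrue, eq_comm]

open Classical in
variable (S) in
/-- A bound for the number of changes that are still possible. -/
noncomputable def work (own : ℕ → ℕ) (B : ℕ → Prop) : ℕ :=
  ((Finset.range S.n).filter fun i => ¬ B i).card * (S.m + 1) +
    ((Finset.range S.m).filter fun e => B (own e)).card

theorem work_le (own : ℕ → ℕ) (B : ℕ → Prop) : S.work own B ≤ S.n * (S.m + 1) + S.m := by
  classical
  exact add_le_add (Nat.mul_le_mul_right _ ((Finset.card_filter_le _ _).trans (by simp)))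
    ((Finset.card_filter_le _ _).trans (by simp))

theorem work_congr (hown : ∀ e, e < S.m → own e < S.n) (h : ∀ i, i < S.n → (B i ↔ B' i)) :
    S.work own B = S.work own B' := by
  classical
  unfold work
  rw [Finset.filter_congr fun i hi => not_congr (h i (Finset.mem_range.1 hi)),
    Finset.filter_congr fun e he => h _ (hown e (Finset.mem_range.1 he))]

theorem work_raise (hsub : ∀ i, B i → B' i) {i : ℕ} (hi : i < S.n) (hB : ¬ B i) (hB' : B' i) :
    S.work own B' < S.work own B := by
  classical
  unfold work
  have h1 : ((Finset.range S.n).filter fun i => ¬ B' i).card <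
      ((Finset.range S.n).filter fun i => ¬ B i).card := by
    apply Finset.card_lt_card
    rw [Finset.ssubset_iff_of_subset]
    · exact ⟨i, by simp [hi, hB], by simp [hB']⟩
    · intro k
      simp only [Finset.mem_filter]
      exact fun hk => ⟨hk.1, fun h => hk.2 (hsub k h)⟩
  have h2 : ((Finset.range S.m).filter fun e => B' (own e)).card ≤ S.m :=
    (Finset.card_filter_le _ _).trans (by simp)
  have h3 := Nat.mul_le_mul_right (S.m + 1) (Nat.succ_le_of_lt h1)
  rw [Nat.succ_mul] at h3
  omega

theorem work_give {e j : ℕ} (he : e < S.m) (hB : B (own e)) (hj : ¬ B j) :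
    S.work (Function.update own e j) B < S.work own B := by
  classical
  unfold work
  refine Nat.add_lt_add_left (Finset.card_lt_card ?_) _
  rw [Finset.ssubset_iff_of_subset]
  · exact ⟨e, by simp [he, hB], by simp [hj]⟩
  · intro x
    rcases eq_or_ne x e with rfl | hx <;> simp_all

end BivaluedData

namespace ChoreProgram

open RAM

variable {F : Type} [Field F] [LinearOrder F] {S : BivaluedData F} {V : ℕ → ℕ → F} {σ σ' : Mem}
  {B B' : ℕ → Prop}

theorem Rep.congr_raised (h : Rep S B σ) (hB : ∀ i, i < S.n → (B i ↔ B' i)) : Rep S B' σ :=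
  ⟨fun i hi => (h.raised i hi).trans (hB i hi),
    fun i hi => (h.cheap i hi).trans (BivaluedData.cheap_congr (hB i hi)),
    fun i hi => (h.dear i hi).trans (BivaluedData.dear_congr (hB i hi))⟩

/-- An item that is low for raised agents only changes its owner. -/
theorem Rep.update (h : Rep S B σ) {e j : ℕ} (he : e < S.m) (hlow : ∀ l, S.low l e → B l)
    (h1 : σ' 1 = Function.update (σ 1) e j) (h3 : σ' 3 = σ 3) (h4 : σ' 4 = σ 4)
    (h5 : ∀ u, u < S.n → σ' 5 u + (if u = σ 1 e then 1 else 0) =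
      σ 5 u + if u = j then 1 else 0) : Rep S B σ' := by
  refine ⟨by rw [h3]; exact h.raised, fun u hu => ?_, fun u hu => ?_⟩
  · rw [h4, h1, BivaluedData.cheap_update he hlow, h.cheap u hu]
  · have h6 := BivaluedData.dear_update (S := S) (own := σ 1) he hlow j u
    have h7 := h5 u hu
    rw [h.dear u hu] at h7
    rw [h1]
    omega

abbrev minSteps (N : ℕ) : ℕ := forSteps N 2 + 1

theorem runs_fill [IsStrictOrderedRing F] {N : ℕ} (hE : Env S V σ) (hn : S.n ≤ N) (hm : S.m ≤ N)
    (hI : S.Inv (σ 1) fun _ => False) (hR : Rep S (fun _ => False) σ) :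
    Runs V fill σ (forSteps N (minSteps N + 2 + 1)) fun σ' =>
      S.Inv (σ' 1) (fun _ => False) ∧ Rep S (fun _ => False) σ' ∧
        ∀ e, e < S.m → σ' 1 e < S.n := by
  refine Runs.forRange (fun k σ' => S.Inv (σ' 1) (fun _ => False) ∧ Rep S (fun _ => False) σ' ∧
        ∀ e, e < k → e < S.m → σ' 1 e < S.n) rfl rfl (by decide) (hE.items.trans_le hm) ?_ ?_ ?_ ?_
  · exact ⟨hI, hR, by simp⟩
  · rintro k σ' x ⟨h1, h2, h3⟩
    exact ⟨h1, h2.congr rfl rfl rfl rfl, h3⟩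
  · rintro k σ₁ hk hf hc ⟨hI₁, hR₁, hown⟩
    have hk : k < S.m := hE.items ▸ hk
    have hE₁ : Env S V σ₁ := hE.congr (hf 0 rfl) (hf 2 rfl) (hf 9 rfl) (hf 10 rfl)
    refine Runs.ite (T := minSteps N + 2) (fun hb => ?_) (fun hb => Runs.skip ?_)
    · have hfree : σ₁ 1 k = S.n := by
        simp only [BExp.holds, NExp.eval, hE₁.agents, hc] at hb
        exact le_antisymm (hI₁.own_le k hk) hb
      have hlow : ∀ l, S.low l k → False := hI₁.free k hk hfree
      refine Runs.seq (runs_findMin hE₁ hR₁ hn) fun σ₂ hf₂ ⟨hj, hmin⟩ => ?_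
      have hc₂ : σ₂ 13 0 = k := by rw [hf₂ 13 rfl, hc]
      generalize hjdef : σ₂ 18 0 = j at *
      have h1 : σ₂ 1 = σ₁ 1 := hf₂ 1 rfl
      have h5 : σ₂ 5 = σ₁ 5 := hf₂ 5 rfl
      refine Runs.set_seq (Runs.set (T := 0) ?_)
      simp only [NExp.eval, hc₂, hjdef, Mem.upd_self, Mem.upd_ne, ne_eq,
        OfNat.ofNat_ne_one, OfNat.one_ne_ofNat, not_false_eq_true, h1, h5]
      refine ⟨hI₁.assign hk hfree hj (by simp) hmin, hR₁.update (j := j) hk hlow ?_ (hf₂ 3 rfl)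
        (hf₂ 4 rfl) ?_, fun e he hem => ?_⟩
      · simp [h1]
      · intro u hu
        have : u ≠ σ₁ 1 k := by omega
        simp only [Mem.upd_self, this, if_false]
        rcases eq_or_ne u j with rfl | huj
        · simp
        · simp [huj, h5]
      · rcases Nat.lt_succ_iff_lt_or_eq.1 he with he | rfl
        · rw [Function.update_of_ne he.ne]; exact hown e he hem
        · simpa using hj
    · refine ⟨hI₁, hR₁, fun e he hem => ?_⟩
      rcases Nat.lt_succ_iff_lt_or_eq.1 he with he | rfl
      · exact hown e he hem
      · simpa [BExp.holds, NExp.eval, hE₁.agents, hc] using hb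
  · rintro σ' - ⟨h1, h2, h3⟩
    rw [hE.items] at h3
    exact ⟨h1, h2, fun e he => h3 e he he⟩

theorem runs_raise {N : ℕ} (hE : Env S V σ) (hn : S.n ≤ N) (hm : S.m ≤ N) (hR : Rep S B σ)
    (hi : σ 19 0 < S.n)
    (hdear : ∀ r, S.Reach (σ 1) (σ 19 0) r → ¬ B r → S.dear (σ 1) B r = 0) :
    Runs V raise σ (forSteps N (pathSteps N + (3 + 1))) fun σ' =>
      Rep S (fun r => B r ∨ S.Reach (σ 1) (σ 19 0) r) σ' := by
  set i := σ 19 0 with hidef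
  refine Runs.forRange (fun k σ' => Rep S (fun r => B r ∨ (r < k ∧ S.Reach (σ 1) i r)) σ')
    rfl rfl (by decide) (hE.agents.trans_le hn) ?_ ?_ ?_ ?_
  · exact hR.congr_raised (by simp)
  · intro k σ' x h
    exact h.congr rfl rfl rfl rfl
  · intro k σ₁ hk hf hc hR₁
    have hk : k < S.n := hE.agents ▸ hk
    have hE₁ : Env S V σ₁ := hE.congr (hf 0 rfl) (hf 2 rfl) (hf 9 rfl) (hf 10 rfl)
    refine Runs.seq (runs_findPaths hE₁ hn hm) fun σ₂ hf₂ hM => ?_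
    rw [hc] at hM
    have hR₂ := hR₁.congr (hf₂ 1 rfl) (hf₂ 3 rfl) (hf₂ 4 rfl) (hf₂ 5 rfl)
    have hc₂ : σ₂ 13 0 = k := by rw [hf₂ 13 rfl, hc]
    have h1 : σ₂ 1 = σ 1 := (hf₂ 1 rfl).trans (hf 1 rfl)
    have h19 : σ₂ 19 0 = i := by rw [hf₂ 19 rfl, hf 19 rfl]
    have hraised := hR₂.raised k hk
    simp only [lt_irrefl, false_and, or_false] at hraised
    have hmark := hM.iff i hi
    rw [h1] at hmark
    have hne : ∀ u, u ≠ k → ((B u ∨ (u < k ∧ S.Reach (σ 1) i u)) ↔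
        (B u ∨ (u < k + 1 ∧ S.Reach (σ 1) i u))) := by
      intro u hu
      have : u < k + 1 ↔ u < k := by omega
      rw [this]
    refine Runs.ite (fun hb => ?_) (fun hb => Runs.skip ?_)
    · simp only [BExp.holds, NExp.eval, hc₂, h19, hmark] at hb
      obtain ⟨hreach, hB⟩ := hb
      have hB : ¬ B k := by rw [← hraised]; omega
      have hnew : B k ∨ (k < k + 1 ∧ S.Reach (σ 1) i k) := Or.inr ⟨Nat.lt_succ_self k, hreach⟩
      have hcheap := hR₂.cheap k hk
      have hk₂ : (B k ∨ (k < k ∧ S.Reach (σ 1) i k)) ↔ B k := by simp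
      rw [BivaluedData.cheap_congr (B' := B) hk₂, h1] at hcheap
      have hcount : σ₂ 4 k = S.count (σ 1) k := by
        rw [BivaluedData.count_eq _ B, hdear k hreach hB, hcheap, add_zero]
      refine Runs.set_seq (Runs.set_seq (Runs.set (T := 0) ?_))
      simp only [NExp.eval, hc₂, Mem.upd_ne, ne_eq, not_false_eq_true, Nat.reduceEqDiff]
      constructor
      · intro u hu
        rcases eq_or_ne u k with rfl | huk
        · simp [hreach]
        · rw [← hne u huk, ← hR₂.raised u hu]
          simp [huk]
      · intro u hu
        rcases eq_or_ne u k with rfl | huk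
        · rw [BivaluedData.cheap_of_raised (B := fun r => B r ∨ (r < u + 1 ∧ S.Reach (σ 1) i r)) hnew]
          simp
        · rw [← BivaluedData.cheap_congr (B := fun r => B r ∨ (r < k ∧ S.Reach (σ 1) i r))
            (hne u huk)]
          simpa [huk] using hR₂.cheap u hu
      · intro u hu
        rcases eq_or_ne u k with rfl | huk
        · rw [BivaluedData.dear_of_raised (B := fun r => B r ∨ (r < u + 1 ∧ S.Reach (σ 1) i r)) hnew]
          simp [hcount, h1]
        · rw [← BivaluedData.dear_congr (B := fun r => B r ∨ (r < k ∧ S.Reach (σ 1) i r))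
            (hne u huk)]
          simpa [huk] using hR₂.dear u hu
    · refine hR₂.congr_raised fun u hu => ?_
      rcases eq_or_ne u k with rfl | huk
      · simp only [BExp.holds, NExp.eval, hc₂, h19, hmark, Nat.le_zero] at hb
        have : S.Reach (σ 1) i u → B u := by
          intro hr
          rw [← hraised]
          by_contra h0
          exact hb ⟨hr, by omega⟩
        simp only [lt_irrefl, false_and, or_false, Nat.lt_succ_self, true_and]
        tauto
      · exact hne u huk
  · intro σ' _ h
    rw [hE.agents] at h
    refine h.congr_raised fun u hu => ?_
    simp [hu]

theorem runs_give {N : ℕ} (hE : Env S V σ) (hm : S.m ≤ N) (hR : Rep S B σ) (hs : σ 19 0 < S.n)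
    (hne : σ 19 0 ≠ σ 18 0) (hB : B (σ 19 0))
    (hhigh : ∀ e, e < S.m → B (σ 1 e) → ∀ l, S.low l e → B l)
    (hpos : 0 < S.dear (σ 1) B (σ 19 0)) :
    Runs V give σ (forSteps N 2 + 3) fun σ' => ∃ e, e < S.m ∧ σ 1 e = σ 19 0 ∧
      σ' 1 = Function.update (σ 1) e (σ 18 0) ∧ Rep S B σ' := by
  set s := σ 19 0 with hsdef
  set j := σ 18 0 with hjdef
  obtain ⟨e₀, he₀, hown₀, -⟩ := BivaluedData.exists_of_num_pos hpos
  refine Runs.seq (R := fun σ' => σ' 21 0 < S.m ∧ σ 1 (σ' 21 0) = s)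
    (Runs.forRange (fun k σ' => (∃ e, e < k ∧ σ 1 e = s) → σ' 21 0 < S.m ∧ σ 1 (σ' 21 0) = s)
      rfl rfl (by decide) (hE.items.trans_le hm) (by simp) (by simp) ?_ ?_) ?_
  · intro k σ₁ hk hf hc h
    have hk : k < S.m := hE.items ▸ hk
    have h1 : σ₁ 1 = σ 1 := hf 1 rfl
    have h19 : σ₁ 19 0 = s := by rw [hf 19 rfl]
    refine Runs.ite (fun hb => Runs.set (T := 0) ?_) (fun hb => Runs.skip ?_)
    · simp only [BExp.holds, NExp.eval, hc, h1, h19] at hb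
      simp only [NExp.eval, hc, Mem.upd_self, Function.update_self]
      exact fun _ => ⟨hk, le_antisymm hb.1 hb.2⟩
    · simp only [BExp.holds, NExp.eval, hc, h1, h19] at hb
      rintro ⟨e, he, heo⟩
      rcases Nat.lt_succ_iff_lt_or_eq.1 he with he | rfl
      · exact h ⟨e, he, heo⟩
      · exact absurd ⟨heo.le, heo.ge⟩ hb
  · intro σ' _ h
    rw [hE.items] at h
    exact h ⟨e₀, he₀, hown₀⟩
  · rintro σ₁ hf ⟨he, hown⟩
    obtain ⟨e, hedef⟩ : ∃ e, σ₁ 21 0 = e := ⟨_, rfl⟩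
    rw [hedef] at he hown
    have h1 : σ₁ 1 = σ 1 := hf 1 rfl
    have h5 : σ₁ 5 = σ 5 := hf 5 rfl
    have h18 : σ₁ 18 0 = j := by rw [hf 18 rfl]
    have h19 : σ₁ 19 0 = s := by rw [hf 19 rfl]
    refine Runs.set_seq (Runs.set_seq (Runs.set (T := 0) ?_))
    have hBe : B (σ 1 e) := by rwa [hown]
    simp only [NExp.eval, h18, h19, hedef, Mem.upd_self, Mem.upd_ne, ne_eq, OfNat.ofNat_ne_one,
      OfNat.one_ne_ofNat, not_false_eq_true, Nat.reduceEqDiff, h1]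
    refine ⟨e, he, hown, rfl, hR.update (j := j) he (hhigh e he hBe) (by simp [h1]) (hf 3 rfl) (hf 4 rfl) ?_⟩
    intro u hu
    have hs5 := hR.dear s hs
    simp only [Mem.upd_self, hown, h5]
    rcases eq_or_ne u j with rfl | huj
    · simp [hne.symm]
    · rcases eq_or_ne u s with rfl | hus
      · simp [huj]; omega
      · simp [huj, hus, h5]

abbrev raiseSteps (N : ℕ) : ℕ := forSteps N (pathSteps N + (3 + 1))

abbrev giveSteps (N : ℕ) : ℕ := forSteps N 2 + 3

abbrev improveSteps (N : ℕ) : ℕ :=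
  loopSteps (N * (N + 1) + N + 1) (minSteps N + (forSteps N 3 + 1 +
    (raiseSteps N + giveSteps N + 1 + 1 + 1 + 1)) + 1) + 1

/-- Nobody envies another agent beyond one item with respect to prices. -/
def IsFair (S : BivaluedData F) (own : ℕ → ℕ) (B : ℕ → Prop) : Prop :=
  (∀ i, ¬ S.Envies own B i) ∧
    ∀ i l, B i → l < S.n → S.b * S.drop own i ≤ S.level own B l

theorem runs_improve [IsStrictOrderedRing F] {N : ℕ} (hE : Env S V σ) (hn : S.n ≤ N) (hm : S.m ≤ N)
    (hI : S.Inv (σ 1) fun _ => False) (hR : Rep S (fun _ => False) σ)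
    (hown : ∀ e, e < S.m → σ 1 e < S.n) :
    Runs V improve σ (improveSteps N) fun σ' => ∃ B, S.Inv (σ' 1) B ∧
      (∀ e, e < S.m → σ' 1 e < S.n) ∧ IsFair S (σ' 1) B := by
  refine Runs.set_seq (Runs.loop (fun σ' => ∃ B, S.Inv (σ' 1) B ∧ Rep S B σ' ∧
    (∀ e, e < S.m → σ' 1 e < S.n) ∧ σ' 15 0 ≤ 1 ∧ (σ' 15 0 = 0 → IsFair S (σ' 1) B))
    (fun σ' => S.work (σ' 1) (fun i => 1 ≤ σ' 3 i) + σ' 15 0) ?_ ?_ ?_ ?_)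
  · rintro σ₁ hf₁ ⟨B, hI₁, hR₁, hown₁, h15, -⟩ hb
    have h15 : σ₁ 15 0 = 1 := le_antisymm h15 (by simpa [BExp.holds, NExp.eval] using hb)
    have hE₁ : Env S V σ₁ := hE.congr (hf₁ 0 rfl) (hf₁ 2 rfl) (hf₁ 9 rfl) (hf₁ 10 rfl)
    rw [h15, BivaluedData.work_congr hown₁ hR₁.raised]
    refine Runs.set_seq ?_
    simp only [NExp.eval]
    refine Runs.seq (runs_findMin (hE₁.congr rfl rfl rfl rfl) (hR₁.congr rfl rfl rfl rfl) hn) ?_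
    rintro σ₂ hf₂ ⟨hj, hmin⟩
    have h15₂ : σ₂ 15 0 = 0 := (congrFun (hf₂ 15 rfl) 0).trans rfl
    replace hf₂ : ∀ a, a ≠ 15 → findMin.writes a = false → σ₂ a = σ₁ a :=
      fun a h h' => (hf₂ a h').trans (Mem.upd_ne _ _ _ h)
    have h1₂ : σ₂ 1 = σ₁ 1 := hf₂ 1 (by decide) rfl
    have hE₂ : Env S V σ₂ := hE₁.congr (hf₂ 0 (by decide) rfl) (hf₂ 2 (by decide) rfl)
      (hf₂ 9 (by decide) rfl) (hf₂ 10 (by decide) rfl)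
    have hR₂ : Rep S B σ₂ := hR₁.congr h1₂ (hf₂ 3 (by decide) rfl) (hf₂ 4 (by decide) rfl)
      (hf₂ 5 (by decide) rfl)
    replace hmin : ∀ l, l < S.n → S.level (σ₁ 1) B (σ₂ 18 0) ≤ S.level (σ₁ 1) B l := hmin
    refine Runs.seq (runs_findMax hE₂ hR₂ hn hj (by rwa [h1₂])) ?_
    intro σ₃ hf₃ h₃
    rw [h1₂] at h₃
    have h1₃ : σ₃ 1 = σ₁ 1 := (hf₃ 1 rfl).trans h1₂
    have h15₃ : σ₃ 15 0 = 0 := by rw [hf₃ 15 rfl, h15₂]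
    have h18₃ : σ₃ 18 = σ₂ 18 := hf₃ 18 rfl
    have hE₃ : Env S V σ₃ := hE₂.congr (hf₃ 0 rfl) (hf₃ 2 rfl) (hf₃ 9 rfl) (hf₃ 10 rfl)
    have hR₃ : Rep S B σ₃ := hR₂.congr (hf₃ 1 rfl) (hf₃ 3 rfl) (hf₃ 4 rfl) (hf₃ 5 rfl)
    have hwork : S.work (σ₃ 1) (fun i => 1 ≤ σ₃ 3 i) = S.work (σ₁ 1) B := by
      rw [h1₃]; exact BivaluedData.work_congr hown₁ hR₃.raised
    have hfinish : IsFair S (σ₁ 1) B → (∃ B, S.Inv (σ₃ 1) B ∧ Rep S B σ₃ ∧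
        (∀ e, e < S.m → σ₃ 1 e < S.n) ∧ σ₃ 15 0 ≤ 1 ∧ (σ₃ 15 0 = 0 → IsFair S (σ₃ 1) B)) ∧
        S.work (σ₃ 1) (fun i => 1 ≤ σ₃ 3 i) + σ₃ 15 0 < S.work (σ₁ 1) B + 1 := by
      intro h
      rw [hwork, h15₃, h1₃]
      exact ⟨⟨B, hI₁, hR₃, hown₁, by omega, fun _ => h⟩, by omega⟩
    generalize hjdef : σ₂ 18 0 = j at *
    refine Runs.ite (T := raiseSteps N + giveSteps N + 1 + 1 + 1)
      (fun hb₃ => Runs.ite (fun hb₄ => Runs.ite (fun hb₅ => ?_) (fun hb₅ => Runs.skip ?_))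
        (fun hb₄ => ?_)) (fun hb₃ => Runs.skip ?_)
    · obtain ⟨-, hi, -, hmax⟩ := h₃.resolve_left fun h => by
        simp only [BExp.holds, NExp.eval, h.1] at hb₃; omega
      have hB : B (σ₃ 19 0) := (hR₃.raised _ hi).1 hb₄
      rw [hE₃.holds_exceeds hR₃ hE₃.eval_maxCost (i := .var 19) (j := .var 18) hi (by simpa [NExp.eval, h18₃, hjdef])] at hb₅
      simp only [NExp.eval, h18₃, hjdef, h1₃] at hb₅
      generalize hidef : σ₃ 19 0 = i at *
      have hdrop : 0 < S.drop (σ₁ 1) i := by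
        by_contra h0
        have h1 := mul_nonpos_of_nonneg_of_nonpos S.b_nonneg (not_lt.1 h0)
        have h2 := BivaluedData.level_nonneg (S := S) (own := σ₁ 1) (B := B) hj
        linarith
      have hcount : 0 < S.count (σ₁ 1) i := by
        by_contra h0
        have h1 : S.count (σ₁ 1) i = 0 := by omega
        rw [BivaluedData.drop, h1, div_pos_iff_of_pos_right (S.w_pos i hi)] at hdrop
        norm_num at hdrop
      have hne : i ≠ j := by
        rintro rfl
        rw [BivaluedData.level, BivaluedData.load, BivaluedData.cheap_of_raised hB,
          BivaluedData.dear_of_raised hB, BivaluedData.drop, ← mul_div_assoc,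
          div_lt_div_iff_of_pos_right (S.w_pos i hi)] at hb₅
        have := S.b_nonneg
        simp only [Nat.cast_zero, mul_zero, zero_add] at hb₅
        linarith
      refine Runs.mono_steps (Runs.seq (T₁ := giveSteps N) (T₂ := 1) (runs_give hE₃ hm hR₃ (by rwa [hidef])
        (by rwa [h18₃, hjdef, hidef]) (by rwa [hidef]) ?_ ?_) ?_)
        (by omega)
      · intro e he hBe
        rw [h1₃] at hBe
        exact hI₁.high e he (Or.inl hBe)
      · rwa [hidef, h1₃, BivaluedData.dear_of_raised hB]
      · rintro σ₄ hf₄ ⟨e, he, hei, hown₄, hR₄⟩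
        rw [h18₃, hjdef, h1₃] at hown₄
        rw [h1₃, hidef] at hei
        have hnj := hI₁.not_raised_of_lt (own := σ₁ 1) (e := e) (by rwa [hei]) (by rwa [hei])
        have hown' : ∀ e, e < S.m → σ₄ 1 e < S.n := by
          intro x hx
          rw [hown₄]
          rcases eq_or_ne x e with rfl | hxe
          · rwa [Function.update_self]
          · rw [Function.update_of_ne hxe]; exact hown₁ x hx
        refine Runs.set (T := 0) ⟨⟨B, ?_, hR₄.congr rfl rfl rfl rfl, hown', ?_, ?_⟩, ?_⟩
        · simp only [Mem.upd_ne, ne_eq, OfNat.one_ne_ofNat, not_false_eq_true, hown₄]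
          refine hI₁.give (by rwa [hei]) (by rwa [hei]) he hj (fun r hr => ?_) hmin
          rw [hei]
          exact hmax r (hr.elim (hI₁.raised_lt r) fun h => h.1) hr
        · simp [NExp.eval]
        · simp [NExp.eval]
        · simp only [NExp.eval, Mem.upd_self, Function.update_self, Mem.upd_ne, ne_eq,
            OfNat.one_ne_ofNat, not_false_eq_true, Nat.reduceEqDiff]
          rw [BivaluedData.work_congr hown' hR₄.raised, hown₄]
          exact Nat.add_lt_add_right (BivaluedData.work_give he (by rwa [hei]) hnj) 1
    · obtain ⟨-, hi, -, hmax⟩ := h₃.resolve_left fun h => by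
        simp only [BExp.holds, NExp.eval, h.1] at hb₃; omega
      rw [hE₃.holds_exceeds hR₃ hE₃.eval_maxCost (i := .var 19) (j := .var 18) hi (by simpa [NExp.eval, h18₃, hjdef])] at hb₅
      simp only [NExp.eval, h18₃, hjdef, h1₃, not_lt] at hb₅
      have hle : ∀ r, r < S.n → B r ∨ S.Envies (σ₁ 1) B r → ∀ l, l < S.n →
          S.b * S.drop (σ₁ 1) r ≤ S.level (σ₁ 1) B l := fun r hr hc l hl =>
        (mul_le_mul_of_nonneg_left (hmax r hr hc) S.b_nonneg).trans (hb₅.trans (hmin l hl))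
      refine hfinish ⟨fun r hr => ?_, fun r l hr => hle r (hI₁.raised_lt r hr) (Or.inl hr) l⟩
      have ha := BivaluedData.Inv.pos_of_envies hr
      have hr' := hr
      obtain ⟨hrn, -, -, l, hl, hlt⟩ := hr'
      have h1 := hle r hrn (Or.inr hr) l hl
      have h2 := BivaluedData.level_nonneg (S := S) (own := σ₁ 1) (B := B) hl
      have h3 : 0 < S.drop (σ₁ 1) r := pos_of_mul_pos_right (h2.trans_lt hlt) ha.le
      have h4 := mul_le_mul_of_nonneg_right S.a_le_b h3.le
      linarith
    · obtain ⟨-, hi, hcand, hmax⟩ := h₃.resolve_left fun h => by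
        simp only [BExp.holds, NExp.eval, h.1] at hb₃; omega
      have hB : ¬ B (σ₃ 19 0) := fun h => hb₄ ((hR₃.raised _ hi).2 h)
      have henv := hcand.resolve_left hB
      have hmax' : ∀ r, B r ∨ S.Envies (σ₁ 1) B r → S.drop (σ₁ 1) r ≤ S.drop (σ₁ 1) (σ₃ 19 0) :=
        fun r hr => hmax r (hr.elim (hI₁.raised_lt r) fun h => h.1) hr
      refine Runs.mono_steps (Runs.seq (T₁ := raiseSteps N) (T₂ := 1)
        (runs_raise hE₃ hn hm hR₃ hi ?_) ?_) (by omega)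
      · intro r
        rw [h1₃]
        exact hI₁.dear_eq_zero_of_reach henv
      · intro σ₄ hf₄ hR₄
        have h1₄ : σ₄ 1 = σ₁ 1 := (hf₄ 1 rfl).trans h1₃
        rw [h1₃] at hR₄
        refine Runs.set (T := 0) ⟨⟨_, ?_, hR₄.congr rfl rfl rfl rfl, ?_, ?_, ?_⟩, ?_⟩
        · simp only [Mem.upd_ne, ne_eq, OfNat.one_ne_ofNat, not_false_eq_true, h1₄]
          exact hI₁.raise henv hmax'
        · simpa only [Mem.upd_ne, ne_eq, OfNat.one_ne_ofNat, not_false_eq_true, h1₄] using hown₁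
        · simp [NExp.eval]
        · simp [NExp.eval]
        · simp only [NExp.eval, Mem.upd_self, Function.update_self, Mem.upd_ne, ne_eq,
            OfNat.one_ne_ofNat, not_false_eq_true, Nat.reduceEqDiff]
          rw [h1₄, BivaluedData.work_congr hown₁ hR₄.raised]
          exact Nat.add_lt_add_right (BivaluedData.work_raise (fun r hr => Or.inl hr) hi hB
            (Or.inr Relation.ReflTransGen.refl)) 1
    · have hnone := (h₃.resolve_right fun h => hb₃ h.1).2
      exact hfinish ⟨fun r hr => hnone r hr.1 (Or.inr hr),
        fun r l hr => absurd (Or.inl hr) (hnone r (hI₁.raised_lt r hr))⟩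
  · exact ⟨_, hI, hR.congr rfl rfl rfl rfl, hown, by simp [NExp.eval], by simp [NExp.eval]⟩
  · rintro σ₁ - ⟨B, hI₁, -, hown₁, -, h⟩ hb
    exact ⟨B, hI₁, hown₁, h (by simpa [BExp.holds, NExp.eval] using hb)⟩
  · simp only [NExp.eval, Mem.upd_self, Function.update_self]
    refine Nat.add_le_add_right ((BivaluedData.work_le _ _).trans ?_) 1
    gcongr

end ChoreProgram

namespace ChoreProgram

open RAM

variable {F : Type} [Field F] [LinearOrder F] {S : BivaluedData F} {V : ℕ → ℕ → F} {σ : Mem}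

/-! ### Initialization -/

/-- The cells recorded in arrays `9` and `10` bound the costs of all pairs that satisfy `P`. -/
structure Extreme (V : ℕ → ℕ → F) (n m : ℕ) (P : ℕ → ℕ → Prop) (σ : Mem) : Prop where
  lt : 0 < m → (σ 9 0 < n ∧ σ 9 1 < m) ∧ σ 10 0 < n ∧ σ 10 1 < m
  le : ∀ i e, i < n → e < m → P i e → V 1 (σ 9 0 * m + σ 9 1) ≤ V 1 (i * m + e) ∧
    V 1 (i * m + e) ≤ V 1 (σ 10 0 * m + σ 10 1)

theorem runs_findCosts {N n m : ℕ} (h0 : σ 0 0 = n) (h1 : σ 0 1 = m) (hn : n ≤ N) (hm : m ≤ N)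
    (hpos : 0 < n) (h9 : ∀ k, σ 9 k = 0) (h10 : ∀ k, σ 10 k = 0) :
    Runs V findCosts σ (forSteps N (forSteps N (3 + 3))) (Extreme V n m fun _ _ => True) := by
  have hcongr : ∀ (P : ℕ → ℕ → Prop) (σ' : Mem) (c x : ℕ), c ≠ 9 → c ≠ 10 → Extreme V n m P σ' →
      Extreme V n m P (σ'.upd c 0 x) := by
    intro P σ' c x hc hc' h
    have e1 := Mem.upd_ne σ' 0 x hc.symm
    have e2 := Mem.upd_ne σ' 0 x hc'.symm
    exact ⟨by rw [e1, e2]; exact h.lt, by rw [e1, e2]; exact h.le⟩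
  refine Runs.forRange (fun k => Extreme V n m fun i _ => i < k) rfl rfl (by decide)
    (h0.trans_le hn) ?_ ?_ ?_ ?_
  · exact ⟨fun hm => by simp [h9, h10, hpos, hm], by simp⟩
  · exact fun k σ' x h => hcongr _ _ _ _ (by decide) (by decide) h
  · intro k σ₁ hk hf hc h
    refine Runs.forRange (fun k' => Extreme V n m fun i e => i < k ∨ (i = k ∧ e < k')) rfl rfl
      (by decide) (by rw [hf 0 rfl, h1]; exact hm) ?_ ?_ ?_ ?_
    · exact ⟨h.lt, fun i e hi he hP => h.le i e hi he (by simpa using hP)⟩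
    · exact fun k σ' x h => hcongr _ _ _ _ (by decide) (by decide) h
    · intro k' σ₂ hk' hf₂ hc₂ h₂
      rw [h0] at hk
      rw [hf 0 rfl, h1] at hk'
      have hc₁ : σ₂ 11 0 = k := by rw [hf₂ 11 rfl, hc]
      have hm₂ : σ₂ 0 1 = m := by rw [hf₂ 0 rfl, hf 0 rfl, h1]
      refine Runs.seq (T₁ := 3) (R := fun σ' =>
        (Extreme V n m (fun i e => i < k ∨ (i = k ∧ e < k')) σ') ∧
        V 1 (σ' 9 0 * m + σ' 9 1) ≤ V 1 (k * m + k')) (Runs.ite (fun hb => ?_) (fun hb => ?_)) ?_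
      · simp only [BExp.holds, VExp.eval, NExp.eval, minCost, hc₁, hc₂, hm₂, not_le] at hb
        refine Runs.set_seq (Runs.set (T := 0) ?_)
        have e9 : ∀ x y, ((σ₂.upd 9 0 x).upd 9 1 y) 9 0 = x ∧
            ((σ₂.upd 9 0 x).upd 9 1 y) 9 1 = y := by simp
        have e10 : ∀ x y, ((σ₂.upd 9 0 x).upd 9 1 y) 10 = σ₂ 10 := by simp
        have e12 : ∀ x, (σ₂.upd 9 0 x) 12 = σ₂ 12 := by simp
        simp only [NExp.eval, hc₁, e12, hc₂]
        refine ⟨⟨fun hm => ⟨by rw [(e9 _ _).1, (e9 _ _).2]; exact ⟨hk, hk'⟩, by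
          rw [e10]; exact (h₂.lt hm).2⟩, fun i e hi he hP => ?_⟩, ?_⟩
        · rw [(e9 _ _).1, (e9 _ _).2, e10]
          exact ⟨hb.le.trans (h₂.le i e hi he hP).1, (h₂.le i e hi he hP).2⟩
        · rw [(e9 _ _).1, (e9 _ _).2]
      · simp only [BExp.holds, VExp.eval, NExp.eval, minCost, hc₁, hc₂, hm₂, not_not] at hb
        exact Runs.skip (T := 1) ⟨h₂, hb⟩
      · rintro σ₃ hf₃ ⟨h₃, hle⟩
        have hc₁₃ : σ₃ 11 0 = k := by rw [hf₃ 11 rfl, hc₁]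
        have hc₂₃ : σ₃ 12 0 = k' := by rw [hf₃ 12 rfl, hc₂]
        have hm₃ : σ₃ 0 1 = m := by rw [hf₃ 0 rfl, hm₂]
        refine Runs.ite (T := 2) (fun hb => ?_) (fun hb => ?_)
        · simp only [BExp.holds, VExp.eval, NExp.eval, maxCost, hc₁₃, hc₂₃, hm₃, not_le] at hb
          refine Runs.set_seq (Runs.set (T := 0) ?_)
          have e10 : ∀ x y, ((σ₃.upd 10 0 x).upd 10 1 y) 10 0 = x ∧
              ((σ₃.upd 10 0 x).upd 10 1 y) 10 1 = y := by simp
          have e9 : ∀ x y, ((σ₃.upd 10 0 x).upd 10 1 y) 9 = σ₃ 9 := by simp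
          have e12 : ∀ x, (σ₃.upd 10 0 x) 12 = σ₃ 12 := by simp
          simp only [NExp.eval, hc₁₃, e12, hc₂₃]
          refine ⟨fun hm => ⟨by rw [e9]; exact (h₃.lt hm).1, by
            rw [(e10 _ _).1, (e10 _ _).2]; exact ⟨hk, hk'⟩⟩, fun i e hi he hP => ?_⟩
          rw [(e10 _ _).1, (e10 _ _).2, e9]
          by_cases hP' : i < k ∨ (i = k ∧ e < k')
          · exact ⟨(h₃.le i e hi he hP').1, (h₃.le i e hi he hP').2.trans hb.le⟩
          · obtain ⟨rfl, rfl⟩ : i = k ∧ e = k' := by omega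
            exact ⟨hle, le_rfl⟩
        · simp only [BExp.holds, VExp.eval, NExp.eval, maxCost, hc₁₃, hc₂₃, hm₃, not_not] at hb
          refine Runs.skip (T := 1) ⟨h₃.lt, fun i e hi he hP => ?_⟩
          by_cases hP' : i < k ∨ (i = k ∧ e < k')
          · exact h₃.le i e hi he hP'
          · obtain ⟨rfl, rfl⟩ : i = k ∧ e = k' := by omega
            exact ⟨hle, hb⟩
    · intro σ' _ h'
      rw [hf 0 rfl, h1] at h'
      exact ⟨h'.lt, fun i e hi he hP => h'.le i e hi he (by omega)⟩
  · intro σ' _ h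
    rw [h0] at h
    exact ⟨h.lt, fun i e hi he _ => h.le i e hi he hi⟩

theorem runs_clear {N : ℕ} (hn : σ 0 0 = S.n) (hm : σ 0 1 = S.m) (hN : S.m ≤ N) :
    Runs V clear σ (forSteps N 1) fun σ' => ∀ e, e < S.m → σ' 1 e = S.n := by
  refine Runs.forRange (fun k σ' => ∀ e, e < k → σ' 1 e = S.n) rfl rfl (by decide)
    (hm.trans_le hN) (by simp) (by simp) ?_ (by simp [hm])
  intro k σ₁ hk hf hc h
  refine Runs.set (T := 0) ?_
  simp only [NExp.eval, hc, hf 0 rfl, hn, Mem.upd_self]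
  intro e he
  rcases Nat.lt_succ_iff_lt_or_eq.1 he with he | rfl
  · rw [Function.update_of_ne he.ne, h e he]
  · simp

/-- The pairs that satisfy `P` have been processed in the allocation of the low items. -/
structure LowProgress (S : BivaluedData F) (P : ℕ → ℕ → Prop) (σ : Mem) : Prop where
  low : ∀ i e, i < S.n → e < S.m → (1 ≤ σ 2 (i * S.m + e) ↔ S.low i e ∧ P i e)
  own : ∀ e, e < S.m → (σ 1 e = S.n ∧ ∀ l, l < S.n → P l e → ¬ S.low l e) ∨ S.low (σ 1 e) e
  count : ∀ u, u < S.n → σ 4 u = S.lows (σ 1) u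

theorem LowProgress.congr {P P' : ℕ → ℕ → Prop} {σ' : Mem} (h : LowProgress S P σ)
    (hP : ∀ i e, i < S.n → e < S.m → (P i e ↔ P' i e)) (h1 : σ' 1 = σ 1) (h2 : σ' 2 = σ 2)
    (h4 : σ' 4 = σ 4) : LowProgress S P' σ' := by
  refine ⟨fun i e hi he => ?_, fun e he => ?_, ?_⟩
  · rw [h2, h.low i e hi he, hP i e hi he]
  · rw [h1]
    exact (h.own e he).imp_left fun h => ⟨h.1, fun l hl hPl => h.2 l hl ((hP l e hl he).2 hPl)⟩
  · rw [h1, h4]; exact h.count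

theorem cell_inj {m i e i' e' : ℕ} (he : e < m) (he' : e' < m) (h : i * m + e = i' * m + e') :
    i = i' ∧ e = e' := by
  have h1 : (i * m + e) / m = i := by
    rw [mul_comm, Nat.mul_add_div (by omega), Nat.div_eq_of_lt he, add_zero]
  have h2 : (i' * m + e') / m = i' := by
    rw [mul_comm, Nat.mul_add_div (by omega), Nat.div_eq_of_lt he', add_zero]
  obtain rfl : i = i' := by rw [← h1, h, h2]
  exact ⟨rfl, by omega⟩

theorem lows_update_free {own : ℕ → ℕ} {e k : ℕ} (he : e < S.m) (hfree : own e = S.n)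
    (hk : S.low k e) {u : ℕ} (hu : u < S.n) :
    S.lows (Function.update own e k) u = S.lows own u + if u = k then 1 else 0 := by
  classical
  have := BivaluedData.num_update (S := S) (fun i e => ¬ False ∧ S.low i e) own he k u
  rw [if_neg (by rintro ⟨h, -⟩; omega)] at this
  unfold BivaluedData.lows BivaluedData.cheap
  rw [add_zero] at this
  rw [this]
  congr 1
  rcases eq_or_ne u k with rfl | huk
  · simp [hk]
  · simp [huk, huk.symm]

theorem runs_assignLow {N : ℕ} (h0 : σ 0 0 = S.n) (h1 : σ 0 1 = S.m) (hn : S.n ≤ N) (hm : S.m ≤ N)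
    (ha : V 1 (σ 9 0 * S.m + σ 9 1) = S.a)
    (hlow : ∀ i e, i < S.n → e < S.m → (V 1 (i * S.m + e) ≤ S.a ↔ S.low i e))
    (hown : ∀ e, e < S.m → σ 1 e = S.n) (h2 : ∀ k, σ 2 k = 0) (h4 : ∀ k, σ 4 k = 0) :
    Runs V assignLow σ (forSteps N (forSteps N 5)) (LowProgress S fun _ _ => True) := by
  refine Runs.forRange (fun k => LowProgress S fun i _ => i < k) rfl rfl (by decide)
    (h0.trans_le hn) ?_ ?_ ?_ ?_
  · refine ⟨by simp [h2], fun e he => Or.inl ⟨hown e he, by simp⟩, fun u hu => ?_⟩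
    rw [h4]
    by_contra hne
    obtain ⟨e, he, h, -⟩ := BivaluedData.exists_of_num_pos (Nat.pos_of_ne_zero (Ne.symm hne))
    rw [hown e he] at h
    omega
  · exact fun k σ' x h => h.congr (by simp) (by simp) (by simp) (by simp)
  · intro k σ₁ hk hf hc h
    rw [h0] at hk
    refine Runs.forRange (fun k' => LowProgress S fun i e => i < k ∨ (i = k ∧ e < k')) rfl rfl
      (by decide) (by rw [hf 0 rfl, h1]; exact hm) ?_ ?_ ?_ ?_
    · exact h.congr (by simp) rfl rfl rfl
    · exact fun k σ' x h => h.congr (by simp) (by simp) (by simp) (by simp)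
    · intro k' σ₂ hk' hf₂ hc₂ h₂
      rw [hf 0 rfl, h1] at hk'
      have hc₁ : σ₂ 11 0 = k := by rw [hf₂ 11 rfl, hc]
      have e00 : σ₂ 0 0 = S.n := by rw [hf₂ 0 rfl, hf 0 rfl, h0]
      have e01 : σ₂ 0 1 = S.m := by rw [hf₂ 0 rfl, hf 0 rfl, h1]
      have e9 : σ₂ 9 = σ 9 := (hf₂ 9 rfl).trans (hf 9 rfl)
      have hPne : ∀ i e, (i < k ∨ (i = k ∧ e < k' + 1)) ↔
          (i < k ∨ (i = k ∧ e < k')) ∨ (i = k ∧ e = k') := by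
        intro i e
        omega
      have hcond : (BExp.vle (costOf (.var 11) (.var 12)) minCost).holds ⟨σ₂, V⟩ ↔ S.low k k' := by
        simp only [BExp.holds, VExp.eval, NExp.eval, minCost, hc₁, hc₂, e01, e9, ha]
        exact hlow k k' hk hk'
      refine Runs.ite (T := 4) (fun hb => ?_) (fun hb => Runs.skip (T := 3) ?_)
      · rw [hcond] at hb
        refine Runs.set_seq ?_
        simp only [NExp.eval, hc₁, hc₂, e01]
        have e2 : ∀ i e, i < S.n → e < S.m →
            (1 ≤ Function.update (σ₂ 2) (k * S.m + k') 1 (i * S.m + e) ↔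
              S.low i e ∧ (i < k ∨ (i = k ∧ e < k' + 1))) := by
          intro i e hi he
          rw [hPne]
          by_cases heq : i = k ∧ e = k'
          · obtain ⟨rfl, rfl⟩ := heq
            simp [hb]
          · rw [Function.update_of_ne fun h => heq (cell_inj he hk' h), h₂.low i e hi he]
            tauto
        refine Runs.ite (T := 2) (fun hb' => ?_) (fun hb' => Runs.skip (T := 1) ?_)
        · simp only [BExp.holds, NExp.eval, Mem.upd_ne, ne_eq,
            OfNat.zero_ne_ofNat, OfNat.one_ne_ofNat, not_false_eq_true, Nat.reduceEqDiff, e00,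
            hc₂] at hb'
          have hfree : σ₂ 1 k' = S.n := by
            rcases h₂.own k' hk' with h | h
            · exact h.1
            · have := S.low_lt _ _ h
              omega
          refine Runs.set_seq (Runs.set (T := 0) ?_)
          have f11 : ∀ a x y (τ : Mem), a ≠ 11 → (τ.upd a x y) 11 = τ 11 :=
            fun a x y τ h => Mem.upd_ne _ _ _ h.symm
          have f12 : ∀ a x y (τ : Mem), a ≠ 12 → (τ.upd a x y) 12 = τ 12 :=
            fun a x y τ h => Mem.upd_ne _ _ _ h.symm
          simp only [NExp.eval, f11, f12, Mem.upd_ne, ne_eq, OfNat.ofNat_ne_one,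
            OfNat.one_ne_ofNat, not_false_eq_true, Nat.reduceEqDiff, hc₁, hc₂]
          refine ⟨?_, ?_, ?_⟩
          · simpa using e2
          · intro e he
            simp only [Mem.upd_ne, Mem.upd_self, ne_eq, OfNat.one_ne_ofNat, not_false_eq_true]
            rcases eq_or_ne e k' with rfl | hne
            · rw [Function.update_self]; exact Or.inr hb
            · rw [Function.update_of_ne hne]
              refine (h₂.own e he).imp_left fun h => ⟨h.1, fun l hl hP => h.2 l hl ?_⟩
              omega
          · intro u hu
            simp only [Mem.upd_ne, Mem.upd_self, ne_eq, OfNat.one_ne_ofNat, not_false_eq_true]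
            rw [lows_update_free hk' hfree hb hu, ← h₂.count u hu]
            rcases eq_or_ne u k with rfl | huk
            · simp
            · simp [huk]
        · simp only [BExp.holds, NExp.eval, Mem.upd_ne, ne_eq,
            OfNat.zero_ne_ofNat, OfNat.one_ne_ofNat, not_false_eq_true, Nat.reduceEqDiff, e00,
            hc₂, not_le] at hb'
          refine ⟨by simpa using e2, fun e he => ?_, ?_⟩
          · simp only [Mem.upd_ne, ne_eq, OfNat.one_ne_ofNat, not_false_eq_true]
            rcases eq_or_ne e k' with rfl | hne
            · exact Or.inr ((h₂.own e he).resolve_left fun h => hb'.ne h.1)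
            · refine (h₂.own e he).imp_left fun h => ⟨h.1, fun l hl hP => h.2 l hl ?_⟩
              omega
          · simpa using h₂.count
      · rw [hcond] at hb
        refine ⟨fun i e hi he => ?_, fun e he => ?_, h₂.count⟩
        · rw [h₂.low i e hi he, hPne]
          by_cases heq : i = k ∧ e = k'
          · obtain ⟨rfl, rfl⟩ := heq
            simp [hb]
          · tauto
        · refine (h₂.own e he).imp_left fun h => ⟨h.1, fun l hl hP => ?_⟩
          rcases (hPne l e).1 hP with hP | ⟨rfl, rfl⟩
          · exact h.2 l hl hP
          · exact hb
    · intro σ' _ h'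
      rw [hf 0 rfl, h1] at h'
      refine h'.congr (fun i e hi he => ?_) rfl rfl rfl
      omega
  · intro σ' _ h
    rw [h0] at h
    exact h.congr (by simp +contextual) rfl rfl rfl

end ChoreProgram

namespace ChoreInstance

variable {F : Type} [Field F] [LinearOrder F] {n m : ℕ}

theorem inputStore_weight (I : ChoreInstance F n m) (i : Fin n) :
    I.inputStore.val 0 i = I.weight i := by
  simp [inputStore]

theorem inputStore_cost (I : ChoreInstance F n m) (i : Fin n) (e : Fin m) :
    I.inputStore.val 1 (i * m + e) = I.cost i e := by
  have hlt : (i : ℕ) * m + e < n * m := by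
    calc (i : ℕ) * m + e < i * m + m := by omega
      _ = (i + 1) * m := by ring
      _ ≤ n * m := Nat.mul_le_mul_right _ i.2
  simp only [inputStore, one_ne_zero, if_false, if_true, dif_pos hlt]
  have h1 : Fin.divNat (⟨(i : ℕ) * m + e, hlt⟩ : Fin (n * m)) = i := by
    ext
    simp only [Fin.divNat]
    rw [mul_comm, Nat.mul_add_div (by omega), Nat.div_eq_of_lt e.2, add_zero]
  have h2 : Fin.modNat (⟨(i : ℕ) * m + e, hlt⟩ : Fin (n * m)) = e := by
    ext
    simp [Fin.modNat, Nat.mod_eq_of_lt e.2]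
  rw [h1, h2]

theorem inputStore_cost_nonneg (I : ChoreInstance F n m) (k : ℕ) : 0 ≤ I.inputStore.val 1 k := by
  simp only [inputStore, one_ne_zero, if_false, if_true]
  split_ifs
  · exact I.cost_nonneg _ _
  · exact le_rfl

theorem inputStore_idx_le (I : ChoreInstance F n m) (a k : ℕ) : I.inputStore.idx a k ≤ n + m := by
  simp only [inputStore]
  split_ifs <;> omega

theorem pos_of_weights (I : ChoreInstance F n m) : 0 < n := by
  rcases Nat.eq_zero_or_pos n with rfl | h
  · simpa using I.weight_sum
  · exact h

end ChoreInstance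

namespace ChoreProgram

open RAM

variable {F : Type} [Field F] [LinearOrder F] [IsStrictOrderedRing F]

/-- A bound for the number of steps for at most `N` agents and at most `N` items. -/
def mainSteps (N : ℕ) : ℕ :=
  forSteps N (forSteps N (3 + 3)) + (forSteps N 1 + (forSteps N (forSteps N 5) + (balanceSteps N +
    (forSteps N (minSteps N + 2 + 1) + improveSteps N))))

theorem runs_main {n m N : ℕ} (I : ChoreInstance F n m) (hI : I.BiValued) (hn : n ≤ N)
    (hm : m ≤ N) : Runs I.inputStore.val main I.inputStore.idx (mainSteps N) fun σ' =>
      ∃ X : Allocation n m, (∀ e : Fin m, σ' 1 e = X e) ∧ I.WEF1 X ∧ I.ParetoOptimal X := by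
  have hpos := I.pos_of_weights
  have h00 : I.inputStore.idx 0 0 = n := by simp [ChoreInstance.inputStore]
  have h01 : I.inputStore.idx 0 1 = m := by simp [ChoreInstance.inputStore]
  have hz : ∀ a k, a ≠ 0 → I.inputStore.idx a k = 0 := by
    intro a k ha
    simp [ChoreInstance.inputStore, ha]
  refine Runs.seq (runs_findCosts h00 h01 hn hm hpos (fun k => hz 9 k (by decide))
    (fun k => hz 10 k (by decide))) fun σ₁ hf₁ hext => ?_
  have hle : I.inputStore.val 1 (σ₁ 9 0 * m + σ₁ 9 1) ≤
      I.inputStore.val 1 (σ₁ 10 0 * m + σ₁ 10 1) := by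
    rcases Nat.eq_zero_or_pos m with rfl | hmpos
    · simp [ChoreInstance.inputStore]
    · have h9 := (hext.lt hmpos).1
      exact (hext.le _ _ h9.1 h9.2 trivial).2
  let S : BivaluedData F :=
    { n := n
      m := m
      w := I.inputStore.val 0
      a := I.inputStore.val 1 (σ₁ 9 0 * m + σ₁ 9 1)
      b := I.inputStore.val 1 (σ₁ 10 0 * m + σ₁ 10 1)
      low := fun i e => i < n ∧ I.inputStore.val 1 (i * m + e) ≤
        I.inputStore.val 1 (σ₁ 9 0 * m + σ₁ 9 1)
      n_pos := hpos
      w_pos := fun i hi => by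
        have := I.inputStore_weight ⟨i, hi⟩
        rw [this]
        exact I.weight_pos _
      a_nonneg := I.inputStore_cost_nonneg _
      a_le_b := hle
      low_lt := fun i e h => h.1 }
  have hSa : ∀ (i : Fin S.n) (e : Fin S.m), S.low i e → I.cost i e = S.a := by
    intro i e h
    rw [← I.inputStore_cost]
    exact le_antisymm h.2 (hext.le i e i.2 e.2 trivial).1
  have hSb : ∀ (i : Fin S.n) (e : Fin S.m), ¬ S.low i e → I.cost i e = S.b := by
    intro i e h
    have h1 : S.a < I.cost i e := by
      rw [← I.inputStore_cost]
      exact not_le.1 fun h' => h ⟨i.2, h'⟩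
    have h2 : I.cost i e ≤ S.b := by
      rw [← I.inputStore_cost]
      exact (hext.le i e i.2 e.2 trivial).2
    obtain ⟨⟨h9, h9'⟩, h10, h10'⟩ := hext.lt (e.pos)
    have ha := I.inputStore_cost ⟨_, h9⟩ ⟨_, h9'⟩
    have hb := I.inputStore_cost ⟨_, h10⟩ ⟨_, h10'⟩
    change S.a = _ at ha
    change S.b = _ at hb
    obtain ⟨a, b, -, -, hab⟩ := hI
    have c1 := hab ⟨_, h9⟩ ⟨_, h9'⟩
    have c2 := hab ⟨_, h10⟩ ⟨_, h10'⟩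
    have c3 := hab i e
    rw [← ha] at c1
    rw [← hb] at c2
    have h3 := h1.trans_le h2
    rcases c3 with c3 | c3 <;> rcases c1 with c1 | c1 <;> rcases c2 with c2 | c2 <;>
      simp only [c1, c2, c3, lt_irrefl] at h1 h3 ⊢
  have hn₁ : σ₁ 0 = I.inputStore.idx 0 := hf₁ 0 rfl
  refine Runs.seq (runs_clear (S := S) (by rw [hn₁]; exact h00) (by rw [hn₁]; exact h01) hm)
    fun σ₂ hf₂ hclear => ?_
  have hn₂ : σ₂ 0 = I.inputStore.idx 0 := (hf₂ 0 rfl).trans hn₁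
  have h9₂ : σ₂ 9 = σ₁ 9 := hf₂ 9 rfl
  have h10₂ : σ₂ 10 = σ₁ 10 := hf₂ 10 rfl
  refine Runs.seq (runs_assignLow (S := S) (by rw [hn₂]; exact h00) (by rw [hn₂]; exact h01) hn hm
    (by rw [h9₂]) (fun i e hi he => ⟨fun h => ⟨hi, h⟩, fun h => h.2⟩) hclear
    (fun k => by rw [hf₂ 2 rfl, hf₁ 2 rfl, hz 2 k (by decide)])
    (fun k => by rw [hf₂ 4 rfl, hf₁ 4 rfl, hz 4 k (by decide)])) fun σ₃ hf₃ hlow => ?_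
  have hn₃ : σ₃ 0 = I.inputStore.idx 0 := (hf₃ 0 rfl).trans hn₂
  have hE₃ : Env S I.inputStore.val σ₃ :=
    ⟨by rw [hn₃]; exact h00, by rw [hn₃]; exact h01, fun _ _ => rfl,
      by rw [hf₃ 9 rfl, h9₂], by rw [hf₃ 10 rfl, h10₂],
      fun i e hi he => by simpa using hlow.low i e hi he⟩
  have hlow₃ : S.LowAllocation (σ₃ 1) := fun e he => (hlow.own e he).imp_left fun h =>
    ⟨h.1, fun l hl => h.2 l (S.low_lt _ _ hl) trivial hl⟩
  refine Runs.seq (runs_balance hE₃ hn hm hlow₃ hlow.count) fun σ₄ hf₄ ⟨hlow₄, hx₄, hbal⟩ => ?_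
  have hE₄ : Env S I.inputStore.val σ₄ := hE₃.congr (hf₄ 0 rfl) (hf₄ 2 rfl) (hf₄ 9 rfl)
    (hf₄ 10 rfl)
  have hR₄ : Rep S (fun _ => False) σ₄ := by
    refine ⟨fun i hi => ?_, hx₄, fun i hi => ?_⟩
    · rw [hf₄ 3 rfl, hf₃ 3 rfl, hf₂ 3 rfl, hf₁ 3 rfl, hz 3 i (by decide)]
      simp
    · rw [hf₄ 5 rfl, hf₃ 5 rfl, hf₂ 5 rfl, hf₁ 5 rfl, hz 5 i (by decide), hlow₄.dear_eq_zero hi]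
  refine Runs.seq (runs_fill hE₄ hn hm (hlow₄.inv hbal) hR₄) fun σ₅ hf₅ ⟨hI₅, hR₅, hown₅⟩ => ?_
  have hE₅ : Env S I.inputStore.val σ₅ := hE₄.congr (hf₅ 0 rfl) (hf₅ 2 rfl) (hf₅ 9 rfl)
    (hf₅ 10 rfl)
  refine (runs_improve hE₅ hn hm hI₅ hR₅ hown₅).mono le_rfl ?_
  rintro σ₆ - ⟨B, hI₆, hown₆, hfair⟩
  exact ⟨fun e => ⟨σ₆ 1 e, hown₆ e e.2⟩, fun _ => rfl, hI₆.wef1_and_paretoOptimal (S := S) I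
    I.inputStore_weight hSa hSb (fun _ => rfl) hfair.1 hfair.2⟩

/-- A bound for the running time for at most `N` agents and items and numbers of size `L`. -/
def timeBound (N L : ℕ) : ℕ :=
  mainSteps N *
    (main.nodes * (1 + 4 ^ main.nodes * (L + main.nodes * (N + mainSteps N + 2) + 2)))

theorem computesWithin_main {n m N L : ℕ} {size : F → ℕ} (hsize : SizeBound size)
    (I : ChoreInstance F n m) (hI : I.BiValued) (hN : n + m ≤ N)
    (hL : ∀ a k, size (I.inputStore.val a k) ≤ L) :
    ∃ X : Allocation n m, I.ComputesWithin size main X (timeBound N L) ∧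
      I.WEF1 X ∧ I.ParetoOptimal X := by
  obtain ⟨σ', t, hs, ht, X, hX, hfair⟩ := runs_main I hI (N := N) (by omega) (by omega)
  obtain ⟨-, t', hexec, ht'⟩ := hs.exists_exec hsize hL (P := main.nodes) rfl le_rfl
    (N + mainSteps N) N (fun a k => (I.inputStore_idx_le a k).trans hN) (by omega)
  refine ⟨X, ⟨_, t', hexec, ht'.trans ?_, hX⟩, hfair⟩
  unfold timeBound opBound
  have : Nat.size (N + mainSteps N + 2) ≤ N + mainSteps N + 2 :=
    Nat.size_le.2 Nat.lt_two_pow_self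
  gcongr

/-! ### Polynomial bounds -/

/-- The function `f` is the evaluation of a polynomial. -/
def IsPolynomial (f : ℕ → ℕ) : Prop := ∃ q : Polynomial ℕ, ∀ x, q.eval x = f x

namespace IsPolynomial

variable {f g : ℕ → ℕ}

theorem const (c : ℕ) : IsPolynomial fun _ => c := ⟨Polynomial.C c, by simp⟩

theorem id : IsPolynomial fun x => x := ⟨Polynomial.X, by simp⟩

theorem add : IsPolynomial f → IsPolynomial g → IsPolynomial fun x => f x + g x
  | ⟨p, hp⟩, ⟨q, hq⟩ => ⟨p + q, by simp [hp, hq]⟩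

theorem mul : IsPolynomial f → IsPolynomial g → IsPolynomial fun x => f x * g x
  | ⟨p, hp⟩, ⟨q, hq⟩ => ⟨p * q, by simp [hp, hq]⟩

theorem forSteps (h : IsPolynomial f) : IsPolynomial fun x => forSteps x (f x) :=
  (id.mul (h.add (const 2))).add (const 2)

theorem loopSteps (hg : IsPolynomial g) (h : IsPolynomial f) :
    IsPolynomial fun x => loopSteps (g x) (f x) :=
  (hg.mul (h.add (const 1))).add (const 1)

end IsPolynomial

open IsPolynomial in
theorem isPolynomial_pathSteps : IsPolynomial pathSteps :=
  (const 1).forSteps.add ((((id.add (const 1)).loopSteps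
    ((((const 5).forSteps.add (const 1)).forSteps).add (const 1))).add (const 1)).add (const 1))

open IsPolynomial in
theorem isPolynomial_minSteps : IsPolynomial minSteps := (const 2).forSteps.add (const 1)

open IsPolynomial in
theorem isPolynomial_transferSteps : IsPolynomial transferSteps :=
  ((id.loopSteps (const 2)).add (const 3)).add (const 1)

open IsPolynomial in
theorem isPolynomial_balanceSteps : IsPolynomial balanceSteps :=
  (((id.mul (id.mul (id.mul (id.add (const 1))))).add (const 1)).loopSteps
    ((((isPolynomial_pathSteps.add (isPolynomial_transferSteps.add (const 1)).forSteps).add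
      (const 1)).forSteps).add (const 1))).add (const 1)

open IsPolynomial in
theorem isPolynomial_improveSteps : IsPolynomial improveSteps := by
  have hraise : IsPolynomial raiseSteps := (isPolynomial_pathSteps.add (const (3 + 1))).forSteps
  have hgive : IsPolynomial giveSteps := (const 2).forSteps.add (const 3)
  exact ((((id.mul (id.add (const 1))).add id).add (const 1)).loopSteps
    ((isPolynomial_minSteps.add (((const 3).forSteps.add (const 1)).add
      (((((hraise.add hgive).add (const 1)).add (const 1)).add (const 1)).add (const 1)))).add
        (const 1))).add (const 1)

open IsPolynomial in
theorem isPolynomial_mainSteps : IsPolynomial mainSteps :=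
  (const (3 + 3)).forSteps.forSteps.add ((const 1).forSteps.add ((const 5).forSteps.forSteps.add
    (isPolynomial_balanceSteps.add
      (((isPolynomial_minSteps.add (const 2)).add (const 1)).forSteps.add
        isPolynomial_improveSteps))))

open IsPolynomial in
theorem isPolynomial_timeBound {L : ℕ → ℕ} (hL : IsPolynomial L) :
    IsPolynomial fun x => timeBound x (L x) :=
  isPolynomial_mainSteps.mul ((const _).mul ((const 1).add ((const _).mul
    ((hL.add ((const _).mul ((id.add isPolynomial_mainSteps).add (const 2)))).add (const 2)))))

end ChoreProgram

/-! ### Sizes of rational numbers -/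

theorem Nat.size_mul_le (x y : ℕ) : Nat.size (x * y) ≤ Nat.size x + Nat.size y := by
  rw [Nat.size_le, pow_add]
  exact Nat.mul_lt_mul'' (Nat.lt_size_self x) (Nat.lt_size_self y)

theorem ratBits_le_of_eq_div {z : ℚ} {p : ℤ} {q s t : ℕ} (hq : q ≠ 0) (h : z = p / q)
    (hp : Nat.size p.natAbs ≤ s) (ht : Nat.size q ≤ t) : ratBits z ≤ 1 + s + t := by
  have hz : z = Rat.divInt p q := by rw [h, Rat.divInt_eq_div]; simp
  have hq' : (q : ℤ) ≠ 0 := by exact_mod_cast hq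
  have hden : z.den ≤ q := by
    have : (z.den : ℤ) ∣ q := by rw [hz]; exact Rat.den_dvd p q
    exact Nat.le_of_dvd (Nat.pos_of_ne_zero hq) (by exact_mod_cast this)
  have hnum : z.num.natAbs ≤ p.natAbs := by
    rcases eq_or_ne p 0 with rfl | hp0
    · simp [h]
    · have : z.num ∣ p := by rw [hz]; exact Rat.num_dvd p hq'
      exact Nat.le_of_dvd (Int.natAbs_pos.2 hp0) (Int.natAbs_dvd_natAbs.2 this)
  unfold ratBits
  have h1 := (Nat.size_le_size hnum).trans hp
  have h2 := (Nat.size_le_size hden).trans ht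
  omega

theorem Nat.size_add_le (x y : ℕ) : Nat.size (x + y) ≤ max (Nat.size x) (Nat.size y) + 1 := by
  rw [Nat.size_le, pow_succ]
  have h1 := (Nat.lt_size_self x).trans_le
    (Nat.pow_le_pow_right two_pos (le_max_left (Nat.size x) (Nat.size y)))
  have h2 := (Nat.lt_size_self y).trans_le
    (Nat.pow_le_pow_right two_pos (le_max_right (Nat.size x) (Nat.size y)))
  omega

theorem sizeBound_ratBits : RAM.SizeBound ratBits := by
  have key : ∀ x y z : ℚ, z.num.natAbs = y.num.natAbs → z.den = y.den →
      ratBits (x + z) ≤ 2 * (ratBits x + ratBits y) := by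
    intro x y z hn hd
    have h1 : x + z = ((x.num * z.den + z.num * x.den : ℤ) : ℚ) / ((x.den * z.den : ℕ) : ℚ) := by
      have hx : (x.den : ℚ) ≠ 0 := by exact_mod_cast x.den_nz
      have hz : (z.den : ℚ) ≠ 0 := by exact_mod_cast z.den_nz
      conv_lhs => rw [← Rat.num_div_den x, ← Rat.num_div_den z]
      push_cast
      field_simp
    have h2 : Nat.size (x.num * z.den + z.num * x.den : ℤ).natAbs ≤
        Nat.size x.num.natAbs + Nat.size y.den + (Nat.size y.num.natAbs + Nat.size x.den) + 1 := by
      refine (Nat.size_le_size (Int.natAbs_add_le _ _)).trans ((Nat.size_add_le _ _).trans ?_)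
      rw [Int.natAbs_mul, Int.natAbs_mul, Int.natAbs_natCast, Int.natAbs_natCast, hn, hd]
      have h3 := Nat.size_mul_le x.num.natAbs y.den
      have h4 := Nat.size_mul_le y.num.natAbs x.den
      omega
    have h3 : Nat.size (x.den * z.den) ≤ Nat.size x.den + Nat.size y.den := by
      rw [hd]; exact Nat.size_mul_le _ _
    refine (ratBits_le_of_eq_div (Nat.mul_ne_zero x.den_nz z.den_nz) h1 h2 h3).trans ?_
    unfold ratBits
    omega
  refine ⟨fun x y => key x y y rfl rfl, fun x y => ?_, fun x y => ?_, fun k => ?_⟩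
  · rw [sub_eq_add_neg]
    exact key x y (-y) (by simp) (by simp)
  · have h1 : x * y = ((x.num * y.num : ℤ) : ℚ) / ((x.den * y.den : ℕ) : ℚ) := by
      conv_lhs => rw [← Rat.num_div_den x, ← Rat.num_div_den y]
      push_cast
      rw [div_mul_div_comm]
    have h2 : Nat.size (x.num * y.num).natAbs ≤ Nat.size x.num.natAbs + Nat.size y.num.natAbs := by
      rw [Int.natAbs_mul]
      exact Nat.size_mul_le _ _
    refine (ratBits_le_of_eq_div (Nat.mul_ne_zero x.den_nz y.den_nz) h1 h2
      (Nat.size_mul_le _ _)).trans ?_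
    unfold ratBits
    omega
  · simp [ratBits]
    omega

theorem ChoreInstance.ratBits_inputStore_le {n m : ℕ} (I : ChoreInstance ℚ n m) (a k : ℕ) :
    ratBits (I.inputStore.val a k) ≤ I.bitLength + 2 := by
  have h0 : ratBits 0 ≤ I.bitLength + 2 := by simp [ratBits]
  simp only [inputStore]
  split_ifs with h1 h2 h3 h4
  · have := Finset.single_le_sum (f := fun i => ratBits (I.weight i)) (fun _ _ => Nat.zero_le _)
      (Finset.mem_univ (⟨k, h2⟩ : Fin n))
    simp only [bitLength]
    omega
  · exact h0
  · set i := Fin.divNat (⟨k, h4⟩ : Fin (n * m))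
    set e := Fin.modNat (⟨k, h4⟩ : Fin (n * m))
    have h5 := Finset.single_le_sum (f := fun e => ratBits (I.cost i e)) (fun _ _ => Nat.zero_le _)
      (Finset.mem_univ e)
    have h6 := Finset.single_le_sum (f := fun i => ∑ e, ratBits (I.cost i e))
      (fun _ _ => Nat.zero_le _) (Finset.mem_univ i)
    simp only [bitLength]
    omega
  · exact h0
  · exact h0

/-- One program finds a WEF1 and Pareto optimal allocation of every bi-valued chore instance with
weighted agents. For real data its running time, with unit cost for operations on reals, is
polynomial in the numbers of agents and items; for rational data its bit running time is
polynomial in the length of the input. -/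
theorem theorem4p1 :
    ∃ p : RAM.Prog,
      (∃ q : Polynomial ℕ, ∀ (n m : ℕ) (I : ChoreInstance ℝ n m), I.BiValued →
        ∃ X : Allocation n m, I.ComputesWithin (fun _ => 0) p X (q.eval (n + m)) ∧
          I.WEF1 X ∧ I.ParetoOptimal X) ∧
      (∃ q : Polynomial ℕ, ∀ (n m : ℕ) (I : ChoreInstance ℚ n m), I.BiValued →
        ∃ X : Allocation n m, I.ComputesWithin ratBits p X (q.eval I.bitLength) ∧
          I.WEF1 X ∧ I.ParetoOptimal X) := by
  refine ⟨ChoreProgram.main, ?_, ?_⟩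
  · obtain ⟨q, hq⟩ := ChoreProgram.isPolynomial_timeBound (ChoreProgram.IsPolynomial.const 0)
    refine ⟨q, fun n m I hI => ?_⟩
    rw [hq]
    exact ChoreProgram.computesWithin_main ⟨by simp, by simp, by simp, by simp⟩ I hI le_rfl
      (by simp)
  · obtain ⟨q, hq⟩ := ChoreProgram.isPolynomial_timeBound
      (ChoreProgram.IsPolynomial.id.add (ChoreProgram.IsPolynomial.const 2))
    refine ⟨q, fun n m I hI => ?_⟩
    rw [hq]
    refine ChoreProgram.computesWithin_main sizeBound_ratBits I hI ?_ I.ratBits_inputStore_le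
    unfold ChoreInstance.bitLength
    omega
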